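/- Let $\mathbb{k}$ be a field of characteristic $0$ and let $G$ be a finite group such that every irreducible representation of $G$ over $\mathbb{k}$ is absolutely irreducible, i.e. has only scalar endomorphisms (for instance, $\mathbb{k}$ algebraically closed). All representations and vector spaces are finite-dimensional over $\mathbb{k}$, and $K(-)$ denotes the Grothendieck group. A *PSH algebra* is a connected graded Hopf algebra $A=\bigoplus_{n\ge 0}A_n$ over $\mathbb{Z}$ with an inner product and a distinguished orthonormal $\mathbb{Z}$-basis of homogeneous elements, finite in each degree, such that multiplication and comultiplication are adjoint to each other and carry elements with non-negative coefficients to elements with non-negative coefficients. A *map of PSH algebras* is a homomorphism of graded Hopf algebras that preserves the inner product and positivity. Let $S_n[G]=G^n\rtimes S_n$ be the wreath product. The group $R_S[G]=\bigoplus_{n\ge0}K(\mathrm{Rep}(S_n[G]))$ is a PSH algebra, graded by $n$, with product $[\rho]\cdot[\sigma]=\left[\mathrm{Ind}_{S_m[G]\times S_n[G]}^{S_{m+n}[G]}(\rho\boxtimes\sigma)\right]$, unit the class of the trivial representation of $S_0[G]$, inner product $\langle[\rho],[\sigma]\rangle=\dim\mathrm{Hom}_{S_n[G]}(\rho,\sigma)$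 for $\rho,\sigma\in\mathrm{Rep}(S_n[G])$ (and $0$ if $\rho,\sigma$ are representations of $S_m[G],S_n[G]$ with $m\ne n$), distinguished basis the classes of the irreducible representations, and comultiplication the adjoint of the product. Let $\mathcal{P}_G$ be the category of $G$-equivariant polynomial functors, i.e. of functors $F$ from $\mathrm{Rep}(G)$ to finite-dimensional vector spaces for which the maps $\mathrm{Hom}_G(V,W)\to\mathrm{Hom}_{\mathbb{k}}(F(V),F(W))$ are polynomial, of degree bounded independently of $V,W$. The group $K(\mathcal{P}_G)$ is a PSH algebra with product $[F]\cdot[H]=[V\mapsto F(V)\otimes H(V)]$, unit the class of the constant functor $\mathbb{k}$, inner product $\langle[F],[H]\rangle=\dim\mathrm{Hom}_{\mathcal{P}_G}(F,H)$, degree $n$ part spanned by the classes of the functors that are homogeneous of degree $n$, distinguished basis the classes of the simple objects, and comultiplication the adjoint of the product. Then there is a map of PSH algebras $R_S[G]\to K(\mathcal{P}_G)$ with $[\rho]\mapsto[L_\rho]$, $L_\rho(V)=\mathrm{Hom}_{S_n[G]}(\rho,V^{\otimes n})$, for every $n$ and every representation $\rho$ of $S_n[G]$, and this map is an isomorphism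 of PSH algebras. Here $S_n[G]$ acts on $V^{\otimes n}$ by $(g,\pi)(v_1\otimes\cdots\otimes v_n)=g_1v_{\pi^{-1}(1)}\otimes\cdots\otimes g_nv_{\pi^{-1}(n)}$. -/

import Mathlib

open CategoryTheory MonoidalCategory
open scoped TensorProduct DirectSum

universe u v w

noncomputable section

namespace PSH

/-! ### Positive self-adjoint Hopf algebras -/

/-- A positive self-adjoint Hopf algebra: a connected graded Hopf algebra over `ℤ` with an inner
product and a distinguished basis of homogeneous elements, finite in each degree and orthonormal,
such that multiplication and comultiplication are adjoint to each other and positive. -/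
structure PSHAlgebra : Type (v + 1) where
  carrier : Type v
  [ring : Ring carrier]
  [coalgebra : Coalgebra ℤ carrier]
  counit_one : Coalgebra.counit (R := ℤ) (1 : carrier) = 1
  counit_mul : ∀ x y : carrier, Coalgebra.counit (R := ℤ) (x * y) =
    Coalgebra.counit (R := ℤ) x * Coalgebra.counit (R := ℤ) y
  comul_one : Coalgebra.comul (R := ℤ) (1 : carrier) = 1
  comul_mul : ∀ x y : carrier, Coalgebra.comul (R := ℤ) (x * y) =
    Coalgebra.comul (R := ℤ) x * Coalgebra.comul (R := ℤ) y
  antipode : carrier →ₗ[ℤ] carrier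
  mul_antipode_left : ∀ x : carrier,
    LinearMap.mul' ℤ carrier (antipode.rTensor carrier (Coalgebra.comul (R := ℤ) x)) =
      algebraMap ℤ carrier (Coalgebra.counit (R := ℤ) x)
  mul_antipode_right : ∀ x : carrier,
    LinearMap.mul' ℤ carrier (antipode.lTensor carrier (Coalgebra.comul (R := ℤ) x)) =
      algebraMap ℤ carrier (Coalgebra.counit (R := ℤ) x)
  /-- The homogeneous components. -/
  grade : ℕ → Submodule ℤ carrier
  isInternal : DirectSum.IsInternal grade
  one_mem : (1 : carrier) ∈ grade 0
  mul_mem : ∀ {m n : ℕ} {x y : carrier}, x ∈ grade m → y ∈ grade n → x * y ∈ grade (m + n)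
  comul_mem : ∀ {n : ℕ} {x : carrier}, x ∈ grade n → Coalgebra.comul (R := ℤ) x ∈
    ⨆ (p : ℕ × ℕ) (_ : p.1 + p.2 = n),
      LinearMap.range (TensorProduct.map (grade p.1).subtype (grade p.2).subtype)
  counit_grade : ∀ {n : ℕ} {x : carrier}, n ≠ 0 → x ∈ grade n → Coalgebra.counit (R := ℤ) x = 0
  /-- Together with `counit_one`: unit and counit are mutually inverse between `ℤ` and degree 0. -/
  connected : ∀ {x : carrier}, x ∈ grade 0 →
    algebraMap ℤ carrier (Coalgebra.counit (R := ℤ) x) = x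
  /-- The inner product. -/
  inner : LinearMap.BilinForm ℤ carrier
  /-- The distinguished basis. -/
  basis : Set carrier
  basis_homogeneous : ∀ x ∈ basis, ∃ n, x ∈ grade n
  basis_finite : ∀ n, (basis ∩ (grade n : Set carrier)).Finite
  basis_span : ∀ n, Submodule.span ℤ (basis ∩ (grade n : Set carrier)) = grade n
  inner_self : ∀ x ∈ basis, inner x x = 1
  inner_ne : ∀ x ∈ basis, ∀ y ∈ basis, x ≠ y → inner x y = 0
  selfAdjoint : ∀ (x y z : carrier),
    inner (x * y) z = (inner.tmul inner) (x ⊗ₜ[ℤ] y) (Coalgebra.comul (R := ℤ) z)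
  mul_pos : ∀ x ∈ basis, ∀ y ∈ basis, x * y ∈ AddSubmonoid.closure basis
  comul_pos : ∀ x ∈ basis, Coalgebra.comul (R := ℤ) x ∈
    AddSubmonoid.closure {t : carrier ⊗[ℤ] carrier | ∃ a ∈ basis, ∃ b ∈ basis, t = a ⊗ₜ[ℤ] b}

namespace PSHAlgebra

instance : CoeSort PSHAlgebra.{v} (Type v) := ⟨PSHAlgebra.carrier⟩

instance (A : PSHAlgebra.{v}) : Ring A := A.ring

instance (A : PSHAlgebra.{v}) : Coalgebra ℤ A := A.coalgebra

/-- The elements with non-negative coefficients in the distinguished basis. -/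
def positive (A : PSHAlgebra.{v}) : AddSubmonoid A := AddSubmonoid.closure A.basis

/-- The Hopf algebra underlying a PSH algebra, as a Hopf algebra in the sense of Mathlib. -/
abbrev hopfAlgebra (A : PSHAlgebra.{v}) : HopfAlgebra ℤ A where
  __ := Bialgebra.mk' ℤ A A.counit_one (A.counit_mul _ _) A.comul_one (A.comul_mul _ _)
  antipode := A.antipode
  mul_antipode_rTensor_comul := LinearMap.ext A.mul_antipode_left
  mul_antipode_lTensor_comul := LinearMap.ext A.mul_antipode_right

end PSHAlgebra

/-- A map of PSH algebras: a homomorphism of Hopf algebras that preserves the grading, the inner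
product and positivity. -/
structure PSHHom (A : PSHAlgebra.{v}) (B : PSHAlgebra.{w}) where
  toBialgHom : A →ₐc[ℤ] B
  map_grade : ∀ (n : ℕ) (x : A), x ∈ A.grade n → toBialgHom x ∈ B.grade n
  map_inner : ∀ x y : A, B.inner (toBialgHom x) (toBialgHom y) = A.inner x y
  map_positive : ∀ x ∈ A.positive, toBialgHom x ∈ B.positive

instance (A : PSHAlgebra.{v}) (B : PSHAlgebra.{w}) : CoeFun (PSHHom A B) (fun _ => A → B) :=
  ⟨fun f => f.toBialgHom⟩

/-- A map of PSH algebras is an isomorphism if it has an inverse map of PSH algebras. -/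
def PSHHom.IsIsomorphism {A : PSHAlgebra.{v}} {B : PSHAlgebra.{w}} (f : PSHHom A B) : Prop :=
  ∃ g : PSHHom B A, Function.LeftInverse g f ∧ Function.RightInverse g f

/-! ### Grothendieck groups -/

/-- The Grothendieck group: the free abelian group on the objects, modulo `[X₂] = [X₁] + [X₃]` for
every short exact sequence `0 ⟶ X₁ ⟶ X₂ ⟶ X₃ ⟶ 0`. -/
def K0 (C : Type u) [Category.{v} C] [Preadditive C] : Type u :=
  FreeAbelianGroup C ⧸ AddSubgroup.closure
    {x : FreeAbelianGroup C | ∃ S : ShortComplex C, S.ShortExact ∧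
      x = FreeAbelianGroup.of S.X₂ - FreeAbelianGroup.of S.X₁ - FreeAbelianGroup.of S.X₃}

instance (C : Type u) [Category.{v} C] [Preadditive C] : AddCommGroup (K0 C) :=
  inferInstanceAs (AddCommGroup (FreeAbelianGroup C ⧸ AddSubgroup.closure
    {x : FreeAbelianGroup C | ∃ S : ShortComplex C, S.ShortExact ∧
      x = FreeAbelianGroup.of S.X₂ - FreeAbelianGroup.of S.X₁ - FreeAbelianGroup.of S.X₃}))

/-- The class of an object in the Grothendieck group. -/
def K0.cls {C : Type u} [Category.{v} C] [Preadditive C] (X : C) : K0 C :=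
  QuotientAddGroup.mk (FreeAbelianGroup.of X)

/-! ### Wreath products and their representations -/

/-- The wreath product `Sₙ[G] = Gⁿ ⋊ Sₙ`, where `π` sends `(gᵢ)ᵢ` to `(g_{π⁻¹ i})ᵢ`. -/
abbrev Wreath (G : Type u) [Group G] (n : ℕ) : Type u :=
  (Fin n → G) ⋊[mulAutArrow] Equiv.Perm (Fin n)

instance (G : Type u) [Group G] [Finite G] (n : ℕ) : Finite (Wreath G n) :=
  Finite.of_equiv _ SemidirectProduct.equivProd.symm

section Groups

variable (G : Type u) [Group G]

/-- The standard embedding `Sₘ[G] × Sₙ[G] → Sₘ₊ₙ[G]`. -/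
def wreathIncl (m n : ℕ) : Wreath G m × Wreath G n →* Wreath G (m + n) where
  toFun x := ⟨Fin.append x.1.left x.2.left,
    finSumFinEquiv.permCongr (Equiv.sumCongr x.1.right x.2.right)⟩
  map_one' := by
    ext i
    · refine Fin.addCases (fun i => ?_) (fun i => ?_) i <;> simp
    · refine Fin.addCases (fun i => ?_) (fun i => ?_) i <;> simp [Equiv.permCongr_apply]
  map_mul' x y := by
    ext i
    · change Fin.append (x.1.left * fun a => y.1.left (x.1.right.symm a))
          (x.2.left * fun a => y.2.left (x.2.right.symm a)) i =
        Fin.append x.1.left x.2.left i * Fin.append y.1.left y.2.left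
          ((finSumFinEquiv.permCongr (Equiv.sumCongr x.1.right x.2.right)).symm i)
      refine Fin.addCases (fun i => ?_) (fun i => ?_) i <;>
        simp [Equiv.permCongr, Equiv.equivCongr]
    · refine Fin.addCases (fun i => ?_) (fun i => ?_) i <;> simp [Equiv.permCongr_apply]

end Groups

section Reps

variable {k : Type u} [Field k] {G : Type u} [Group G]

/-- The external tensor product of a representation of `H₁` and a representation of `H₂`. -/
def extTensor {H₁ H₂ : Type u} [Group H₁] [Group H₂] (ρ : FDRep k H₁) (σ : FDRep k H₂) :
    Representation k (H₁ × H₂) (ρ ⊗[k] σ) :=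
  Representation.tprod (MonoidHom.comp ρ.ρ (MonoidHom.fst H₁ H₂))
    (MonoidHom.comp σ.ρ (MonoidHom.snd H₁ H₂))

/-- The representation of `Sₘ₊ₙ[G]` induced from the external tensor product `ρ ⊠ σ` on
`Sₘ[G] × Sₙ[G]`. -/
def indProd [Finite G] {m n : ℕ} (ρ : FDRep k (Wreath G m)) (σ : FDRep k (Wreath G n)) :
    FDRep k (Wreath G (m + n)) :=
  FDRep.of (Representation.ind (wreathIncl G m n) (extTensor ρ σ))

/-- The action of `Sₙ[G]` on `V^{⊗n}`:
`(g, π) (v₁ ⊗ ⋯ ⊗ vₙ) = g₁ v_{π⁻¹ 1} ⊗ ⋯ ⊗ gₙ v_{π⁻¹ n}`. -/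
def tensorPowRep (n : ℕ) (V : FDRep k G) : Representation k (Wreath G n) (⨂[k] _ : Fin n, V) where
  toFun x := PiTensorProduct.map (fun i => V.ρ (x.left i)) ∘ₗ
    (PiTensorProduct.reindex k (fun _ : Fin n => (V : Type u)) x.right).toLinearMap
  map_one' := by
    ext v
    simp [Module.End.one_apply]
    rfl
  map_mul' x y := by
    ext v
    simp [mulAutArrow]
    rfl

variable (k G) in
/-- The functor `V ↦ V^{⊗n}` from representations of `G` to representations of `Sₙ[G]`. -/
def tensorPow (n : ℕ) : FDRep k G ⥤ FDRep k (Wreath G n) where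
  obj V := FDRep.of (tensorPowRep n V)
  map {V W} f :=
    { hom := FGModuleCat.ofHom (PiTensorProduct.map (fun _ : Fin n => f.hom.hom.hom))
      comm := fun x => by
        ext : 1
        change PiTensorProduct.map (fun _ : Fin n => f.hom.hom.hom) ∘ₗ tensorPowRep n V x =
          tensorPowRep n W x ∘ₗ PiTensorProduct.map (fun _ : Fin n => f.hom.hom.hom)
        have h (g : G) (a : V) : f.hom.hom.hom (V.ρ g a) = W.ρ g (f.hom.hom.hom a) :=
          LinearMap.congr_fun (congrArg (fun q => q.hom.hom) (f.comm g)) a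
        refine PiTensorProduct.ext (MultilinearMap.ext fun v => ?_)
        simp [tensorPowRep, h] }
  map_id V := by
    ext : 2
    exact PiTensorProduct.map_id
  map_comp f g := by
    ext : 2
    exact PiTensorProduct.map_comp (fun _ => g.hom.hom.hom) (fun _ => f.hom.hom.hom)

/-! ### Polynomial functors -/

variable (k) in
/-- The `N`-valued polynomial functions of degree at most `d` in `r` variables. -/
def polyFunctions (r d : ℕ) (N : Type v) [AddCommGroup N] [Module k N] :
    Submodule k ((Fin r → k) → N) :=
  Submodule.span k {p | ∃ (e : Fin r → ℕ) (a : N), ∑ i, e i ≤ d ∧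
    p = fun c => (∏ i, c i ^ e i) • a}

variable (k) in
/-- A map between vector spaces is polynomial of degree at most `d` if, for all vectors
`v₁, …, vᵣ`, its value at `c₁ v₁ + ⋯ + cᵣ vᵣ` is a polynomial of degree at most `d` in the
scalars `c₁, …, cᵣ`. -/
def IsPolynomialMap (d : ℕ) {M : Type w} {N : Type v} [AddCommGroup M] [Module k M]
    [AddCommGroup N] [Module k N] (f : M → N) : Prop :=
  ∀ (r : ℕ) (v : Fin r → M), (fun c => f (∑ i, c i • v i)) ∈ polyFunctions k r d N

variable (k G) in
/-- A functor `F` from finite-dimensional representations of `G` to finite-dimensional vector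
spaces is polynomial if the maps `Hom_G(V, W) → Hom(F V, F W)` are polynomial, of bounded degree. -/
def isPolynomialFunctor : ObjectProperty (FDRep k G ⥤ FGModuleCat.{u} k) :=
  fun F => ∃ d : ℕ, ∀ V W : FDRep k G,
    IsPolynomialMap k d (fun f : V ⟶ W => F.map f)

variable (k G) in
/-- The category `P_G` of `G`-equivariant polynomial functors. -/
abbrev PolyFunctor := (isPolynomialFunctor k G).FullSubcategory

lemma polyFunctions_bilin {r d e : ℕ} {N₁ N₂ N : Type v} [AddCommGroup N₁] [Module k N₁]
    [AddCommGroup N₂] [Module k N₂] [AddCommGroup N] [Module k N] (B : N₁ →ₗ[k] N₂ →ₗ[k] N)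
    {p : (Fin r → k) → N₁} {q : (Fin r → k) → N₂} (hp : p ∈ polyFunctions k r d N₁)
    (hq : q ∈ polyFunctions k r e N₂) : (fun c => B (p c) (q c)) ∈ polyFunctions k r (d + e) N := by
  induction hp using Submodule.span_induction with
  | mem p hp =>
    obtain ⟨s, a, hs, rfl⟩ := hp
    induction hq using Submodule.span_induction with
    | mem q hq =>
      obtain ⟨t, b, ht, rfl⟩ := hq
      refine Submodule.subset_span ⟨s + t, B a b, ?_, ?_⟩
      · simp only [Pi.add_apply, Finset.sum_add_distrib]
        omega
      · funext c
        simp [pow_add, Finset.prod_mul_distrib, smul_smul, mul_comm]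
    | zero =>
      simp only [Pi.zero_apply, map_zero]
      exact Submodule.zero_mem _
    | add x y _ _ hx hy =>
      simp only [Pi.add_apply, map_add]
      exact Submodule.add_mem _ hx hy
    | smul a x _ hx =>
      simp only [Pi.smul_apply, (B _).map_smul]
      exact Submodule.smul_mem _ a hx
  | zero =>
    simp only [Pi.zero_apply, map_zero, LinearMap.zero_apply]
    exact Submodule.zero_mem _
  | add x y _ _ hx hy =>
    simp only [Pi.add_apply, map_add, LinearMap.add_apply]
    exact Submodule.add_mem _ hx hy
  | smul a x _ hx =>
    simp only [Pi.smul_apply, map_smul, LinearMap.smul_apply]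
    exact Submodule.smul_mem _ a hx

lemma isPolynomialMap_multilinear {n : ℕ} {M : Type w} {N : Type v} [AddCommGroup M] [Module k M]
    [AddCommGroup N] [Module k N] (f : MultilinearMap k (fun _ : Fin n => M) N) :
    IsPolynomialMap k n (fun x => f (fun _ => x)) := by
  intro r v
  have h : (fun c : Fin r → k => f (fun _ => ∑ i, c i • v i)) =
      ∑ s : Fin n → Fin r, fun c => (∏ j, c (s j)) • f (fun j => v (s j)) := by
    funext c
    rw [Finset.sum_apply, MultilinearMap.map_sum]
    exact Finset.sum_congr rfl fun s _ => MultilinearMap.map_smul_univ _ _ _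
  rw [h]
  refine Submodule.sum_mem _ fun s _ => Submodule.subset_span
    ⟨fun i => (Finset.univ.filter fun j => s j = i).card, f (fun j => v (s j)), ?_, ?_⟩
  · rw [← Finset.card_eq_sum_card_fiberwise (fun _ _ => Finset.mem_univ _)]
    simp
  · funext c
    rw [← Finset.prod_fiberwise Finset.univ s (fun j => c (s j))]
    congr 1
    refine Finset.prod_congr rfl fun i _ => ?_
    rw [Finset.prod_congr rfl (g := fun _ => c i), Finset.prod_const]
    intro j hj
    rw [(Finset.mem_filter.mp hj).2]

lemma IsPolynomialMap.comp_linear {d : ℕ} {M : Type w} {N N' : Type v} [AddCommGroup M]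
    [Module k M] [AddCommGroup N] [Module k N] [AddCommGroup N'] [Module k N'] {f : M → N}
    (hf : IsPolynomialMap k d f) (l : N →ₗ[k] N') : IsPolynomialMap k d (fun x => l (f x)) := by
  intro r v
  suffices h : polyFunctions k r d N ≤
      (polyFunctions k r d N').comap (LinearMap.compLeft l (Fin r → k)) from h (hf r v)
  refine Submodule.span_le.mpr ?_
  rintro _ ⟨e, a, he, rfl⟩
  refine Submodule.subset_span ⟨e, l a, he, ?_⟩
  funext c
  simp

instance : (isPolynomialFunctor k G).IsMonoidal where
  prop_unit := ⟨0, fun V W r v => Submodule.subset_span ⟨0, 𝟙 _, by simp, by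
    funext c
    simp⟩⟩
  prop_tensor := by
    rintro F H ⟨d, hF⟩ ⟨e, hH⟩
    exact ⟨d + e, fun V W r v => polyFunctions_bilin
      (LinearMap.mk₂ k (fun (a : F.obj V ⟶ F.obj W) (b : H.obj V ⟶ H.obj W) => a ⊗ₘ b)
        (fun _ _ _ => MonoidalPreadditive.add_tensor _ _ _)
        (fun _ _ _ => by
          simp only [MonoidalCategory.tensorHom_def, MonoidalLinear.smul_whiskerRight,
            Linear.smul_comp])
        (fun _ _ _ => MonoidalPreadditive.tensor_add _ _ _)
        (fun _ _ _ => by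
          simp only [MonoidalCategory.tensorHom_def, MonoidalLinear.whiskerLeft_smul,
            Linear.comp_smul]))
      (hF V W r v) (hH V W r v)⟩

/-- Homogeneous polynomial functors of degree `n`. -/
def IsHomogeneous (n : ℕ) (F : PolyFunctor k G) : Prop :=
  ∀ (V W : FDRep k G) (c : k) (f : V ⟶ W), F.obj.map (c • f) = c ^ n • F.obj.map f

/-- The functor `L_ρ : V ↦ Hom_{Sₙ[G]}(ρ, V^{⊗n})`. -/
def homTensorFunctor {n : ℕ} (ρ : FDRep k (Wreath G n)) : FDRep k G ⥤ FGModuleCat.{u} k where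
  obj V := FGModuleCat.of k (ρ ⟶ (tensorPow k G n).obj V)
  map f := FGModuleCat.ofHom (Linear.rightComp k ρ ((tensorPow k G n).map f))
  map_id V := by
    ext x : 3
    refine congrArg Action.Hom.hom (?_ : x ≫ (tensorPow k G n).map (𝟙 V) = x)
    rw [CategoryTheory.Functor.map_id, Category.comp_id]
  map_comp f g := by
    ext x : 3
    refine congrArg Action.Hom.hom (?_ : x ≫ (tensorPow k G n).map (f ≫ g) =
      (x ≫ (tensorPow k G n).map f) ≫ (tensorPow k G n).map g)
    rw [CategoryTheory.Functor.map_comp, Category.assoc]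

lemma isPolynomialFunctor_homTensorFunctor {n : ℕ} (ρ : FDRep k (Wreath G n)) :
    isPolynomialFunctor k G (homTensorFunctor ρ) := by
  refine ⟨n, fun V W => ?_⟩
  -- morphisms of representations, seen as linear maps
  let u (X : FDRep k (Wreath G n)) : (ρ ⟶ X) →ₗ[k] (ρ →ₗ[k] X) :=
    { toFun := fun x => x.hom.hom.hom
      map_add' := fun _ _ => rfl
      map_smul' := fun _ _ => rfl }
  have hu (X) : Function.Injective (u X) := fun x y h => by
    ext : 2
    exact h
  let A := (tensorPow k G n).obj V
  let B := (tensorPow k G n).obj W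
  let j : ((homTensorFunctor ρ).obj V ⟶ (homTensorFunctor ρ).obj W) →ₗ[k]
      ((ρ ⟶ A) →ₗ[k] (ρ →ₗ[k] B)) :=
    { toFun := fun y => u B ∘ₗ y.hom.hom
      map_add' := fun _ _ => LinearMap.comp_add _ _ _
      map_smul' := fun _ _ => rfl }
  have hj : LinearMap.ker j = ⊥ := LinearMap.ker_eq_bot.mpr fun y z h => by
    ext x : 3
    exact hu _ (LinearMap.congr_fun h x)
  obtain ⟨s, hs⟩ := LinearMap.exists_leftInverse_of_injective j hj
  let T : (A →ₗ[k] B) →ₗ[k] ((ρ ⟶ A) →ₗ[k] (ρ →ₗ[k] B)) :=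
    { toFun := fun t => (LinearMap.llcomp k ρ A B t) ∘ₗ u A
      map_add' := fun _ _ => rfl
      map_smul' := fun _ _ => rfl }
  let e : (V ⟶ W) →ₗ[k] (V →ₗ[k] W) :=
    { toFun := fun x => x.hom.hom.hom
      map_add' := fun _ _ => rfl
      map_smul' := fun _ _ => rfl }
  let P : MultilinearMap k (fun _ : Fin n => (V ⟶ W)) (A →ₗ[k] B) :=
    (PiTensorProduct.mapMultilinear k (fun _ : Fin n => (V : Type u))
      (fun _ : Fin n => (W : Type u))).compLinearMap (fun _ => e)
  have h := ((isPolynomialMap_multilinear P).comp_linear T).comp_linear s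
  have h' (f : V ⟶ W) : (homTensorFunctor ρ).map f = s (T (P fun _ => f)) := by
    have : T (P fun _ => f) = j ((homTensorFunctor ρ).map f) := rfl
    rw [this]
    exact (LinearMap.congr_fun hs _).symm
  simpa only [h'] using h

/-- `L_ρ` as an object of `P_G`. -/
def polyOfRep {n : ℕ} (ρ : FDRep k (Wreath G n)) : PolyFunctor k G :=
  ⟨homTensorFunctor ρ, isPolynomialFunctor_homTensorFunctor ρ⟩

end Reps

/-! ### The two PSH algebras -/

section Main

variable (k : Type u) [Field k] (G : Type u) [Group G]

/-- `k` is a splitting field of `G`: every irreducible representation of `G` over `k` is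
absolutely irreducible, i.e. has only scalar endomorphisms. -/
def IsSplittingField : Prop :=
  ∀ S : FDRep k G, Simple S → Module.finrank k (S ⟶ S) = 1

/-- The group `⊕ₙ K(Rep(Sₙ[G]))`. -/
abbrev WreathK : Type (u + 1) := ⨁ n : ℕ, K0 (FDRep k (Wreath G n))

variable {k G}

/-- The class in `⊕ₙ K(Rep(Sₙ[G]))` of a representation of `Sₙ[G]`. -/
def wreathCls {n : ℕ} (ρ : FDRep k (Wreath G n)) : WreathK k G :=
  DirectSum.of (fun n : ℕ => K0 (FDRep k (Wreath G n))) n (K0.cls ρ)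

/-- The identification `cl` makes `A` the PSH algebra `⊕ₙ K(Rep(Sₙ[G]))`: the product is given by
induction, the inner product by the dimensions of the `Hom`-spaces (representations of different
`Sₙ[G]` being orthogonal), the degree by `n`, and the basis by the irreducible representations.
The comultiplication is the adjoint of the product. -/
structure IsWreathPSH [Finite G] (A : PSHAlgebra.{u + 1}) (cl : WreathK k G ≃+ A) : Prop where
  one : cl (wreathCls (FDRep.of (Representation.trivial k (Wreath G 0) k))) = 1
  mul : ∀ {m n : ℕ} (ρ : FDRep k (Wreath G m)) (σ : FDRep k (Wreath G n)),
    cl (wreathCls ρ) * cl (wreathCls σ) = cl (wreathCls (indProd ρ σ))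
  inner : ∀ {n : ℕ} (ρ σ : FDRep k (Wreath G n)),
    A.inner (cl (wreathCls ρ)) (cl (wreathCls σ)) = Module.finrank k (ρ ⟶ σ)
  inner_of_ne : ∀ {m n : ℕ} (ρ : FDRep k (Wreath G m)) (σ : FDRep k (Wreath G n)), m ≠ n →
    A.inner (cl (wreathCls ρ)) (cl (wreathCls σ)) = 0
  grade : ∀ n : ℕ, A.grade n =
    Submodule.span ℤ {x | ∃ ρ : FDRep k (Wreath G n), x = cl (wreathCls ρ)}
  basis : A.basis =
    {x | ∃ (n : ℕ) (ρ : FDRep k (Wreath G n)), Simple ρ ∧ x = cl (wreathCls ρ)}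

/-- The identification `cl` makes `A` the PSH algebra `K(P_G)`: the product is given by the
pointwise tensor product of functors, the inner product by the dimensions of the `Hom`-spaces, the
grading by the homogeneous functors, and the basis by the simple objects.
The comultiplication is the adjoint of the product. -/
structure IsPolyPSH (A : PSHAlgebra.{u + 1}) (cl : K0 (PolyFunctor k G) ≃+ A) : Prop where
  one : cl (K0.cls (𝟙_ (PolyFunctor k G))) = 1
  mul : ∀ F H : PolyFunctor k G, cl (K0.cls F) * cl (K0.cls H) = cl (K0.cls (F ⊗ H))
  inner : ∀ F H : PolyFunctor k G,
    A.inner (cl (K0.cls F)) (cl (K0.cls H)) = Module.finrank k (F ⟶ H)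
  grade : ∀ n : ℕ, A.grade n =
    Submodule.span ℤ {x | ∃ F : PolyFunctor k G, IsHomogeneous n F ∧ x = cl (K0.cls F)}
  basis : A.basis = {x | ∃ F : PolyFunctor k G, Simple F ∧ x = cl (K0.cls F)}

end Main

end PSH

end

/-! Both Grothendieck rings are realized as one and the same ring of functions, and the isomorphism
becomes the identity. Let Ω be the collection of pairs (V, f) with f an endomorphism of V in Rep(G),
and let the character of a polynomial functor F be (V, f) ↦ tr F(f). Characters are additive and
turn pointwise tensor products into products. By Frobenius reciprocity and V^{⊗(m+n)} = V^{⊗m} ⊗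
V^{⊗n}, the character of L for an induction product is the product of the two characters
(`char_polyOfRep_indProd`).

Write L_i for the functors L_ρ with ρ irreducible, in all degrees. Three facts carry the proof: the
category of polynomial functors is split semisimple with simple objects L_i
(`isSplitSemisimple_poly`); the characters of the L_i are linearly independent
(`linearIndependent_char`); and the character of F at (V ⊕ W, f ⊕ g) is the sum of dim Hom(L_i ⊗
L_j, F) · χ_i(f) χ_j(g) (`char_biprod`). Direct sum on Ω therefore induces a comultiplication on the
ℤ-span of the characters. The Hopf axioms can be checked on values, and the structure constants dim
Hom(L_i ⊗ L_j, L_l) of the comultiplication are those of the product, which is self-adjointness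
(`CharData.pshAlgebra`). Both groups K are identified with this span by taking characters, and ρ and
L_ρ give the same function (`wreathEquiv_eq_polyEquiv`).

Semisimplicity: the f^{⊗n} span the equivariant maps V^{⊗n} → W^{⊗n} (`span_tensorPow_map`), so the
degree n component of F extends to all such maps (`nonempty_polyAction`). Every irreducible ρ of
S_n[G] is a retract of X^{⊗n} for X = k[G]^n (`exists_retract_tensorPow_regPow`), and the
corresponding idempotent on F(X) cuts out the multiplicity space of L_ρ.

That irreducible representations of S_n[G] have scalar endomorphisms (`isSplittingField_wreath`) is
proved by highest weights instead of a classification. If S embeds in V^{⊗n}, then Hom(S, V^{⊗n}) is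
irreducible under the Lie algebra End_G(V), a product of matrix algebras over k. Its highest weight
vector is unique up to a scalar, so each endomorphism of S multiplies it by a scalar, and it is a
monomorphism.

The formula on direct sums comes from the isotypic decomposition of V ↦ F(V ⊕ W) and the adjunction
Hom(A ⊗ B, F) = Hom(B, W ↦ Hom(A, F(- ⊕ W))) (`curryEquiv`). -/

noncomputable section

namespace PSH

universe v'

/-! ### Split semisimple categories and their Grothendieck groups -/

section K0

variable {C : Type u} [Category.{v} C] [Preadditive C]

/-- An additive invariant of a category defines a homomorphism on its Grothendieck group. -/
def K0.lift {A : Type w} [AddCommGroup A] (f : C → A)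
    (hf : ∀ S : ShortComplex C, S.ShortExact → f S.X₂ = f S.X₁ + f S.X₃) : K0 C →+ A :=
  QuotientAddGroup.lift _ (FreeAbelianGroup.lift f) <| by
    rw [AddSubgroup.closure_le]
    rintro _ ⟨S, hS, rfl⟩
    simp [hf S hS]

@[simp]
lemma K0.lift_cls {A : Type w} [AddCommGroup A] (f : C → A)
    (hf : ∀ S : ShortComplex C, S.ShortExact → f S.X₂ = f S.X₁ + f S.X₃) (X : C) :
    K0.lift f hf (K0.cls X) = f X := by
  change FreeAbelianGroup.lift f (FreeAbelianGroup.of X) = f X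
  simp

lemma K0.cls_shortExact (S : ShortComplex C) (hS : S.ShortExact) :
    K0.cls S.X₂ = K0.cls S.X₁ + K0.cls S.X₃ := by
  have : (QuotientAddGroup.mk (FreeAbelianGroup.of S.X₂ - FreeAbelianGroup.of S.X₁ -
      FreeAbelianGroup.of S.X₃) : K0 C) = 0 :=
    (QuotientAddGroup.eq_zero_iff _).2 (AddSubgroup.subset_closure ⟨S, hS, rfl⟩)
  have h2 : K0.cls S.X₂ - K0.cls S.X₁ - K0.cls S.X₃ = 0 := this
  rw [sub_sub, sub_eq_zero] at h2
  exact h2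

lemma K0.induction_on {p : K0 C → Prop} (x : K0 C) (zero : p 0) (cls : ∀ X, p (K0.cls X))
    (neg : ∀ x, p x → p (-x)) (add : ∀ x y, p x → p y → p (x + y)) : p x := by
  obtain ⟨y, rfl⟩ := QuotientAddGroup.mk_surjective x
  induction y using FreeAbelianGroup.induction_on with
  | zero => exact zero
  | of X => exact cls X
  | neg X h => exact neg _ h
  | add x y hx hy => exact add _ _ hx hy

lemma K0.hom_ext {A : Type w} [AddCommGroup A] {f g : K0 C →+ A}
    (h : ∀ X, f (K0.cls X) = g (K0.cls X)) : f = g := by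
  ext x
  induction x using K0.induction_on with
  | zero => simp
  | cls X => exact h X
  | neg x hx => simp [hx]
  | add x y hx hy => simp [hx, hy]

/-- A function on objects is split additive if it is additive on split short complexes. -/
def SplitAdditive {A : Type w} [AddCommGroup A] (f : C → A) : Prop :=
  ∀ S : ShortComplex C, S.Splitting → f S.X₂ = f S.X₁ + f S.X₃

lemma K0.splitAdditive_cls [Limits.HasZeroObject C] : SplitAdditive (K0.cls : C → K0 C) :=
  fun S hS => K0.cls_shortExact S hS.shortExact

namespace SplitAdditive

variable {A : Type w} [AddCommGroup A] {f : C → A} (hf : SplitAdditive f)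
include hf

lemma of_isZero {X : C} (hX : Limits.IsZero X) : f X = 0 := by
  have := hf (ShortComplex.mk (0 : X ⟶ X) (0 : X ⟶ X) (by simp))
    ⟨0, 0, hX.eq_of_src _ _, hX.eq_of_src _ _, hX.eq_of_src _ _⟩
  simpa using this

/-- An isomorphism is a split short complex whose first term is zero. -/
lemma of_iso [Limits.HasZeroObject C] {X Y : C} (e : X ≅ Y) : f X = f Y := by
  open ZeroObject in
  have := hf (ShortComplex.mk (0 : (0 : C) ⟶ X) e.hom (by simp))
    ⟨0, e.inv, by simp [(Limits.isZero_zero C).eq_of_src (𝟙 (0 : C)) 0], by simp, by simp⟩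
  simpa [hf.of_isZero (Limits.isZero_zero C)] using this

lemma biprod [Limits.HasBinaryBiproducts C] (X Y : C) : f (X ⊞ Y) = f X + f Y :=
  hf _ (ShortComplex.Splitting.ofHasBinaryBiproduct X Y)

end SplitAdditive

variable {I : Type w}

/-- A decomposition of `X` as a finite direct sum of objects of the family `a`. -/
structure SumDecomposition (a : I → C) (X : C) where
  T : Type
  [fin : Fintype T]
  s : T → I
  ι : ∀ t, a (s t) ⟶ X
  π : ∀ t, X ⟶ a (s t)
  ι_π : ∀ t, ι t ≫ π t = 𝟙 _
  ι_π_ne : ∀ t t', t ≠ t' → ι t ≫ π t' = 0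
  total : ∑ t, π t ≫ ι t = 𝟙 X

attribute [instance] SumDecomposition.fin

open Limits in
lemma SplitAdditive.sumDecomposition [HasBinaryBiproducts C] [HasZeroObject C]
    {A : Type*} [AddCommGroup A] {f : C → A} (hf : SplitAdditive f) {a : I → C} {X : C}
    (D : SumDecomposition a X) : f X = ∑ t, f (a (D.s t)) := by
  classical
  -- Each partial sum of the idempotents is split by an iterated binary biproduct Y; for the full
  -- index set the idempotent is the identity, so Y is isomorphic to X.
  have key : ∀ B : Finset D.T, ∃ (Y : C) (i : Y ⟶ X) (p : X ⟶ Y), i ≫ p = 𝟙 Y ∧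
      p ≫ i = ∑ t ∈ B, D.π t ≫ D.ι t ∧ f Y = ∑ t ∈ B, f (a (D.s t)) := by
    intro B
    induction B using Finset.induction_on with
    | empty =>
      open ZeroObject in
      exact ⟨0, 0, 0, (isZero_zero C).eq_of_src _ _, by simp,
        by simpa using hf.of_isZero (isZero_zero C)⟩
    | insert t B ht ih =>
      obtain ⟨Y, i, p, h1, h2, h3⟩ := ih
      have e1 : i ≫ D.π t = 0 := by
        calc i ≫ D.π t = i ≫ (p ≫ i) ≫ D.π t := by simp [reassoc_of% h1]
          _ = 0 := by
            rw [h2, Preadditive.sum_comp, Preadditive.comp_sum]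
            refine Finset.sum_eq_zero fun t' ht' => ?_
            rw [Category.assoc, D.ι_π_ne t' t (fun h => ht (h ▸ ht'))]
            simp
      have e2 : D.ι t ≫ p = 0 := by
        calc D.ι t ≫ p = D.ι t ≫ (p ≫ i) ≫ p := by simp [h1]
          _ = 0 := by
            rw [h2, Preadditive.sum_comp, Preadditive.comp_sum]
            refine Finset.sum_eq_zero fun t' ht' => ?_
            rw [Category.assoc, reassoc_of% (D.ι_π_ne t t' (fun h => ht (h ▸ ht')))]
            simp
      refine ⟨Y ⊞ a (D.s t), biprod.desc i (D.ι t), biprod.lift p (D.π t), ?_, ?_, ?_⟩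
      · apply biprod.hom_ext <;> apply biprod.hom_ext' <;> simp [h1, e1, e2, D.ι_π]
      · rw [biprod.lift_desc, h2, Finset.sum_insert ht, add_comm]
      · rw [hf.biprod, h3, Finset.sum_insert ht, add_comm]
  obtain ⟨Y, i, p, h1, h2, h3⟩ := key Finset.univ
  rw [D.total] at h2
  rw [← h3]
  exact hf.of_iso ⟨p, i, h2, h1⟩

end K0

/-- The family `a` exhibits `C` as a split semisimple category with simple objects `a i`. -/
structure IsSplitSemisimple (k : Type u) [Field k] {C : Type v} [Category.{v'} C]
    [Preadditive C] [Linear k C] {I : Type w} (a : I → C) : Prop where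
  dec : ∀ X : C, Nonempty (SumDecomposition a X)
  hom_zero : ∀ {i j : I}, i ≠ j → ∀ f : a i ⟶ a j, f = 0
  end_scalar : ∀ {i : I} (f : a i ⟶ a i), ∃ c : k, f = c • 𝟙 (a i)
  id_ne : ∀ i, 𝟙 (a i) ≠ 0

namespace IsSplitSemisimple

variable {k : Type u} [Field k] {C : Type v} [Category.{v'} C]
    [Preadditive C] [Linear k C] {I : Type w} {a : I → C} (h : IsSplitSemisimple k a)
include h

lemma finrank_end (i : I) : Module.finrank k (a i ⟶ a i) = 1 :=
  finrank_eq_one (𝟙 _) (h.id_ne i) fun f => by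
    obtain ⟨c, hc⟩ := h.end_scalar f
    exact ⟨c, hc.symm⟩

lemma finrank_ne {i j : I} (hij : i ≠ j) : Module.finrank k (a i ⟶ a j) = 0 := by
  have : Subsingleton (a i ⟶ a j) := ⟨fun f g => by rw [h.hom_zero hij f, h.hom_zero hij g]⟩
  exact Module.finrank_zero_of_subsingleton

lemma finite_simple_hom (i j : I) : Module.Finite k (a i ⟶ a j) := by
  by_cases hij : i = j
  · subst hij
    exact Module.finite_of_finrank_eq_succ (h.finrank_end i)
  · have : Subsingleton (a i ⟶ a j) := ⟨fun f g => by rw [h.hom_zero hij f, h.hom_zero hij g]⟩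
    infer_instance

/-- A morphism is determined by its matrix entries between simple summands, and these live in spaces
of dimension at most one. -/
lemma finite_hom (X Y : C) : Module.Finite k (X ⟶ Y) := by
  obtain ⟨D⟩ := h.dec X
  obtain ⟨E⟩ := h.dec Y
  have := h.finite_simple_hom
  let e : (X ⟶ Y) →ₗ[k] ∀ (t : D.T) (t' : E.T), a (D.s t) ⟶ a (E.s t') :=
    LinearMap.pi fun t => LinearMap.pi fun t' =>
      (Linear.leftComp k _ (D.ι t)) ∘ₗ (Linear.rightComp k _ (E.π t'))
  refine Module.Finite.of_injective e (LinearMap.ker_eq_bot.1 ?_)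
  rw [LinearMap.ker_eq_bot']
  intro f hf
  have hf' : ∀ t t', D.ι t ≫ f ≫ E.π t' = 0 := fun t t' => congr_fun (congr_fun hf t) t'
  calc f = (∑ t, D.π t ≫ D.ι t) ≫ f ≫ (∑ t', E.π t' ≫ E.ι t') := by simp [D.total, E.total]
    _ = ∑ t, ∑ t', D.π t ≫ (D.ι t ≫ f ≫ E.π t') ≫ E.ι t' := by
      simp only [Preadditive.sum_comp, Preadditive.comp_sum, Category.assoc]
      exact Finset.sum_comm
    _ = 0 := by simp [hf']

lemma hom_ext {X Y : C} {f g : X ⟶ Y} (hfg : ∀ i (x : a i ⟶ X), x ≫ f = x ≫ g) : f = g := by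
  obtain ⟨D⟩ := h.dec X
  rw [← Category.id_comp f, ← Category.id_comp g, ← D.total]
  simp only [Preadditive.sum_comp, Category.assoc, hfg]

/-- A morphism can be prescribed on the multiplicity spaces. -/
lemma exists_hom {X Y : C} (r : ∀ i, (a i ⟶ X) →ₗ[k] (a i ⟶ Y)) :
    ∃ g : X ⟶ Y, ∀ i (x : a i ⟶ X), x ≫ g = r i x := by
  obtain ⟨D⟩ := h.dec X
  refine ⟨∑ t, D.π t ≫ r _ (D.ι t), fun i x => ?_⟩
  -- By Schur's lemma `x ≫ D.π t` is zero or a scalar, so linearity of `r` is all the compatibility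
  -- that is needed.
  have key : ∀ t, x ≫ D.π t ≫ r _ (D.ι t) = r i (x ≫ D.π t ≫ D.ι t) := by
    intro t
    by_cases hi : i = D.s t
    · subst hi
      obtain ⟨c, hc⟩ := h.end_scalar (x ≫ D.π t)
      rw [← Category.assoc, ← Category.assoc, hc]
      simp
    · rw [← Category.assoc, ← Category.assoc, h.hom_zero hi (x ≫ D.π t)]
      simp
  rw [Preadditive.comp_sum, Finset.sum_congr rfl fun t _ => key t, ← map_sum,
    ← Preadditive.comp_sum, D.total, Category.comp_id]

/-- A monomorphism is injective on every multiplicity space Hom(a i, -); linear left inverses there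
assemble to a morphism. -/
lemma exists_retraction {X Y : C} (f : X ⟶ Y) [Mono f] : ∃ r : Y ⟶ X, f ≫ r = 𝟙 X := by
  have : ∀ i, ∃ r : (a i ⟶ Y) →ₗ[k] (a i ⟶ X), r ∘ₗ Linear.rightComp k (a i) f = LinearMap.id :=
    fun i => LinearMap.exists_leftInverse_of_injective _ (LinearMap.ker_eq_bot.2
      fun x y hxy => (cancel_mono f).1 hxy)
  choose r hr using this
  obtain ⟨g, hg⟩ := h.exists_hom r
  refine ⟨g, h.hom_ext fun i x => ?_⟩
  rw [← Category.assoc, hg]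
  simpa using LinearMap.congr_fun (hr i) x

lemma balanced : Balanced C where
  isIso_of_mono_of_epi f _ _ := by
    obtain ⟨r, hr⟩ := h.exists_retraction f
    exact ⟨r, hr, (cancel_epi f).1 (by rw [reassoc_of% hr, Category.comp_id])⟩

/-- Because of this, invariants of the Grothendieck group need only be additive on split complexes,
and `C` need not be known to be abelian. -/
lemma nonempty_splitting (S : ShortComplex C) (hS : S.ShortExact) : Nonempty S.Splitting := by
  have := h.balanced
  have := hS.mono_f
  obtain ⟨r, hr⟩ := h.exists_retraction S.f
  exact ⟨ShortComplex.Splitting.ofExactOfRetraction S hS.exact r hr hS.epi_g⟩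

lemma splitAdditive_finrank_hom (X : C) :
    SplitAdditive (fun Y : C => (Module.finrank k (X ⟶ Y) : ℤ)) := by
  intro S hS
  have h1 := h.finite_hom X S.X₁
  have h3 := h.finite_hom X S.X₃
  have e : (X ⟶ S.X₂) ≃ₗ[k] (X ⟶ S.X₁) × (X ⟶ S.X₃) :=
    LinearEquiv.ofLinearMap ((Linear.rightComp k X hS.r).prod (Linear.rightComp k X S.g))
      ((Linear.rightComp k X S.f).coprod (Linear.rightComp k X hS.s))
      (by ext x <;> simp [hS.s_r])
      (by ext x; simp [← Preadditive.comp_add, hS.id])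
  dsimp only
  rw [e.finrank_eq, Module.finrank_prod, Nat.cast_add]

lemma splitAdditive_finrank_hom_left (X : C) :
    SplitAdditive (fun Y : C => (Module.finrank k (Y ⟶ X) : ℤ)) := by
  intro S hS
  have h1 := h.finite_hom S.X₁ X
  have h3 := h.finite_hom S.X₃ X
  have e : (S.X₂ ⟶ X) ≃ₗ[k] (S.X₁ ⟶ X) × (S.X₃ ⟶ X) :=
    LinearEquiv.ofLinearMap ((Linear.leftComp k X S.f).prod (Linear.leftComp k X hS.s))
      ((Linear.leftComp k X hS.r).coprod (Linear.leftComp k X S.g))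
      (by ext x <;> simp [reassoc_of% hS.s_r])
      (by ext x; simp [← Category.assoc, ← Preadditive.add_comp, hS.id])
  dsimp only
  rw [e.finrank_eq, Module.finrank_prod, Nat.cast_add]

lemma simple (i : I) : Simple (a i) where
  mono_isIso_iff_nonzero {Y} f _ := by
    constructor
    · rintro hf rfl
      refine h.id_ne i ?_
      rw [← IsIso.inv_hom_id (0 : Y ⟶ a i), Limits.comp_zero]
    · intro hf
      obtain ⟨r, hr⟩ := h.exists_retraction f
      obtain ⟨c, hc⟩ := h.end_scalar (r ≫ f)
      refine ⟨r, hr, ?_⟩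
      -- The idempotent `r ≫ f` is a scalar `c` fixing the nonzero `f`, so `c = 1` and `f` is
      -- invertible.
      have h1 : f = c • f := by
        calc f = f ≫ r ≫ f := by rw [reassoc_of% hr]
          _ = c • f := by rw [hc]; simp
      have h2 : (c - 1) • f = 0 := by rw [sub_smul, one_smul, ← h1, sub_self]
      rw [smul_eq_zero, or_iff_left hf, sub_eq_zero] at h2
      rw [hc, h2, one_smul]

/-- Any summand inclusion of a decomposition is a nonzero monomorphism into `X`, hence an
isomorphism. -/
lemma exists_iso_of_simple (X : C) [Simple X] : ∃ i, Nonempty (a i ≅ X) := by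
  obtain ⟨D⟩ := h.dec X
  by_cases hT : IsEmpty D.T
  · exact absurd (by simpa using D.total.symm) (id_nonzero X)
  · rw [not_isEmpty_iff] at hT
    obtain ⟨t⟩ := hT
    have : Mono (D.ι t) := mono_of_mono_fac (D.ι_π t)
    have hne : D.ι t ≠ 0 := fun h0 => h.id_ne (D.s t) (by rw [← D.ι_π t, h0, Limits.zero_comp])
    have := isIso_of_mono_of_nonzero hne
    exact ⟨_, ⟨asIso (D.ι t)⟩⟩

section Multiplicity

/-- The multiplicities of the simple objects in `X`. -/
def mult (X : C) : I →₀ ℤ :=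
  Finsupp.ofSupportFinite (fun i => (Module.finrank k (a i ⟶ X) : ℤ)) <| by
    obtain ⟨D⟩ := h.dec X
    refine (Set.finite_range D.s).subset fun i hi => ?_
    by_contra hn
    refine hi ?_
    have : Subsingleton (a i ⟶ X) := by
      refine subsingleton_of_forall_eq 0 fun f => ?_
      rw [← Category.comp_id f, ← D.total, Preadditive.comp_sum]
      refine Finset.sum_eq_zero fun t _ => ?_
      rw [← Category.assoc, h.hom_zero (fun e => hn ⟨t, e.symm⟩) (f ≫ D.π t), Limits.zero_comp]
    simp [Module.finrank_zero_of_subsingleton]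

lemma mult_apply (X : C) (i : I) : h.mult X i = Module.finrank k (a i ⟶ X) := rfl

lemma mult_simple (i : I) : h.mult (a i) = Finsupp.single i 1 := by
  classical
  ext j
  rw [mult_apply, Finsupp.single_apply]
  split_ifs with hij
  · subst hij; simp [h.finrank_end]
  · simp [h.finrank_ne (Ne.symm hij)]

lemma splitAdditive_mult : SplitAdditive h.mult := by
  intro S hS
  ext i
  exact h.splitAdditive_finrank_hom (a i) S hS

lemma splitAdditive_shortExact {A : Type*} [AddCommGroup A] {f : C → A} (hf : SplitAdditive f)
    (S : ShortComplex C) (hS : S.ShortExact) : f S.X₂ = f S.X₁ + f S.X₃ :=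
  hf S (h.nonempty_splitting S hS).some

variable [Limits.HasBinaryBiproducts C] [Limits.HasZeroObject C]

/-- The workhorse for additive invariants: both `f` and the multiplicities are read off from the
same decomposition of `X`, so the values on simple objects determine `f`. -/
lemma splitAdditive_eq {A : Type*} [AddCommGroup A] {f : C → A} (hf : SplitAdditive f) (X : C) :
    f X = (h.mult X).sum fun i n => n • f (a i) := by
  classical
  obtain ⟨D⟩ := h.dec X
  rw [hf.sumDecomposition D, h.splitAdditive_mult.sumDecomposition D]
  simp only [mult_simple]
  rw [← Finsupp.sum_finsetSum_index (by simp) (by simp [add_smul])]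
  simp

lemma finrank_hom_eq (X Y : C) :
    (Module.finrank k (X ⟶ Y) : ℤ) = (h.mult X).sum fun i n => n * h.mult Y i := by
  rw [h.splitAdditive_eq (h.splitAdditive_finrank_hom_left Y) X]
  simp [mult_apply]

/-- The Grothendieck group is free on the classes of the simple objects. -/
def k0Equiv : K0 C ≃+ (I →₀ ℤ) :=
  AddMonoidHom.toAddEquiv
    (K0.lift h.mult (h.splitAdditive_shortExact h.splitAdditive_mult))
    (Finsupp.liftAddHom fun i => (zmultiplesHom _ (K0.cls (a i))))
    (K0.hom_ext fun X => by
      simp only [AddMonoidHom.coe_comp, Function.comp_apply, K0.lift_cls, AddMonoidHom.id_apply]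
      rw [h.splitAdditive_eq K0.splitAdditive_cls X]
      simp [Finsupp.sum])
    (by ext i : 2; simp [mult_simple])

lemma k0Equiv_cls (X : C) : h.k0Equiv (K0.cls X) = h.mult X := by
  simp [k0Equiv]

end Multiplicity

end IsSplitSemisimple

/-! ### Representations of finite groups -/

section Decompositions

variable {C : Type u} [Category.{v} C] [Preadditive C] {I : Type w} {a : I → C}

/-- Decompositions of the two outer terms of a split short complex give one of the middle term. -/
def SumDecomposition.ofSplitting {S : ShortComplex C} (h : S.Splitting)
    (D : SumDecomposition a S.X₁) (E : SumDecomposition a S.X₃) : SumDecomposition a S.X₂ where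
  T := D.T ⊕ E.T
  s := Sum.elim D.s E.s
  ι := Sum.rec (fun t => D.ι t ≫ S.f) (fun t => E.ι t ≫ h.s)
  π := Sum.rec (fun t => h.r ≫ D.π t) (fun t => S.g ≫ E.π t)
  ι_π := by rintro (t | t) <;> simp [D.ι_π, E.ι_π]
  ι_π_ne := by
    rintro (t | t) (t' | t') ht
    · simp [D.ι_π_ne t t' (fun e => ht (by rw [e]))]; rfl
    · simp; rfl
    · simp [reassoc_of% h.s_r]; rfl
    · simp [E.ι_π_ne t t' (fun e => ht (by rw [e]))]; rfl
  total := by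
    rw [Fintype.sum_sum_type, ← h.id]
    congr 1
    · calc _ = h.r ≫ (∑ t, D.π t ≫ D.ι t) ≫ S.f := by
            simp [Preadditive.sum_comp, Preadditive.comp_sum]
        _ = _ := by rw [D.total, Category.id_comp]
    · calc _ = S.g ≫ (∑ t, E.π t ≫ E.ι t) ≫ h.s := by
            simp [Preadditive.sum_comp, Preadditive.comp_sum]
        _ = _ := by rw [E.total, Category.id_comp]

/-- Replace the members of the family occurring in a decomposition by isomorphic objects. -/
def SumDecomposition.changeFamily {J : Type*} {b : J → C} {X : C} (D : SumDecomposition a X)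
    (f : I → J) (e : ∀ i, a i ≅ b (f i)) : SumDecomposition b X where
  T := D.T
  s t := f (D.s t)
  ι t := (e _).inv ≫ D.ι t
  π t := D.π t ≫ (e _).hom
  ι_π t := by simp [reassoc_of% D.ι_π t]
  ι_π_ne t t' h := by simp [reassoc_of% D.ι_π_ne t t' h]
  total := by simp [D.total]

end Decompositions

variable {k : Type u} [Field k] {H : Type u} [Group H]

/-- The linear map underlying a morphism of representations. -/
def lin {V W : FDRep k H} : (V ⟶ W) →ₗ[k] (V →ₗ[k] W) where
  toFun f := f.hom.hom.hom
  map_add' _ _ := rfl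
  map_smul' _ _ := rfl

lemma lin_injective {V W : FDRep k H} : Function.Injective (lin : (V ⟶ W) → (V →ₗ[k] W)) :=
  fun x y h => by
    ext : 2
    exact h

@[simp]
lemma lin_comp {U V W : FDRep k H} (f : U ⟶ V) (g : V ⟶ W) : lin (f ≫ g) = lin g ∘ₗ lin f := rfl

@[simp]
lemma lin_id (V : FDRep k H) : lin (𝟙 V) = LinearMap.id := rfl

lemma lin_equivariant {V W : FDRep k H} (f : V ⟶ W) (g : H) (x : V) :
    lin f (V.ρ g x) = W.ρ g (lin f x) :=
  LinearMap.congr_fun (congrArg (fun q => q.hom.hom) (f.comm g)) x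

/-- An equivariant linear map as a morphism of representations. -/
def mkHom {V W : FDRep k H} (l : V →ₗ[k] W) (hl : ∀ g x, l (V.ρ g x) = W.ρ g (l x)) : V ⟶ W where
  hom := FGModuleCat.ofHom l
  comm g := by
    ext : 1
    exact LinearMap.ext (hl g)

@[simp]
lemma lin_mkHom {V W : FDRep k H} (l : V →ₗ[k] W) (hl : ∀ g x, l (V.ρ g x) = W.ρ g (l x)) :
    lin (mkHom l hl) = l := rfl

/-- The sum of the conjugates of a linear map between representations. -/
def sumConj [Fintype H] (V W : FDRep k H) : (V →ₗ[k] W) →ₗ[k] (V ⟶ W) where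
  toFun l := mkHom (∑ g : H, W.ρ g ∘ₗ l ∘ₗ V.ρ g⁻¹) fun h x => by
    simp only [LinearMap.sum_apply, LinearMap.comp_apply, map_sum]
    refine Fintype.sum_equiv (Equiv.mulLeft h⁻¹) _ _ fun g => ?_
    simp only [Equiv.coe_mulLeft, ← Module.End.mul_apply, ← map_mul]
    simp
  map_add' x y := lin_injective (by
    simp [LinearMap.comp_add, LinearMap.add_comp, Finset.sum_add_distrib])
  map_smul' c x := lin_injective (by
    simp [LinearMap.comp_smul, LinearMap.smul_comp, Finset.smul_sum])

lemma lin_sumConj [Fintype H] {V W : FDRep k H} (l : V →ₗ[k] W) :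
    lin (sumConj V W l) = ∑ g : H, W.ρ g ∘ₗ l ∘ₗ V.ρ g⁻¹ := rfl

lemma sumConj_lin [Fintype H] {V W : FDRep k H} (f : V ⟶ W) :
    sumConj V W (lin f) = (Fintype.card H : k) • f := by
  refine lin_injective (LinearMap.ext fun x => ?_)
  simp only [lin_sumConj, LinearMap.sum_apply, LinearMap.comp_apply, map_smul,
    LinearMap.smul_apply, ← lin_equivariant]
  simp [← Module.End.mul_apply, ← map_mul, Nat.cast_smul_eq_nsmul]

/-! ### Maschke's theorem and Schur's lemma. -/

section Semisimple

variable [CharZero k] [Finite H]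

/-- Every representation is a direct sum of irreducible ones. -/
theorem nonempty_sumDecomposition (V : FDRep k H) :
    Nonempty (SumDecomposition (fun S : {S : FDRep k H // Simple S} => S.1) V) := by
  induction hn : Module.finrank k V using Nat.strong_induction_on generalizing V with
  | _ n ih =>
  subst hn
  by_cases h0 : 𝟙 V = 0
  · exact ⟨⟨Empty, Empty.elim, Empty.rec, Empty.rec, by simp, by simp, by simp [h0]⟩⟩
  by_cases hV : Simple V
  · refine ⟨⟨Unit, fun _ => ⟨V, hV⟩, fun _ => 𝟙 V, fun _ => 𝟙 V, by simp, by simp, by simp⟩⟩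
  have : ∃ (Y : FDRep k H) (f : Y ⟶ V), Mono f ∧ f ≠ 0 ∧ ¬ IsIso f := by
    by_contra hcon
    push Not at hcon
    refine hV ⟨fun {Y} f hf => ⟨fun hi he => h0 ?_, fun hne => hcon Y f hf hne⟩⟩
    subst he
    rw [← IsIso.inv_hom_id (0 : Y ⟶ V), Limits.comp_zero]
  obtain ⟨Y, f, hf, hf0, hfi⟩ := this
  let S := ShortComplex.mk f (Limits.cokernel.π f) (by simp)
  have hS : S.ShortExact :=
    { exact := ShortComplex.exact_of_g_is_cokernel S (Limits.cokernelIsCokernel f)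
      mono_f := hf }
  -- Maschke's theorem enters here: representations of a finite group in characteristic 0 are
  -- injective objects.
  let s := hS.splittingOfInjective
  have e : V ≃ₗ[k] Y × S.X₃ :=
    LinearEquiv.ofLinearMap ((lin s.r).prod (lin S.g)) ((lin f).coprod (lin s.s))
      (by
        have h1 := congrArg lin s.f_r
        have h2 := congrArg lin s.s_g
        have h3 := congrArg lin S.zero
        have h4 := congrArg lin s.s_r
        simp only [lin_comp, lin_id, map_zero] at h1 h2 h3 h4
        ext x
        · simpa using LinearMap.congr_fun h1 x
        · simpa using LinearMap.congr_fun h3 x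
        · simpa using LinearMap.congr_fun h4 x
        · simpa using LinearMap.congr_fun h2 x)
      (by
        have h1 := congrArg lin s.id
        simp only [map_add, lin_comp, lin_id] at h1
        ext x
        exact LinearMap.congr_fun h1 x)
  have hfr : Module.finrank k V = Module.finrank k Y + Module.finrank k S.X₃ := by
    rw [e.finrank_eq, Module.finrank_prod]
  have zero_of : ∀ Z : FDRep k H, Module.finrank k Z = 0 → 𝟙 Z = 0 := fun Z hZ =>
    lin_injective (LinearMap.ext fun x => by
      have := Module.finrank_zero_iff.1 hZ
      exact Subsingleton.elim _ _)
  -- Both outer terms are nonzero, so both have smaller dimension than `V` and the induction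
  -- applies.
  have hY : Module.finrank k Y ≠ 0 := fun h => hf0 (by
    rw [← Category.id_comp f, zero_of Y h, Limits.zero_comp])
  have hZ : Module.finrank k S.X₃ ≠ 0 := fun h => hfi (by
    have hg : S.g = 0 := by rw [← Category.comp_id S.g, zero_of _ h, Limits.comp_zero]
    refine ⟨s.r, s.f_r, ?_⟩
    have := s.id
    rw [hg, Limits.zero_comp, add_zero] at this
    exact this)
  obtain ⟨D⟩ := ih _ (by omega) Y rfl
  obtain ⟨E⟩ := ih _ (by omega) S.X₃ rfl
  exact ⟨SumDecomposition.ofSplitting s D E⟩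

variable (k H) in
/-- Irreducible representations up to isomorphism. -/
def irrSetoid : Setoid {S : FDRep k H // Simple S} where
  r S T := Nonempty (S.1 ≅ T.1)
  iseqv := ⟨fun _ => ⟨Iso.refl _⟩, fun ⟨e⟩ => ⟨e.symm⟩, fun ⟨e⟩ ⟨f⟩ => ⟨e ≪≫ f⟩⟩

variable (k H) in
/-- The set of isomorphism classes of irreducible representations. -/
def Irr : Type (u + 1) := Quotient (irrSetoid k H)

/-- A representative of an isomorphism class of irreducible representations. -/
def Irr.rep (i : Irr k H) : FDRep k H := (Quotient.out i).1

instance (i : Irr k H) : Simple i.rep := (Quotient.out i).2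

/-- The class of an irreducible representation. -/
def Irr.mk (S : FDRep k H) (hS : Simple S) : Irr k H := Quotient.mk (irrSetoid k H) ⟨S, hS⟩

omit [CharZero k] [Finite H] in
lemma Irr.nonempty_iso (S : FDRep k H) (hS : Simple S) : Nonempty (S ≅ (Irr.mk S hS).rep) :=
  (Quotient.exact (Quotient.out_eq (Quotient.mk (irrSetoid k H) ⟨S, hS⟩)).symm)

omit [CharZero k] [Finite H] in
lemma Irr.eq_of_iso {i j : Irr k H} (e : i.rep ≅ j.rep) : i = j := by
  rw [← Quotient.out_eq i, ← Quotient.out_eq j]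
  exact Quotient.sound ⟨e⟩

theorem isSplitSemisimple_of_splittingField (hk : IsSplittingField k H) :
    IsSplitSemisimple k (Irr.rep : Irr k H → FDRep k H) where
  dec X := by
    obtain ⟨D⟩ := nonempty_sumDecomposition X
    exact ⟨D.changeFamily (fun S => Irr.mk S.1 S.2) fun S => (Irr.nonempty_iso S.1 S.2).some⟩
  hom_zero {i j} hij f := by
    by_contra hf
    have := isIso_of_hom_simple hf
    exact hij (Irr.eq_of_iso (asIso f))
  end_scalar {i} f := by
    obtain ⟨c, hc⟩ := (finrank_eq_one_iff_of_nonzero' (𝟙 i.rep) (id_nonzero _)).1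
      (hk i.rep inferInstance) f
    exact ⟨c, hc.symm⟩
  id_ne i := id_nonzero _

end Semisimple

/-! ### Coefficients of polynomial functions -/

section Extraction

variable (k : Type u) [Field k] [CharZero k]

/-- Coefficients of polynomials in one variable of bounded degree are linear combinations of
values. -/
lemma exists_extraction (d n : ℕ) : ∃ (S : Finset k) (w : k → k),
    ∀ m ≤ d, ∑ s ∈ S, w s * s ^ m = if m = n then 1 else 0 := by
  classical
  let S : Finset k := (Finset.range (d + 1)).image fun j : ℕ => (j : k)
  have hS : S.card = d + 1 := by
    rw [Finset.card_image_of_injective _ Nat.cast_injective, Finset.card_range]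
  -- The nodes 0, …, d are distinct in characteristic 0. Lagrange interpolation reproduces X^m for m
  -- ≤ d, and the weights take its coefficient at X^n; for n > d every sum is 0, as it should be.
  refine ⟨S, fun s => (Lagrange.basis S id s).coeff n, fun m hm => ?_⟩
  have h := Lagrange.eq_interpolate (s := S) (v := id) (f := (Polynomial.X : Polynomial k) ^ m)
    Function.injective_id.injOn (by
      rw [hS, Polynomial.degree_X_pow]
      exact_mod_cast Nat.lt_succ_of_le hm)
  have h2 := congrArg (fun p : Polynomial k => p.coeff n) h
  simp only [Lagrange.interpolate_apply, Polynomial.finsetSum_coeff, Polynomial.coeff_C_mul,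
    Polynomial.coeff_X_pow, Polynomial.eval_pow, Polynomial.eval_X, id] at h2
  rw [Finset.sum_congr rfl fun s _ => mul_comm _ _, ← h2]
  simp [eq_comm]

/-- Coefficients of polynomials in several variables are linear combinations of values. -/
lemma exists_extraction_pi {r : ℕ} (d : ℕ) (e : Fin r → ℕ) :
    ∃ (S : Finset (Fin r → k)) (w : (Fin r → k) → k),
      ∀ e' : Fin r → ℕ, (∀ i, e' i ≤ d) →
        ∑ s ∈ S, w s * ∏ i, s i ^ e' i = if e' = e then 1 else 0 := by
  classical
  choose S w h using exists_extraction k d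
  refine ⟨Fintype.piFinset fun i => S (e i), fun s => ∏ i, w (e i) (s i), fun e' he' => ?_⟩
  simp only [← Finset.prod_mul_distrib]
  rw [← Finset.prod_univ_sum (fun i => S (e i)) fun i x => w (e i) x * x ^ e' i,
    Finset.prod_congr rfl fun i _ => h (e i) (e' i) (he' i), Finset.prod_ite_zero]
  simp [funext_iff]

variable {k}

/-- Polarization: symmetrizations of the values of a multilinear map are linear combinations of
values on the diagonal. -/
lemma exists_polarization (n : ℕ) : ∃ (S : Finset (Fin n → k)) (w : (Fin n → k) → k),
    ∀ {M : Type v} {N : Type w} [AddCommGroup M] [Module k M] [AddCommGroup N] [Module k N]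
      (B : MultilinearMap k (fun _ : Fin n => M) N) (x : Fin n → M),
      ∑ π : Equiv.Perm (Fin n), B (fun i => x (π i)) =
        ∑ s ∈ S, w s • B (fun _ => ∑ i, s i • x i) := by
  classical
  -- Expand B on the diagonal at ∑ sᵢ xᵢ and extract the coefficient of s₁ ⋯ sₙ: exactly the
  -- bijective index maps contribute to it.
  obtain ⟨S, w, h⟩ := exists_extraction_pi k n (fun _ : Fin n => 1)
  refine ⟨S, w, fun {M N} _ _ _ _ B x => ?_⟩
  have expand : ∀ s : Fin n → k, B (fun _ => ∑ i, s i • x i) =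
      ∑ σ : Fin n → Fin n, (∏ i, s i ^ (Finset.univ.filter fun j => σ j = i).card) •
        B (fun j => x (σ j)) := by
    intro s
    rw [MultilinearMap.map_sum]
    refine Finset.sum_congr rfl fun σ _ => ?_
    rw [MultilinearMap.map_smul_univ]
    congr 1
    rw [← Finset.prod_fiberwise Finset.univ σ (fun j => s (σ j))]
    refine Finset.prod_congr rfl fun i _ => ?_
    rw [Finset.prod_congr rfl (g := fun _ => s i), Finset.prod_const]
    intro j hj
    rw [(Finset.mem_filter.mp hj).2]
  simp only [expand, Finset.smul_sum, smul_smul]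
  rw [Finset.sum_comm]
  simp only [← Finset.sum_smul]
  have hcard : ∀ σ : Fin n → Fin n, (∀ i, (Finset.univ.filter fun j => σ j = i).card = 1) ↔
      Function.Bijective σ := by
    intro σ
    rw [Function.bijective_iff_existsUnique]
    refine forall_congr' fun i => ?_
    rw [Finset.card_eq_one, Finset.singleton_iff_unique_mem]
    simp
  have hcoef : ∀ σ : Fin n → Fin n, (∑ s ∈ S, w s *
      ∏ i, s i ^ (Finset.univ.filter fun j => σ j = i).card) • B (fun j => x (σ j)) =
      if Function.Bijective σ then B (fun j => x (σ j)) else 0 := by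
    intro σ
    rw [h _ fun i => (Finset.card_le_univ _).trans (by simp)]
    simp only [funext_iff, hcard]
    rw [ite_smul, one_smul, zero_smul]
  rw [Finset.sum_congr rfl fun σ _ => hcoef σ, ← Finset.sum_filter]
  refine Finset.sum_bij (fun π _ => ⇑π)
    (fun π _ => Finset.mem_filter.2 ⟨Finset.mem_univ _, π.bijective⟩)
    (fun π _ π' _ h => DFunLike.coe_injective h) (fun σ hσ => ?_) (fun _ _ => rfl)
  exact ⟨Equiv.ofBijective σ (Finset.mem_filter.1 hσ).2, Finset.mem_univ _, rfl⟩

/-- The exponents of total degree at most `d`. -/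
def exps (r d : ℕ) : Finset (Fin r → ℕ) :=
  (Fintype.piFinset fun _ => Finset.range (d + 1)).filter fun e => ∑ i, e i ≤ d

omit [CharZero k] in
lemma mem_exps {r d : ℕ} {e : Fin r → ℕ} : e ∈ exps r d ↔ ∑ i, e i ≤ d := by
  simp only [exps, Finset.mem_filter, Fintype.mem_piFinset, Finset.mem_range, and_iff_right_iff_imp]
  intro h i
  have := Finset.single_le_sum (f := e) (fun _ _ => Nat.zero_le _) (Finset.mem_univ i)
  omega

omit [CharZero k] in
lemma exists_coeff {r d : ℕ} {N : Type v} [AddCommGroup N] [Module k N] {p : (Fin r → k) → N}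
    (hp : p ∈ polyFunctions k r d N) :
    ∃ a : (Fin r → ℕ) → N, ∀ c, p c = ∑ e ∈ exps r d, (∏ i, c i ^ e i) • a e := by
  classical
  induction hp using Submodule.span_induction with
  | mem p hp =>
    obtain ⟨e, a, he, rfl⟩ := hp
    refine ⟨Pi.single e a, fun c => ?_⟩
    rw [Finset.sum_eq_single e]
    · simp
    · intro e' _ h
      simp [Pi.single_eq_of_ne h]
    · exact fun h => absurd (mem_exps.2 he) h
  | zero => exact ⟨0, by simp⟩
  | add x y _ _ hx hy =>
    obtain ⟨a, ha⟩ := hx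
    obtain ⟨b, hb⟩ := hy
    exact ⟨a + b, fun c => by simp [ha, hb, Finset.sum_add_distrib]⟩
  | smul t x _ hx =>
    obtain ⟨a, ha⟩ := hx
    refine ⟨t • a, fun c => ?_⟩
    simp only [Pi.smul_apply, ha, Finset.smul_sum, smul_comm t]

end Extraction

/-! ### Equivariant maps between tensor powers -/

section TensorPowers

variable {k : Type u} [Field k] {G : Type u} [Group G] {n : ℕ}

lemma tensorPowRep_tprod (V : FDRep k G) (x : Wreath G n) (v : Fin n → V) :
    tensorPowRep n V x (PiTensorProduct.tprod k v) =
      PiTensorProduct.tprod k fun i => V.ρ (x.left i) (v (x.right⁻¹ i)) := by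
  simp [tensorPowRep]

/-- Linear maps between tensor powers are spanned by the decomposable ones. -/
lemma span_range_map {ι : Type*} [Finite ι] {V W : Type*} [AddCommGroup V] [Module k V]
    [AddCommGroup W] [Module k W] [FiniteDimensional k V] [FiniteDimensional k W] :
    Submodule.span k (Set.range fun m : ι → V →ₗ[k] W => PiTensorProduct.map m) = ⊤ := by
  classical
  have := Fintype.ofFinite ι
  let b := Module.finBasis k V
  let c := Module.finBasis k W
  let B := Basis.piTensorProduct fun _ : ι => b
  let C := Basis.piTensorProduct fun _ : ι => c
  refine eq_top_iff.2 fun t _ => ?_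
  -- The matrix units of a tensor power are tensor products of matrix units.
  have ht : t = ∑ p : ι → Fin _, ∑ q : ι → Fin _, C.repr (t (B p)) q •
      PiTensorProduct.map fun i => (b.coord (p i)).smulRight (c (q i)) := by
    refine B.ext fun p => ?_
    simp only [LinearMap.sum_apply, LinearMap.smul_apply]
    rw [Finset.sum_eq_single p]
    · conv_lhs => rw [← C.sum_repr (t (B p))]
      refine Finset.sum_congr rfl fun q _ => ?_
      congr 1
      simp [B, C]
    · intro p' _ hp
      refine Finset.sum_eq_zero fun q _ => ?_
      obtain ⟨i, hi⟩ := Function.ne_iff.1 hp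
      simp only [B, Basis.piTensorProduct_apply, PiTensorProduct.map_tprod]
      refine smul_eq_zero_of_right _ (MultilinearMap.map_coord_zero _ i ?_)
      simp [hi.symm]
    · simp
  rw [ht]
  exact Submodule.sum_mem _ fun p _ => Submodule.sum_mem _ fun q _ =>
    Submodule.smul_mem _ _ (Submodule.subset_span ⟨_, rfl⟩)

/-- Conjugation permutes the slots and conjugates each slot by its own element of `G`, so averages
over the wreath product can be computed slot by slot. -/
lemma tensorPow_conj (V W : FDRep k G) (m : Fin n → V →ₗ[k] W) (x : Wreath G n) :
    tensorPowRep n W x ∘ₗ PiTensorProduct.map m ∘ₗ tensorPowRep n V x⁻¹ =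
      PiTensorProduct.map fun i => W.ρ (x.left i) ∘ₗ m (x.right⁻¹ i) ∘ₗ V.ρ (x.left i)⁻¹ := by
  have h : tensorPowRep n W x ∘ₗ PiTensorProduct.map m =
      (PiTensorProduct.map fun i => W.ρ (x.left i) ∘ₗ m (x.right⁻¹ i) ∘ₗ V.ρ (x.left i)⁻¹) ∘ₗ
        tensorPowRep n V x := by
    refine PiTensorProduct.ext (MultilinearMap.ext fun v => ?_)
    simp only [LinearMap.compMultilinearMap_apply, LinearMap.comp_apply, tensorPowRep_tprod,
      PiTensorProduct.map_tprod]
    congr 1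
    funext i
    simp [← Module.End.mul_apply, ← map_mul]
  rw [← LinearMap.comp_assoc, h, LinearMap.comp_assoc]
  change _ ∘ₗ (tensorPowRep n V x * tensorPowRep n V x⁻¹) = _
  rw [← map_mul, mul_inv_cancel, map_one]
  rfl

variable (n) in
/-- The tensor product of linear maps, as a map between tensor powers. -/
def tensMap (V W : FDRep k G) (m : Fin n → V →ₗ[k] W) :
    (tensorPow k G n).obj V →ₗ[k] (tensorPow k G n).obj W :=
  (PiTensorProduct.map m : (⨂[k] _ : Fin n, V) →ₗ[k] ⨂[k] _ : Fin n, W)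

variable (n) in
/-- The tensor product of linear maps as a multilinear map. -/
def tensMultilinear (V W : FDRep k G) : MultilinearMap k (fun _ : Fin n => V →ₗ[k] W)
    ((tensorPow k G n).obj V →ₗ[k] (tensorPow k G n).obj W) :=
  PiTensorProduct.mapMultilinear k (fun _ : Fin n => (V : Type u)) (fun _ : Fin n => (W : Type u))

lemma tensMultilinear_apply (V W : FDRep k G) (m : Fin n → V →ₗ[k] W) :
    tensMultilinear n V W m = tensMap n V W m := rfl

lemma lin_tensorPow_map {V W : FDRep k G} (f : V ⟶ W) :
    lin ((tensorPow k G n).map f) = tensMap n V W (fun _ => lin f) := rfl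

lemma span_range_tensMap (V W : FDRep k G) :
    Submodule.span k (Set.range (tensMap n V W)) = ⊤ :=
  span_range_map (k := k) (ι := Fin n) (V := V) (W := W)

lemma tensMap_conj (V W : FDRep k G) (m : Fin n → V →ₗ[k] W) (x : Wreath G n) :
    ((tensorPow k G n).obj W).ρ x ∘ₗ tensMap n V W m ∘ₗ ((tensorPow k G n).obj V).ρ x⁻¹ =
      tensMap n V W fun i => W.ρ (x.left i) ∘ₗ m (x.right⁻¹ i) ∘ₗ V.ρ (x.left i)⁻¹ :=
  tensorPow_conj V W m x

variable [CharZero k] [Finite G]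

/-- Every equivariant map between tensor powers is a linear combination of tensor powers of
equivariant maps. -/
theorem span_tensorPow_map (V W : FDRep k G) :
    Submodule.span k (Set.range fun f : V ⟶ W => (tensorPow k G n).map f) = ⊤ := by
  classical
  have := Fintype.ofFinite G
  have := Fintype.ofFinite (Wreath G n)
  refine eq_top_iff.2 fun t _ => ?_
  have hcard : (Fintype.card (Wreath G n) : k) ≠ 0 := Nat.cast_ne_zero.2 Fintype.card_ne_zero
  -- Up to the invertible group order, `t` is a sum of conjugates of a linear map. It is thus enough
  -- to treat sums of conjugates of decomposable maps, which span all linear maps.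
  rw [← Submodule.smul_mem_iff _ hcard, ← sumConj_lin]
  suffices h : ⊤ ≤ (Submodule.span k (Set.range fun f : V ⟶ W => (tensorPow k G n).map f)).comap
      (sumConj ((tensorPow k G n).obj V) ((tensorPow k G n).obj W)) from h Submodule.mem_top
  rw [← span_range_tensMap, Submodule.span_le]
  rintro _ ⟨m, rfl⟩
  obtain ⟨S, w, hSw⟩ := exists_polarization (k := k) n
  have key : sumConj ((tensorPow k G n).obj V) ((tensorPow k G n).obj W) (tensMap n V W m) =
      ∑ s ∈ S, w s • (tensorPow k G n).map (∑ i, s i • sumConj V W (m i)) := by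
    refine lin_injective ?_
    -- Summing over Gⁿ replaces each slot by its own sum of conjugates; the remaining sum over
    -- permutations is a symmetrization, which polarization writes through n-th tensor powers.
    have h1 : lin (sumConj ((tensorPow k G n).obj V) ((tensorPow k G n).obj W)
        (tensMap n V W m)) =
        ∑ π : Equiv.Perm (Fin n), tensMultilinear n V W
          fun i => lin (sumConj V W (m (π i))) := by
      rw [lin_sumConj]
      refine (Finset.sum_congr rfl fun x _ => tensMap_conj V W m x).trans ?_
      rw [← SemidirectProduct.equivProd.symm.sum_comp, Fintype.sum_prod_type, Finset.sum_comm]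
      refine Fintype.sum_equiv (Equiv.inv _) _ _ fun π => ?_
      simp only [lin_sumConj]
      rw [MultilinearMap.map_sum]
      rfl
    rw [h1, hSw (tensMultilinear n V W) fun i => lin (sumConj V W (m i))]
    simp only [map_sum, map_smul, lin_tensorPow_map]
    rfl
  rw [SetLike.mem_coe, Submodule.mem_comap, key]
  exact Submodule.sum_mem _ fun s _ => Submodule.smul_mem _ _ (Submodule.subset_span ⟨_, rfl⟩)

end TensorPowers

/-! ### Generators of the category of representations of the wreath product -/

section Generator

variable (k : Type u) [Field k] (G : Type u) [Group G] [Finite G] (n : ℕ)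

/-- The sum of `n` copies of the regular representation. -/
def regPow : FDRep k G :=
  FDRep.of (V := Fin n → G → k)
    { toFun := fun g =>
        { toFun := fun f i h => f i (g⁻¹ * h)
          map_add' := fun _ _ => rfl
          map_smul' := fun _ _ => rfl }
      map_one' := by ext; simp
      map_mul' := fun g h => by
        refine LinearMap.ext fun f => ?_
        funext i x
        simp [mul_assoc] }

variable {k G n}

/-- The generators of `regPow`. -/
def regPowGen (i : Fin n) : regPow k G n := by
  classical exact (Pi.single i (Pi.single 1 1) : Fin n → G → k)

variable (k G) in
/-- The coordinates of `regPow` dual to `regPowGen`. -/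
def regPowCoord (i : Fin n) : regPow k G n →ₗ[k] k :=
  ((LinearMap.proj (1 : G)) ∘ₗ LinearMap.proj i : (Fin n → G → k) →ₗ[k] k)

open Classical in
lemma regPowCoord_ρ_gen (i j : Fin n) (g : G) :
    regPowCoord k G i ((regPow k G n).ρ g (regPowGen j)) = if i = j ∧ g = 1 then 1 else 0 := by
  change (Pi.single j (Pi.single 1 1) : Fin n → G → k) i (g⁻¹ * 1) = _
  by_cases h : i = j
  · subst h
    simp [Pi.single_apply]
  · simp [h]

variable (k G n) in
/-- The generator of the free part of the tensor power of `regPow`. -/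
def tensGen : (tensorPow k G n).obj (regPow k G n) :=
  (PiTensorProduct.tprod k (fun i => regPowGen i) : ⨂[k] _ : Fin n, regPow k G n)

variable (k G n) in
/-- The coordinate of the generator of the free part of the tensor power of `regPow`. -/
def tensCoord : (tensorPow k G n).obj (regPow k G n) →ₗ[k] k :=
  (PiTensorProduct.lift ((MultilinearMap.mkPiAlgebra k (Fin n) k).compLinearMap
    fun i => regPowCoord k G i) : (⨂[k] _ : Fin n, regPow k G n) →ₗ[k] k)

/-- The i-th tensor factor of the generator lies in the i-th copy of k[G]. The copies detect the
permutation and the coordinates in k[G] detect the elements of `G`, so the generator spans a free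
module over the group algebra. -/
lemma tensCoord_ρ_gen [DecidableEq (Wreath G n)] (x : Wreath G n) :
    tensCoord k G n (((tensorPow k G n).obj (regPow k G n)).ρ x (tensGen k G n)) =
      if x = 1 then 1 else 0 := by
  classical
  change (PiTensorProduct.lift ((MultilinearMap.mkPiAlgebra k (Fin n) k).compLinearMap
    fun i => regPowCoord k G i)) (tensorPowRep n (regPow k G n) x
      (PiTensorProduct.tprod k fun i => regPowGen i)) = _
  rw [tensorPowRep_tprod]
  simp only [PiTensorProduct.lift.tprod, MultilinearMap.compLinearMap_apply,
    MultilinearMap.mkPiAlgebra_apply, regPowCoord_ρ_gen, Finset.prod_ite_zero]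
  simp only [Finset.mem_univ, true_imp_iff, Finset.prod_const_one]
  congr 1
  rw [SemidirectProduct.ext_iff, funext_iff, Equiv.ext_iff, eq_iff_iff, forall_and, and_comm]
  refine and_congr Iff.rfl ⟨fun h i => ?_, fun h i => ?_⟩
  · have := h (x.right i)
    simpa using this
  · have := h (x.right⁻¹ i)
    simpa using this

/-- Sum the conjugates of the rank one map `tensCoord · v`: at the generator only the identity
element contributes, so no division by the group order is needed. -/
lemma exists_hom_tensorPow_regPow (ρ : FDRep k (Wreath G n)) (v : ρ) :
    ∃ r : (tensorPow k G n).obj (regPow k G n) ⟶ ρ, lin r (tensGen k G n) = v := by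
  classical
  have := Fintype.ofFinite (Wreath G n)
  refine ⟨sumConj _ _ ((tensCoord k G n).smulRight v), ?_⟩
  rw [lin_sumConj]
  simp only [LinearMap.sum_apply, LinearMap.comp_apply, LinearMap.smulRight_apply,
    tensCoord_ρ_gen, inv_eq_one, ite_smul, one_smul, zero_smul]
  rw [Finset.sum_eq_single 1 (fun x _ hx => by simp [hx]) (by simp)]
  simp

variable [CharZero k]

/-- Every irreducible representation of the wreath product is a direct summand of the tensor power
of `regPow`. -/
lemma exists_retract_tensorPow_regPow (ρ : FDRep k (Wreath G n)) [Simple ρ] :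
    ∃ (j : ρ ⟶ (tensorPow k G n).obj (regPow k G n))
      (r : (tensorPow k G n).obj (regPow k G n) ⟶ ρ), j ≫ r = 𝟙 ρ := by
  obtain ⟨v, hv⟩ : ∃ v : ρ, v ≠ 0 := by
    by_contra h
    push Not at h
    exact id_nonzero ρ (lin_injective (LinearMap.ext fun x => (h _).trans (h _).symm))
  obtain ⟨r, hr⟩ := exists_hom_tensorPow_regPow ρ v
  have hr0 : r ≠ 0 := by
    rintro rfl
    exact hv (by rw [← hr]; rfl)
  -- A nonzero map to a simple object is epi, and it splits because representations are projective
  -- in characteristic 0.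
  have := epi_of_nonzero_to_simple hr0
  exact ⟨Projective.factorThru (𝟙 ρ) r, r, Projective.factorThru_comp _ _⟩

end Generator

/-! ### Highest weight vectors -/

section HighestWeight

variable {k : Type*} [Field k] {X : Type*} [AddCommGroup X] [Module k X]
  {E : Type*} [Ring E] [Algebra k E] (D : E →ₗ[k] Module.End k X) {m : ℕ} (e : Fin m → E)

/-- The spaces generated from `v` by at most `r` lowering operators. -/
def lowering (v : X) : ℕ → Submodule k X
  | 0 => Submodule.span k {v}
  | r + 1 => lowering v r ⊔
      Submodule.span k {y | ∃ j l, j < l ∧ ∃ x, ∃ z ∈ lowering v r, y = D (e j * x * e l) z}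

variable {D e}

lemma lowering_mono (v : X) (r : ℕ) : lowering D e v r ≤ lowering D e v (r + 1) := le_sup_left

lemma mem_lowering_succ {v : X} {r : ℕ} {j l : Fin m} (hjl : j < l) (x : E) {z : X}
    (hz : z ∈ lowering D e v r) : D (e j * x * e l) z ∈ lowering D e v (r + 1) :=
  Submodule.mem_sup_right (Submodule.subset_span ⟨j, l, hjl, x, z, hz, rfl⟩)

variable (hD : ∀ x y, D (x * y) - D (y * x) = D x * D y - D y * D x)
  (he : ∀ j l, e j * e l = if j = l then e j else 0) (hsum : ∑ j, e j = 1)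
  (hscalar : ∀ j x, ∃ c : k, e j * x * e j = c • e j)

-- The Peirce decomposition. The parts with j < l lower weights, those with l < j raise them, and
-- those with j = l act as the torus.
include hsum in
lemma eq_sum_mul_mul (x : E) : x = ∑ j, ∑ l, e j * x * e l := by
  simp only [← Finset.mul_sum, hsum, mul_one, ← Finset.sum_mul, one_mul]

-- This replaces the PBW theorem. A raising or torus operator is moved past a lowering one at the
-- cost of a commutator; the commutator is again of the form `D x`, applied one level down, where
-- the second claim is already known.
include hD hsum hscalar in
lemma lowering_stable {v : X} {κ : Fin m → k} (hv : ∀ j, D (e j) v = κ j • v)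
    (hmax : ∀ j l, l < j → ∀ x, D (e j * x * e l) v = 0) (r : ℕ) :
    (∀ j l, l ≤ j → ∀ x, ∀ y ∈ lowering D e v r, D (e j * x * e l) y ∈ lowering D e v r) ∧
      ∀ x, ∀ y ∈ lowering D e v r, D x y ∈ lowering D e v (r + 1) := by
  have second : ∀ r, (∀ j l, l ≤ j → ∀ x, ∀ y ∈ lowering D e v r,
      D (e j * x * e l) y ∈ lowering D e v r) →
      ∀ x, ∀ y ∈ lowering D e v r, D x y ∈ lowering D e v (r + 1) := by
    intro r h x y hy
    rw [eq_sum_mul_mul hsum x]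
    simp only [map_sum, LinearMap.sum_apply]
    refine Submodule.sum_mem _ fun j _ => Submodule.sum_mem _ fun l _ => ?_
    rcases le_or_gt l j with hlj | hjl
    · exact lowering_mono v r (h j l hlj x y hy)
    · exact mem_lowering_succ hjl x hy
  suffices first : ∀ r, ∀ j l, l ≤ j → ∀ x, ∀ y ∈ lowering D e v r,
      D (e j * x * e l) y ∈ lowering D e v r from ⟨first r, second r (first r)⟩
  intro r
  induction r with
  | zero =>
    intro j l hlj x y hy
    obtain ⟨a, rfl⟩ := Submodule.mem_span_singleton.1 hy
    rw [map_smul]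
    refine Submodule.smul_mem _ _ ?_
    rcases hlj.eq_or_lt with rfl | hlt
    · obtain ⟨c, hc⟩ := hscalar l x
      rw [hc, map_smul, LinearMap.smul_apply, hv]
      exact Submodule.smul_mem _ _ (Submodule.smul_mem _ _ (Submodule.mem_span_singleton_self v))
    · rw [hmax j l hlt x]
      exact Submodule.zero_mem _
  | succ r ih =>
    intro j l hlj x
    suffices h : lowering D e v (r + 1) ≤ (lowering D e v (r + 1)).comap (D (e j * x * e l)) from
      fun y hy => h hy
    refine sup_le (fun y hy => lowering_mono v r (ih j l hlj x y hy)) (Submodule.span_le.2 ?_)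
    rintro _ ⟨j', l', hjl', x', z, hz, rfl⟩
    rw [SetLike.mem_coe, Submodule.mem_comap]
    have h := hD (e j * x * e l) (e j' * x' * e l')
    have h2 : D (e j * x * e l) (D (e j' * x' * e l') z) =
        D (e j' * x' * e l') (D (e j * x * e l) z) +
          D ((e j * x * e l) * (e j' * x' * e l') - (e j' * x' * e l') * (e j * x * e l)) z := by
      have h3 := LinearMap.congr_fun h z
      simp only [LinearMap.sub_apply, Module.End.mul_apply] at h3
      rw [map_sub, LinearMap.sub_apply, h3]
      abel
    rw [h2]
    exact Submodule.add_mem _ (mem_lowering_succ hjl' x' (ih j l hlj x z hz))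
      (second r ih _ z hz)

variable (k) in
/-- The grading element `∑ j eⱼ`. -/
def gradingElt (e : Fin m → E) : E := ∑ j : Fin m, ((j : ℕ) : k) • e j

include he in
lemma gradingElt_comm (j l : Fin m) (x : E) :
    gradingElt k e * (e j * x * e l) - (e j * x * e l) * gradingElt k e =
      (((j : ℕ) : k) - ((l : ℕ) : k)) • (e j * x * e l) := by
  have h1 : gradingElt k e * e j = ((j : ℕ) : k) • e j := by
    simp [gradingElt, Finset.sum_mul, he]
  have h2 : e l * gradingElt k e = ((l : ℕ) : k) • e l := by
    simp [gradingElt, Finset.mul_sum, he]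
  rw [← mul_assoc, ← mul_assoc, h1, mul_assoc _ (e l), h2, sub_smul]
  simp

variable (D e) in
/-- The span of the eigenvectors of the grading element for eigenvalues below `c`. -/
def lowerPart (c : k) : Submodule k X :=
  Submodule.span k {y | ∃ n : ℕ, 0 < n ∧ D (gradingElt k e) y = (c - n) • y}

-- A lowering operator `e j * x * e l` changes the eigenvalue of the grading element by j - l < 0,
-- so `v` is the only generator left at eigenvalue `c`.
include hD he in
lemma lowering_le {v : X} {c : k} (hv : D (gradingElt k e) v = c • v) (r : ℕ) :
    lowering D e v r ≤ Submodule.span k {v} ⊔ lowerPart D e c := by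
  have step : ∀ (j l : Fin m), j < l → ∀ (x : E) (y : X) (n : ℕ),
      D (gradingElt k e) y = (c - n) • y → D (e j * x * e l) y ∈ lowerPart D e c := by
    intro j l hjl x y n hy
    refine Submodule.subset_span ⟨n + (l - j : ℕ), by have := Fin.lt_def.1 hjl; omega, ?_⟩
    have h3 := LinearMap.congr_fun (hD (gradingElt k e) (e j * x * e l)) y
    rw [← map_sub, gradingElt_comm he] at h3
    simp only [LinearMap.sub_apply, Module.End.mul_apply, map_smul, LinearMap.smul_apply, hy] at h3
    rw [sub_eq_iff_eq_add'.1 h3.symm, ← add_smul]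
    congr 1
    have := Fin.lt_def.1 hjl
    push_cast [Nat.cast_sub this.le]
    ring
  induction r with
  | zero => exact le_sup_left
  | succ r ih =>
    refine sup_le ih (Submodule.span_le.2 ?_)
    rintro _ ⟨j, l, hjl, x, z, hz, rfl⟩
    obtain ⟨y, hy, z', hz', rfl⟩ := Submodule.mem_sup.1 (ih hz)
    obtain ⟨a, rfl⟩ := Submodule.mem_span_singleton.1 hy
    refine Submodule.mem_sup_right ?_
    rw [map_add, map_smul]
    refine Submodule.add_mem _ (Submodule.smul_mem _ _ (step j l hjl x v 0 (by simpa using hv))) ?_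
    suffices h : lowerPart D e c ≤ (lowerPart D e c).comap (D (e j * x * e l)) from h hz'
    refine Submodule.span_le.2 ?_
    rintro w ⟨n, -, hn⟩
    exact step j l hjl x w n hn

/-- Eigenspaces for distinct eigenvalues are independent, and c - n ≠ c for n > 0 in characteristic
0. -/
lemma eq_zero_of_mem_lowerPart [CharZero k] {c : k} {z : X} (hz : z ∈ lowerPart D e c)
    (h : D (gradingElt k e) z = c • z) : z = 0 := by
  have hind := Module.End.eigenspaces_iSupIndep (D (gradingElt k e)) c
  refine Submodule.disjoint_def.1 hind z (Module.End.mem_eigenspace_iff.2 h) ?_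
  refine (Submodule.span_le.2 ?_ : lowerPart D e c ≤ _) hz
  rintro y ⟨n, hn, hy⟩
  have hne : c - n ≠ c := by
    rw [Ne, sub_eq_self, Nat.cast_eq_zero]
    omega
  exact Submodule.mem_iSup_of_mem (c - n) (Submodule.mem_iSup_of_mem hne
    (Module.End.mem_eigenspace_iff.2 hy))

include hD he hsum hscalar in
/-- An irreducible module has a highest weight vector, which is an eigenvector of everything that
commutes with the action. -/
theorem exists_highestWeight [CharZero k] [FiniteDimensional k X]
    (hex : ∃ (κ : Fin m → ℤ) (v : X), v ≠ 0 ∧ ∀ j, D (e j) v = (κ j : k) • v)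
    (hirr : ∀ N : Submodule k X, N ≠ ⊥ → (∀ x, ∀ y ∈ N, D x y ∈ N) → N = ⊤) :
    ∃ v : X, v ≠ 0 ∧ ∀ φ : X →ₗ[k] X, (∀ x y, φ (D x y) = D x (φ y)) → ∃ a : k, φ v = a • v := by
  classical
  -- The weights are integral, so the grading values of weight vectors can be ordered; there are
  -- finitely many, being eigenvalues of one operator.
  let C : Set ℤ := {c | ∃ (κ : Fin m → ℤ) (v : X), v ≠ 0 ∧ (∀ j, D (e j) v = (κ j : k) • v) ∧
    c = ∑ j : Fin m, (j : ℕ) * κ j}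
  have heig : ∀ (κ : Fin m → ℤ) (v : X), (∀ j, D (e j) v = (κ j : k) • v) →
      D (gradingElt k e) v = ((∑ j : Fin m, ((j : ℕ) : ℤ) * κ j : ℤ) : k) • v := by
    intro κ v hv
    simp only [gradingElt, map_sum, LinearMap.sum_apply, map_smul, LinearMap.smul_apply, hv,
      smul_smul, ← Finset.sum_smul]
    congr 1
    push_cast
    rfl
  have hfin : C.Finite := by
    refine Set.Finite.of_finite_image (f := fun c : ℤ => (c : k)) ?_ (Int.cast_injective.injOn)
    refine (Module.End.finite_hasEigenvalue (D (gradingElt k e))).subset ?_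
    rintro _ ⟨c, ⟨κ, v, hv0, hv, rfl⟩, rfl⟩
    exact Module.End.hasEigenvalue_of_hasEigenvector
      ⟨Module.End.mem_eigenspace_iff.2 (heig κ v hv), hv0⟩
  obtain ⟨κ₀, v₀, h1, h2⟩ := hex
  obtain ⟨c, ⟨κ, v, hv0, hv, hc⟩, hmax⟩ := Set.exists_max_image C id hfin ⟨_, κ₀, v₀, h1, h2, rfl⟩
  have hkill : ∀ j l, l < j → ∀ x, D (e j * x * e l) v = 0 := by
    intro j l hlj x
    by_contra hne
    -- A raised vector would have weight κ + δⱼ - δₗ, whose grading value exceeds the maximum by j -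
    -- l > 0.
    have hw : ∀ i, D (e i) (D (e j * x * e l) v) =
        ((κ i + (if i = j then 1 else 0) - (if i = l then 1 else 0) : ℤ) : k) •
          D (e j * x * e l) v := by
      intro i
      have h3 := LinearMap.congr_fun (hD (e i) (e j * x * e l)) v
      have h4 : e i * (e j * x * e l) = if i = j then e j * x * e l else 0 := by
        rw [← mul_assoc, ← mul_assoc, he]
        split_ifs with hij
        · rw [hij]
        · simp
      have h5 : (e j * x * e l) * e i = if i = l then e j * x * e l else 0 := by
        rw [mul_assoc, he]
        simp only [eq_comm (a := l)]
        split_ifs <;> simp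
      simp only [LinearMap.sub_apply, Module.End.mul_apply, hv, map_smul] at h3
      rw [sub_eq_iff_eq_add'.1 h3.symm, h4, h5]
      push_cast
      split_ifs <;> simp [add_smul, sub_eq_add_neg]
    have := hmax _ ⟨_, _, hne, hw, rfl⟩
    simp only [id, hc, mul_sub, mul_add, Finset.sum_sub_distrib, Finset.sum_add_distrib] at this
    simp at this
    have := Fin.lt_def.1 hlj
    omega
  have hstab := lowering_stable hD hsum hscalar hv hkill
  have htop : (⨆ r, lowering D e v r) = ⊤ := by
    have hdir : Directed (· ≤ ·) (lowering D e v) :=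
      (monotone_nat_of_le_succ (lowering_mono v)).directed_le
    refine hirr _ ?_ ?_
    · intro hbot
      have : v ∈ (⨆ r, lowering D e v r) :=
        Submodule.mem_iSup_of_mem 0 (Submodule.mem_span_singleton_self v)
      rw [hbot] at this
      exact hv0 this
    · intro x y hy
      obtain ⟨r, hr⟩ := (Submodule.mem_iSup_of_directed _ hdir).1 hy
      exact Submodule.mem_iSup_of_mem (r + 1) ((hstab r).2 x y hr)
  have hle : (⊤ : Submodule k X) ≤ Submodule.span k {v} ⊔ lowerPart D e (c : k) := by
    rw [← htop]
    refine iSup_le fun r => lowering_le hD he ?_ r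
    rw [heig κ v hv, hc]
  refine ⟨v, hv0, fun φ hφ => ?_⟩
  obtain ⟨y, hy, z, hz, hyz⟩ := Submodule.mem_sup.1 (hle (Submodule.mem_top (x := φ v)))
  obtain ⟨a, rfl⟩ := Submodule.mem_span_singleton.1 hy
  refine ⟨a, ?_⟩
  have hgv : D (gradingElt k e) v = (c : k) • v := by rw [heig κ v hv, hc]
  -- Since φ commutes with the grading element, `φ v` has eigenvalue `c`; its component in the lower
  -- part has eigenvalue `c` as well and must vanish.
  have hz0 : z = 0 := by
    refine eq_zero_of_mem_lowerPart hz ?_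
    rw [← eq_sub_iff_add_eq'] at hyz
    rw [hyz, map_sub, ← hφ, hgv]
    simp only [map_smul, hgv, smul_sub, smul_comm a]
  rw [← hyz, hz0, add_zero]

end HighestWeight

/-! ### Derivations on tensor powers -/

section Derivations

variable {k : Type*} [Field k] {V : Type*} [AddCommGroup V] [Module k V] (n : ℕ)

variable (k V) in
/-- The operator `∑ᵢ 1 ⊗ ⋯ ⊗ x ⊗ ⋯ ⊗ 1` on the tensor power. -/
def tensDeriv : Module.End k V →ₗ[k] Module.End k (⨂[k] _ : Fin n, V) :=
  ∑ i, (PiTensorProduct.mapMultilinear k (fun _ : Fin n => V) (fun _ : Fin n => V)).toLinearMap 1 i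

variable {n}

lemma tensDeriv_apply (x : Module.End k V) :
    tensDeriv k V n x = ∑ i, PiTensorProduct.map (Pi.mulSingle i x : Fin n → Module.End k V) := by
  rw [tensDeriv, LinearMap.sum_apply]
  rfl

lemma map_mulSingle_mul (i j : Fin n) (x y : Module.End k V) :
    (PiTensorProduct.map (Pi.mulSingle i x : Fin n → Module.End k V) *
      PiTensorProduct.map (Pi.mulSingle j y : Fin n → Module.End k V) :
        Module.End k (⨂[k] _ : Fin n, V)) =
    PiTensorProduct.map (Pi.mulSingle i x * Pi.mulSingle j y : Fin n → Module.End k V) :=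
  (PiTensorProduct.map_mul _ _).symm

/-- Operators in different slots commute, so only the diagonal terms survive in the commutator: the
Lie algebra End(V) acts on the tensor power. -/
lemma tensDeriv_mul_sub (x y : Module.End k V) :
    tensDeriv k V n (x * y) - tensDeriv k V n (y * x) =
      tensDeriv k V n x * tensDeriv k V n y - tensDeriv k V n y * tensDeriv k V n x := by
  have h1 : tensDeriv k V n y * tensDeriv k V n x = ∑ i, ∑ j,
      PiTensorProduct.map (Pi.mulSingle j y : Fin n → Module.End k V) *
        PiTensorProduct.map (Pi.mulSingle i x : Fin n → Module.End k V) := by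
    rw [tensDeriv_apply, tensDeriv_apply, Finset.sum_mul_sum, Finset.sum_comm]
  rw [h1]
  simp only [tensDeriv_apply, Finset.sum_mul_sum]
  rw [← Finset.sum_sub_distrib, ← Finset.sum_sub_distrib]
  refine Finset.sum_congr rfl fun i _ => ?_
  rw [← Finset.sum_sub_distrib, Finset.sum_eq_single i]
  · simp only [map_mulSingle_mul, Pi.mulSingle_mul]
  · intro j _ hji
    simp only [map_mulSingle_mul]
    rw [(Pi.mulSingle_commute (f := fun _ : Fin n => Module.End k V) hji.symm x y).eq, sub_self]
  · simp

/-- Evaluation of polynomials in `n` variables at the operators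
`1 ⊗ ⋯ ⊗ x ⊗ ⋯ ⊗ 1`. -/
def evalAt (n : ℕ) (x : Module.End k V) :
    MvPolynomial (Fin n) k →ₐ[k] Module.End k (⨂[k] _ : Fin n, V) :=
  -- The variables go first to the commutative algebra k[X]^{⊗n}, as `MvPolynomial.aeval` requires a
  -- commutative target; then X is evaluated at `x` in each slot.
  (PiTensorProduct.liftAlgHom
    ((PiTensorProduct.mapMultilinear k (fun _ : Fin n => V) (fun _ : Fin n => V)).compLinearMap
      fun _ => (Polynomial.aeval x : Polynomial k →ₐ[k] Module.End k V).toLinearMap)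
    (by
      simp only [MultilinearMap.compLinearMap_apply]
      exact (congrArg PiTensorProduct.map (funext fun _ => map_one (Polynomial.aeval x))).trans
        PiTensorProduct.map_one)
    (fun p q => by
      simp only [MultilinearMap.compLinearMap_apply]
      exact (congrArg PiTensorProduct.map (funext fun i => map_mul (Polynomial.aeval x)
        (p i) (q i))).trans (PiTensorProduct.map_mul _ _))).comp
  (MvPolynomial.aeval fun i =>
    PiTensorProduct.tprod k (Pi.mulSingle i Polynomial.X : Fin n → Polynomial k))

lemma evalAt_psum (x : Module.End k V) (j : ℕ) :
    evalAt n x (MvPolynomial.psum (Fin n) k j) = tensDeriv k V n (x ^ j) := by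
  rw [evalAt, AlgHom.comp_apply, MvPolynomial.psum, map_sum, map_sum, tensDeriv_apply]
  refine Finset.sum_congr rfl fun i _ => ?_
  rw [map_pow, MvPolynomial.aeval_X, ← PiTensorProduct.tprodMonoidHom_apply, ← map_pow,
    ← Pi.mulSingle_pow]
  simp only [PiTensorProduct.tprodMonoidHom_apply, PiTensorProduct.liftAlgHom_apply,
    PiTensorProduct.lift.tprod, MultilinearMap.compLinearMap_apply]
  refine congrArg PiTensorProduct.map (funext fun l => ?_)
  by_cases h : l = i
  · subst h; simp
  · simp [Pi.mulSingle_eq_of_ne h]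

lemma evalAt_esymm (x : Module.End k V) :
    evalAt n x (MvPolynomial.esymm (Fin n) k n) = PiTensorProduct.map fun _ => x := by
  have h1 : MvPolynomial.esymm (Fin n) k n = ∏ i, MvPolynomial.X i := by
    rw [MvPolynomial.esymm]
    have : Finset.powersetCard n (Finset.univ : Finset (Fin n)) = {Finset.univ} := by
      have h := Finset.powersetCard_self (Finset.univ : Finset (Fin n))
      rwa [Finset.card_univ, Fintype.card_fin] at h
    rw [this, Finset.sum_singleton]
  rw [h1, evalAt, AlgHom.comp_apply, map_prod]
  simp only [MvPolynomial.aeval_X, ← PiTensorProduct.tprodMonoidHom_apply]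
  rw [← map_prod, Finset.univ_prod_mulSingle (fun _ : Fin n => (Polynomial.X : Polynomial k))]
  simp only [PiTensorProduct.tprodMonoidHom_apply, PiTensorProduct.liftAlgHom_apply,
    PiTensorProduct.lift.tprod, MultilinearMap.compLinearMap_apply]
  refine congrArg PiTensorProduct.map (funext fun l => ?_)
  simp

/-- The tensor power of `x` is a polynomial in the derivations attached to powers of `x`. -/
lemma map_mem_adjoin_tensDeriv [CharZero k] (x : Module.End k V) :
    (PiTensorProduct.map fun _ : Fin n => x) ∈
      Algebra.adjoin k (Set.range fun j : ℕ => tensDeriv k V n (x ^ j)) := by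
  rw [← evalAt_esymm]
  generalize hm : n = m
  have : ∀ m : ℕ, evalAt n x (MvPolynomial.esymm (Fin n) k m) ∈
      Algebra.adjoin k (Set.range fun j : ℕ => tensDeriv k V n (x ^ j)) := by
    intro m
    induction m using Nat.strong_induction_on with
    | _ m ih =>
    rcases Nat.eq_zero_or_pos m with rfl | hpos
    · rw [MvPolynomial.esymm_zero, map_one]
      exact Subalgebra.one_mem _
    -- Newton's identities express m eₘ through power sums and lower elementary polynomials; m is
    -- invertible in characteristic 0. The n-th elementary polynomial gives x ⊗ ⋯ ⊗ x.
    have hN := congrArg (evalAt n x) (MvPolynomial.mul_esymm_eq_sum (Fin n) k m)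
    rw [map_mul, map_natCast, map_mul, map_pow, map_neg, map_one, map_sum] at hN
    have hm0 : (m : k) ≠ 0 := Nat.cast_ne_zero.2 hpos.ne'
    have h2 : (m : k) • evalAt n x (MvPolynomial.esymm (Fin n) k m) ∈
        Algebra.adjoin k (Set.range fun j : ℕ => tensDeriv k V n (x ^ j)) := by
      rw [Algebra.smul_def, map_natCast, hN]
      refine Subalgebra.mul_mem _ (Subalgebra.pow_mem _ (Subalgebra.neg_mem _
        (Subalgebra.one_mem _)) _) (Subalgebra.sum_mem _ fun a ha => ?_)
      rw [map_mul, map_mul, map_pow, map_neg, map_one, evalAt_psum]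
      refine Subalgebra.mul_mem _ (Subalgebra.mul_mem _ (Subalgebra.pow_mem _ (Subalgebra.neg_mem _
        (Subalgebra.one_mem _)) _) (ih _ ?_)) (Algebra.subset_adjoin ⟨_, rfl⟩)
      exact (Finset.mem_filter.1 ha).2
    have h3 := Subalgebra.smul_mem _ h2 (m : k)⁻¹
    rwa [smul_smul, inv_mul_cancel₀ hm0, one_smul] at h3
  subst hm
  exact this n

/-- The weights on the tensor power count how often each idempotent occurs, so they are integral. -/
lemma tensDeriv_idempotent_mul_map {J : Type*} [DecidableEq J] (e : J → Module.End k V)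
    (he : ∀ j l, e j * e l = if j = l then e j else 0) (j : J) (p : Fin n → J) :
    tensDeriv k V n (e j) * PiTensorProduct.map (fun i => e (p i)) =
      ((Finset.univ.filter fun i => p i = j).card : k) • PiTensorProduct.map fun i => e (p i) := by
  rw [tensDeriv_apply, Finset.sum_mul]
  have : ∀ i, PiTensorProduct.map (Pi.mulSingle i (e j) : Fin n → Module.End k V) *
      PiTensorProduct.map (fun i => e (p i)) =
      if p i = j then PiTensorProduct.map (fun i => e (p i)) else 0 := by
    intro i
    refine (PiTensorProduct.map_mul _ _).symm.trans ?_
    split_ifs with h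
    · refine congrArg PiTensorProduct.map (funext fun l => ?_)
      by_cases hl : l = i
      · subst hl
        simp [he, h]
      · simp [Pi.mulSingle_eq_of_ne hl]
    · refine (PiTensorProduct.mapMultilinear k (fun _ : Fin n => V) (fun _ : Fin n => V)
        ).map_coord_zero i ?_
      simp [he, Ne.symm h]
  rw [Finset.sum_congr rfl fun i _ => this i, ← Finset.sum_filter, Finset.sum_const,
    Nat.cast_smul_eq_nsmul]

end Derivations

/-! ### Splitting fields of wreath products -/

section Splitting

variable {k : Type u} [Field k] {G : Type u} [Group G] {n : ℕ}

/-- A linear map invariant under conjugation as a morphism of representations. -/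
def homOfConj {H : Type u} [Group H] {V W : FDRep k H} (l : V →ₗ[k] W)
    (hl : ∀ g, W.ρ g ∘ₗ l ∘ₗ V.ρ g⁻¹ = l) : V ⟶ W :=
  mkHom l fun g x => by
    conv_lhs => rw [← hl g]
    simp [← Module.End.mul_apply, ← map_mul]

@[simp]
lemma lin_homOfConj {H : Type u} [Group H] {V W : FDRep k H} (l : V →ₗ[k] W)
    (hl : ∀ g, W.ρ g ∘ₗ l ∘ₗ V.ρ g⁻¹ = l) : lin (homOfConj l hl) = l := rfl

lemma conj_lin {H : Type u} [Group H] {V W : FDRep k H} (f : V ⟶ W) (g : H) :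
    W.ρ g ∘ₗ lin f ∘ₗ V.ρ g⁻¹ = lin f := by
  refine LinearMap.ext fun x => ?_
  simp only [LinearMap.comp_apply, ← lin_equivariant]
  simp [← Module.End.mul_apply, ← map_mul]

lemma linearMap_sum_comp {R M N P ι : Type*} [CommSemiring R] [AddCommMonoid M] [AddCommMonoid N]
    [AddCommMonoid P] [Module R M] [Module R N] [Module R P] (s : Finset ι) (f : ι → N →ₗ[R] P)
    (g : M →ₗ[R] N) : (∑ i ∈ s, f i) ∘ₗ g = ∑ i ∈ s, f i ∘ₗ g :=
  LinearMap.ext fun x => by simp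

lemma linearMap_comp_sum {R M N P ι : Type*} [CommSemiring R] [AddCommMonoid M] [AddCommMonoid N]
    [AddCommMonoid P] [Module R M] [Module R N] [Module R P] (s : Finset ι) (f : ι → M →ₗ[R] N)
    (g : N →ₗ[R] P) : g ∘ₗ (∑ i ∈ s, f i) = ∑ i ∈ s, g ∘ₗ f i :=
  LinearMap.ext fun x => by simp

variable (k) in
/-- The linear map underlying an endomorphism, as a homomorphism of algebras. -/
def linAlgHom {H : Type u} [Group H] (V : FDRep k H) : End V →ₐ[k] Module.End k V :=
  AlgHom.ofLinearMap (lin : (V ⟶ V) →ₗ[k] _) rfl fun _ _ => rfl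

lemma tensDeriv_conj (V : FDRep k G) (x : V ⟶ V) (γ : Wreath G n) :
    tensorPowRep n V γ ∘ₗ tensDeriv k V n (lin x) ∘ₗ tensorPowRep n V γ⁻¹ =
      tensDeriv k V n (lin x) := by
  rw [tensDeriv_apply, linearMap_sum_comp, linearMap_comp_sum]
  simp only [tensorPow_conj]
  refine Fintype.sum_equiv γ.right _ _ fun i => ?_
  refine congrArg PiTensorProduct.map (funext fun j => ?_)
  by_cases h : j = γ.right i
  · subst h
    simpa using conj_lin x (γ.left (γ.right i))
  · have h' : γ.right⁻¹ j ≠ i := fun e => h (by rw [← e]; simp)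
    rw [Pi.mulSingle_eq_of_ne h, Pi.mulSingle_eq_of_ne h']
    exact conj_lin (𝟙 V) _

variable (n) in
/-- The operator `∑ᵢ 1 ⊗ ⋯ ⊗ x ⊗ ⋯ ⊗ 1` on the tensor power of a representation. -/
def derivHom (V : FDRep k G) :
    End V →ₗ[k] ((tensorPow k G n).obj V ⟶ (tensorPow k G n).obj V) where
  toFun x := homOfConj (tensDeriv k V n (lin x) : Module.End k (⨂[k] _ : Fin n, V))
    (tensDeriv_conj V x)
  map_add' x y := lin_injective (map_add (tensDeriv k V n ∘ₗ lin) x y)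
  map_smul' c x := lin_injective (map_smul (tensDeriv k V n ∘ₗ lin) c x)

lemma derivHom_mul_sub (V : FDRep k G) (x y : End V) :
    derivHom n V (x * y) - derivHom n V (y * x) =
      derivHom n V y ≫ derivHom n V x - derivHom n V x ≫ derivHom n V y := by
  refine lin_injective ?_
  rw [map_sub, map_sub]
  exact tensDeriv_mul_sub (n := n) (lin x) (lin y)

/-- Membership in the generated algebra is known for linear maps and descends to equivariant ones
along the injective homomorphism `linAlgHom`. -/
lemma tensorPow_map_mem_adjoin [CharZero k] (V : FDRep k G) (f : End V) :
    (tensorPow k G n).mapEnd V f ∈ Algebra.adjoin (A := End ((tensorPow k G n).obj V)) k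
      (Set.range fun j : ℕ => (derivHom n V (f ^ j) : End ((tensorPow k G n).obj V))) := by
  have h : linAlgHom k _ ((tensorPow k G n).mapEnd V f) ∈ Algebra.adjoin k (linAlgHom k _ ''
      (Set.range fun j : ℕ => (derivHom n V (f ^ j) : End ((tensorPow k G n).obj V)))) := by
    rw [← Set.range_comp]
    have h2 := map_mem_adjoin_tensDeriv (n := n) (linAlgHom k V f)
    have h3 : ∀ j : ℕ, linAlgHom k V f ^ j = lin (f ^ j : End V) := fun j =>
      (map_pow (linAlgHom k V) f j).symm
    simp only [h3] at h2
    exact h2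
  rw [← AlgHom.map_adjoin, Subalgebra.mem_map] at h
  obtain ⟨t, ht, hte⟩ := h
  rwa [← lin_injective hte]

/-- The projection of the tensor power to the space of weight `κ`. -/
def weightProj {m : ℕ} (V : FDRep k G) (e : Fin m → End V) (κ : Fin m → ℕ) :
    (tensorPow k G n).obj V ⟶ (tensorPow k G n).obj V :=
  homOfConj (∑ p : Fin n → Fin m, if (fun j => ∑ i, if p i = j then 1 else 0) = κ then
      tensMap n V V (fun i => lin (e (p i))) else 0) fun γ => by
    rw [linearMap_sum_comp, linearMap_comp_sum]
    -- A permutation of the slots changes `p` but not the number of occurrences of each index.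
    refine Fintype.sum_equiv (Equiv.arrowCongr γ.right (Equiv.refl _)) _ _ fun p => ?_
    have h1 : (fun j => ∑ i, if (Equiv.arrowCongr γ.right (Equiv.refl (Fin m))) p i = j
        then 1 else 0) = fun j => ∑ i, if p i = j then 1 else 0 := by
      funext j
      rw [← Equiv.sum_comp γ.right]
      simp
    rw [h1]
    split_ifs with h
    · rw [tensMap_conj]
      refine congrArg _ (funext fun i => conj_lin _ _)
    · simp

variable [CharZero k] [Finite G]

/-- A splitting field of `G` is also a splitting field of its wreath products. -/
theorem isSplittingField_wreath (hk : IsSplittingField k G) (n : ℕ) :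
    IsSplittingField k (Wreath G n) := by
  classical
  intro S hS
  obtain ⟨x₀, r₀, hx₀⟩ := exists_retract_tensorPow_regPow S
  have hx₀0 : x₀ ≠ 0 := by
    rintro rfl
    rw [Limits.zero_comp] at hx₀
    exact id_nonzero S hx₀.symm
  let V := regPow k G n
  let Y := (tensorPow k G n).obj V
  obtain ⟨Δ⟩ := nonempty_sumDecomposition V
  let σ := (Fintype.equivFin Δ.T).symm
  -- The idempotents of a decomposition of V into irreducibles; the hypothesis on `G` makes each
  -- corner e j · End(V) · e j consist of scalars.
  let e : Fin (Fintype.card Δ.T) → End V := fun j => Δ.π (σ j) ≫ Δ.ι (σ j)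
  have hmul : ∀ a b : End V, a * b = b ≫ a := fun _ _ => rfl
  have he : ∀ j l, e j * e l = if j = l then e j else 0 := by
    intro j l
    rw [hmul]
    split_ifs with h
    · subst h
      simp [e, reassoc_of% Δ.ι_π (σ j)]
    · simp [e, reassoc_of% Δ.ι_π_ne (σ l) (σ j) (fun h' => h (σ.injective h').symm)]
  have hsum : ∑ j, e j = 1 := by
    refine (Equiv.sum_comp σ fun t => Δ.π t ≫ Δ.ι t).trans Δ.total
  have hscalar : ∀ j x, ∃ c : k, e j * x * e j = c • e j := by
    intro j x
    obtain ⟨c, hc⟩ := (finrank_eq_one_iff_of_nonzero' (𝟙 (Δ.s (σ j)).1)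
      (@id_nonzero _ _ _ _ (Δ.s (σ j)).2)).1 (hk _ (Δ.s (σ j)).2) (Δ.ι (σ j) ≫ x ≫ Δ.π (σ j))
    refine ⟨c, ?_⟩
    rw [hmul, hmul]
    calc e j ≫ x ≫ e j = Δ.π (σ j) ≫ (Δ.ι (σ j) ≫ x ≫ Δ.π (σ j)) ≫ Δ.ι (σ j) := by simp [e]
      _ = c • e j := by rw [← hc]; simp [e]
  -- The Lie algebra End(V) acts by composition after maps S → Y; endomorphisms of `S` act by
  -- composition before them, so the two actions commute.
  let D : End V →ₗ[k] Module.End k (S ⟶ Y) :=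
    { toFun := fun x => Linear.rightComp k S (derivHom n V x)
      map_add' := fun x y => by ext; simp
      map_smul' := fun c x => by ext; simp }
  have hDa : ∀ x y, D x y = y ≫ derivHom n V x := fun _ _ => rfl
  have hD : ∀ x y, D (x * y) - D (y * x) = D x * D y - D y * D x := by
    intro x y
    refine LinearMap.ext fun z => ?_
    have h := congrArg (fun q => z ≫ q) (derivHom_mul_sub (n := n) V x y)
    simpa only [LinearMap.sub_apply, Module.End.mul_apply, hDa, Preadditive.comp_sub,
      Category.assoc] using h
  have hex : ∃ (κ : Fin (Fintype.card Δ.T) → ℤ) (v : S ⟶ Y), v ≠ 0 ∧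
      ∀ j, D (e j) v = (κ j : k) • v := by
    let ct : (Fin n → Fin (Fintype.card Δ.T)) → Fin (Fintype.card Δ.T) → ℕ :=
      fun p j => ∑ i, if p i = j then 1 else 0
    -- Expand (∑ eⱼ)^{⊗n} = 1 and group by weight: some weight component of the embedding `x₀` is
    -- nonzero.
    have htot : ∑ κ ∈ Finset.univ.image ct, weightProj (n := n) V e κ = 𝟙 Y := by
      refine lin_injective ?_
      rw [map_sum]
      simp only [weightProj, lin_homOfConj]
      rw [Finset.sum_comm]
      have h1 : ∀ p : Fin n → Fin (Fintype.card Δ.T), (∑ κ ∈ Finset.univ.image ct,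
          if (fun j => ∑ i, if p i = j then 1 else 0) = κ then
            tensMap n V V (fun i => lin (e (p i))) else 0) =
          tensMultilinear n V V (fun i => lin (e (p i))) := by
        intro p
        rw [Finset.sum_ite_eq, if_pos (Finset.mem_image_of_mem ct (Finset.mem_univ p))]
        rfl
      rw [Finset.sum_congr rfl fun p _ => h1 p]
      refine (MultilinearMap.map_sum (tensMultilinear n V V) fun _ j => lin (e j)).symm.trans ?_
      have h2 : ∑ j, lin (e j) = LinearMap.id := by
        rw [← map_sum, hsum]
        rfl
      simp only [h2]
      exact PiTensorProduct.map_id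
    have : ∃ κ ∈ Finset.univ.image ct, x₀ ≫ weightProj (n := n) V e κ ≠ 0 := by
      by_contra hcon
      push Not at hcon
      refine hx₀0 ?_
      rw [← Category.comp_id x₀]
      change x₀ ≫ 𝟙 Y = 0
      rw [← htot, Preadditive.comp_sum]
      exact Finset.sum_eq_zero hcon
    obtain ⟨κ, -, hκ⟩ := this
    refine ⟨fun j => κ j, x₀ ≫ weightProj (n := n) V e κ, hκ, fun j => ?_⟩
    rw [hDa, Category.assoc]
    have : weightProj (n := n) V e κ ≫ derivHom n V (e j) =
        (κ j : k) • weightProj (n := n) V e κ := by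
      refine lin_injective ?_
      rw [lin_comp, map_smul, weightProj, lin_homOfConj, linearMap_comp_sum, Finset.smul_sum]
      refine Finset.sum_congr rfl fun p _ => ?_
      split_ifs with h
      · have h2 := tensDeriv_idempotent_mul_map (n := n) (fun j => lin (e j)) (fun a b => by
          have := congrArg lin (he a b)
          rw [apply_ite lin, map_zero] at this
          exact this) j p
        rw [Finset.card_filter] at h2
        rw [← h]
        exact h2
      · simp
    rw [this]
    simp
  -- A stable subspace is closed under all f^{⊗n}, hence under all endomorphisms of `Y`. A nonzero
  -- `x` in it is a split monomorphism, so any `y` is `x` followed by an endomorphism of `Y`.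
  have hirr : ∀ N : Submodule k (S ⟶ Y), N ≠ ⊥ → (∀ x, ∀ y ∈ N, D x y ∈ N) → N = ⊤ := by
    intro N hN hst
    obtain ⟨x, hxN, hx0⟩ := Submodule.exists_mem_ne_zero_of_ne_bot hN
    have := mono_of_nonzero_from_simple hx0
    let A : Subalgebra k (End Y) :=
      { carrier := {t | ∀ z ∈ N, z ≫ t ∈ N}
        mul_mem' := fun {a b} ha hb z hz => by
          change z ≫ b ≫ a ∈ N
          rw [← Category.assoc]
          exact ha _ (hb z hz)
        add_mem' := fun {a b} ha hb z hz => by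
          rw [Preadditive.comp_add]
          exact N.add_mem (ha z hz) (hb z hz)
        algebraMap_mem' := fun c z hz => by
          change z ≫ (c • 𝟙 Y) ∈ N
          rw [Linear.comp_smul, Category.comp_id]
          exact N.smul_mem c hz }
    have hA : ∀ f : V ⟶ V, (tensorPow k G n).map f ∈ A := by
      intro f
      refine (Algebra.adjoin_le (A := End Y) ?_) (tensorPow_map_mem_adjoin V f)
      rintro _ ⟨j, rfl⟩ z hz
      exact hst _ z hz
    have hall : ∀ t : Y ⟶ Y, ∀ z ∈ N, z ≫ t ∈ N := by
      intro t
      have h : (⊤ : Submodule k (Y ⟶ Y)) ≤ Subalgebra.toSubmodule A := by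
        rw [← span_tensorPow_map, Submodule.span_le]
        rintro _ ⟨f, rfl⟩
        exact hA f
      exact h (Submodule.mem_top (x := t))
    rw [eq_top_iff]
    intro y _
    have h := hall (Injective.factorThru (𝟙 S) x ≫ y) x hxN
    rwa [← Category.assoc, Injective.comp_factorThru, Category.id_comp] at h
  obtain ⟨v, hv0, hv⟩ := exists_highestWeight hD he hsum hscalar hex hirr
  have := mono_of_nonzero_from_simple hv0
  refine finrank_eq_one (𝟙 S) (id_nonzero S) fun φ => ?_
  -- Hence `φ ≫ v = a • v`, and the monomorphism `v` can be cancelled.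
  obtain ⟨a, ha⟩ := hv (Linear.leftComp k Y φ) fun x y => by
    simp [hDa]
  refine ⟨a, (cancel_mono v).1 ?_⟩
  rw [Linear.smul_comp, Category.id_comp, ← ha]
  rfl

end Splitting

/-! ### Polynomial functors as modules over tensor powers -/

section Multilinear

variable {k : Type u} [Field k]

/-- A linear map on the linear maps between tensor powers is determined by a multilinear map. -/
lemma exists_linear_of_multilinear {ι V W N : Type*} [Finite ι] [AddCommGroup V] [Module k V]
    [AddCommGroup W] [Module k W] [FiniteDimensional k V] [FiniteDimensional k W]
    [AddCommGroup N] [Module k N] (B : MultilinearMap k (fun _ : ι => V →ₗ[k] W) N) :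
    ∃ φ : ((⨂[k] _ : ι, V) →ₗ[k] ⨂[k] _ : ι, W) →ₗ[k] N,
      ∀ m : ι → V →ₗ[k] W, φ (PiTensorProduct.map m) = B m := by
  classical
  have := Fintype.ofFinite ι
  let Ψ : (⨂[k] _ : ι, V →ₗ[k] W) →ₗ[k] ((⨂[k] _ : ι, V) →ₗ[k] ⨂[k] _ : ι, W) :=
    PiTensorProduct.piTensorHomMap
  have hΨ : ∀ m, Ψ (PiTensorProduct.tprod k m) = PiTensorProduct.map m := fun m =>
    PiTensorProduct.piTensorHomMap_tprod_eq_map m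
  have hsurj : Function.Surjective Ψ := by
    rw [← LinearMap.range_eq_top, eq_top_iff, ← span_range_map, Submodule.span_le]
    rintro _ ⟨m, rfl⟩
    exact ⟨_, hΨ m⟩
  have e1 := (Basis.piTensorProduct fun _ : ι => Module.finBasis k (V →ₗ[k] W))
  have e2 := (Basis.piTensorProduct fun _ : ι => Module.finBasis k V)
  have e3 := (Basis.piTensorProduct fun _ : ι => Module.finBasis k W)
  have := Module.Finite.of_basis e1
  have := Module.Finite.of_basis e2
  have := Module.Finite.of_basis e3
  -- A surjection between spaces of equal finite dimension is injective, so a multilinear map can be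
  -- transported through `Ψ`.
  have hinj : Function.Injective Ψ := by
    refine (LinearMap.injective_iff_surjective_of_finrank_eq_finrank ?_).2 hsurj
    rw [Module.finrank_linearMap, Module.finrank_eq_card_basis e1, Module.finrank_eq_card_basis e2,
      Module.finrank_eq_card_basis e3]
    simp [Module.finrank_linearMap, mul_pow]
  refine ⟨PiTensorProduct.lift B ∘ₗ (LinearEquiv.ofBijective Ψ ⟨hinj, hsurj⟩).symm.toLinearMap,
    fun m => ?_⟩
  have : (LinearEquiv.ofBijective Ψ ⟨hinj, hsurj⟩).symm (PiTensorProduct.map m) =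
      PiTensorProduct.tprod k m := by
    rw [LinearEquiv.symm_apply_eq]
    exact (hΨ m).symm
  simp [this]

/-- A polynomial map on a finite-dimensional space is a sum of diagonal restrictions of
multilinear maps. -/
lemma IsPolynomialMap.exists_multilinear {d : ℕ} {M : Type w} {N : Type v} [AddCommGroup M]
    [Module k M] [FiniteDimensional k M] [AddCommGroup N] [Module k N] {p : M → N}
    (hp : IsPolynomialMap k d p) : ∃ B : ∀ n : ℕ, MultilinearMap k (fun _ : Fin n => M) N,
      (∀ n, d < n → B n = 0) ∧ ∀ x, p x = ∑ n ∈ Finset.range (d + 1), B n fun _ => x := by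
  classical
  let b := Module.finBasis k M
  obtain ⟨a, ha⟩ := exists_coeff (hp _ b)
  -- A monomial of total degree n is the diagonal of a product of n coordinate functions, with slots
  -- indexed by the pairs (l, a) with a < e l.
  have hmon : ∀ (n : ℕ) (e : Fin (Module.finrank k M) → ℕ),
      ∃ B : MultilinearMap k (fun _ : Fin n => M) k,
        ∑ l, e l = n → ∀ x, B (fun _ => x) = ∏ l, b.repr x l ^ e l := by
    intro n e
    by_cases h : ∑ l, e l = n
    · subst h
      refine ⟨(MultilinearMap.mkPiAlgebra k _ k).compLinearMap
        (fun j => b.coord (finSigmaFinEquiv.symm j).1), fun _ x => ?_⟩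
      rw [MultilinearMap.compLinearMap_apply, MultilinearMap.mkPiAlgebra_apply,
        ← Equiv.prod_comp finSigmaFinEquiv, Fintype.prod_sigma]
      simp
    · exact ⟨0, fun h' => absurd h' h⟩
  choose B hB using hmon
  refine ⟨fun n => ∑ e ∈ (exps (Module.finrank k M) d).filter fun e => ∑ l, e l = n,
    (B n e).smulRight (a e), ?_, ?_⟩
  · intro n hn
    refine Finset.sum_eq_zero fun e he => ?_
    rw [Finset.mem_filter, mem_exps] at he
    omega
  · intro x
    have h1 := ha (b.repr x)
    rw [b.sum_repr] at h1
    rw [h1, ← Finset.sum_fiberwise_of_maps_to (s := exps (Module.finrank k M) d)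
      (t := Finset.range (d + 1)) (g := fun e => ∑ l, e l)
      (fun e he => Finset.mem_range.2 (Nat.lt_succ_of_le (mem_exps.1 he)))]
    refine Finset.sum_congr rfl fun n _ => ?_
    rw [sum_apply]
    refine Finset.sum_congr rfl fun e he => ?_
    rw [Finset.mem_filter] at he
    simp [hB n e he.2 x]

end Multilinear

/-! ### Homogeneous components of a polynomial functor. -/

section Theta

variable {k : Type u} [Field k] {G : Type u} [Group G]

/-- The linear map given by the action of a polynomial functor on a morphism. -/
def PolyFunctor.lmap (F : PolyFunctor k G) {V W : FDRep k G} (f : V ⟶ W) :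
    F.obj.obj V →ₗ[k] F.obj.obj W := (F.obj.map f).hom.hom

lemma PolyFunctor.lmap_id (F : PolyFunctor k G) (V : FDRep k G) :
    PolyFunctor.lmap F (𝟙 V) = LinearMap.id := by
  rw [PolyFunctor.lmap, F.obj.map_id]
  rfl

lemma PolyFunctor.lmap_comp (F : PolyFunctor k G) {U V W : FDRep k G} (f : U ⟶ V) (g : V ⟶ W) :
    PolyFunctor.lmap F (f ≫ g) = PolyFunctor.lmap F g ∘ₗ PolyFunctor.lmap F f := by
  rw [PolyFunctor.lmap, F.obj.map_comp]
  rfl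

lemma PolyFunctor.exists_isPolynomialMap (F : PolyFunctor k G) : ∃ d : ℕ, ∀ V W : FDRep k G,
    IsPolynomialMap k d fun f : V ⟶ W => PolyFunctor.lmap F f := by
  obtain ⟨d, hd⟩ := F.property
  exact ⟨d, fun V W => (hd V W).comp_linear
    ({ toFun := fun x => x.hom.hom
       map_add' := fun _ _ => rfl
       map_smul' := fun _ _ => rfl } :
      (F.obj.obj V ⟶ F.obj.obj W) →ₗ[k] (F.obj.obj V →ₗ[k] F.obj.obj W))⟩

lemma finite_hom_fdRep {H : Type u} [Group H] (V W : FDRep k H) : Module.Finite k (V ⟶ W) :=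
  Module.Finite.of_injective lin lin_injective

/-- The components of a polynomial functor: `F` is the sum over `n ≤ d` of its extensions `θₙ` to
the category of tensor powers with all equivariant maps between them. -/
structure PolyAction (F : PolyFunctor k G) where
  d : ℕ
  θ : ∀ (n : ℕ) {V W : FDRep k G}, ((tensorPow k G n).obj V ⟶ (tensorPow k G n).obj W) →ₗ[k]
    (F.obj.obj V →ₗ[k] F.obj.obj W)
  map_eq : ∀ {V W : FDRep k G} (f : V ⟶ W),
    PolyFunctor.lmap F f = ∑ n ∈ Finset.range (d + 1), θ n ((tensorPow k G n).map f)
  comp : ∀ (n : ℕ) {U V W : FDRep k G} (x : (tensorPow k G n).obj U ⟶ (tensorPow k G n).obj V)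
    (y : (tensorPow k G n).obj V ⟶ (tensorPow k G n).obj W), θ n y ∘ₗ θ n x = θ n (x ≫ y)
  comp_ne : ∀ {m n : ℕ}, m ≠ n → ∀ {U V W : FDRep k G}
    (x : (tensorPow k G m).obj U ⟶ (tensorPow k G m).obj V)
    (y : (tensorPow k G n).obj V ⟶ (tensorPow k G n).obj W), θ n y ∘ₗ θ m x = 0
  zero : ∀ n, d < n → ∀ {V W : FDRep k G}
    (x : (tensorPow k G n).obj V ⟶ (tensorPow k G n).obj W), θ n x = 0

lemma tensorPow_map_smul {n : ℕ} {V W : FDRep k G} (c : k) (f : V ⟶ W) :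
    (tensorPow k G n).map (c • f) = c ^ n • (tensorPow k G n).map f := by
  refine lin_injective ?_
  rw [map_smul, lin_tensorPow_map, lin_tensorPow_map, ← tensMultilinear_apply,
    ← tensMultilinear_apply]
  simpa using (tensMultilinear n V W).map_smul_univ (fun _ => c) (fun _ => lin f)

variable [CharZero k] [Finite G]

lemma hom_ext_tensorPow {n : ℕ} {V W : FDRep k G} {N : Type*} [AddCommGroup N] [Module k N]
    {α β : ((tensorPow k G n).obj V ⟶ (tensorPow k G n).obj W) →ₗ[k] N}
    (h : ∀ f, α ((tensorPow k G n).map f) = β ((tensorPow k G n).map f)) : α = β :=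
  LinearMap.ext_on_range (span_tensorPow_map V W) h

/-- The degree n part of f ↦ F(f) is the diagonal of a multilinear map, hence a linear function of
f^{⊗n}. Since the f^{⊗n} span, functoriality and orthogonality of the components follow from F(f ≫
g) = F(g) ∘ F(f) by comparing coefficients in scalars. -/
theorem nonempty_polyAction (F : PolyFunctor k G) : Nonempty (PolyAction F) := by
  classical
  obtain ⟨d, hd⟩ := PolyFunctor.exists_isPolynomialMap F
  have hθ : ∀ V W : FDRep k G, ∃ θ : ∀ n : ℕ,
      ((tensorPow k G n).obj V ⟶ (tensorPow k G n).obj W) →ₗ[k] (F.obj.obj V →ₗ[k] F.obj.obj W),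
      (∀ n, d < n → θ n = 0) ∧
      ∀ f, PolyFunctor.lmap F f = ∑ n ∈ Finset.range (d + 1), θ n ((tensorPow k G n).map f) := by
    intro V W
    have := finite_hom_fdRep V W
    obtain ⟨B, hB0, hB⟩ := (hd V W).exists_multilinear
    -- A linear retraction from all linear maps to equivariant ones extends the multilinear maps to
    -- where `exists_linear_of_multilinear` applies; its choice plays no role on f^{⊗n}.
    obtain ⟨s, hs⟩ := LinearMap.exists_leftInverse_of_injective (lin : (V ⟶ W) →ₗ[k] _)
      (LinearMap.ker_eq_bot.2 lin_injective)
    choose φ hφ using fun n : ℕ => exists_linear_of_multilinear (ι := Fin n) (V := V) (W := W)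
      ((B n).compLinearMap fun _ => s)
    let φ' : ∀ n, ((tensorPow k G n).obj V →ₗ[k] (tensorPow k G n).obj W) →ₗ[k]
      (F.obj.obj V →ₗ[k] F.obj.obj W) := φ
    have hφ' : ∀ n (f : V ⟶ W), φ' n (lin ((tensorPow k G n).map f)) = B n fun _ => f := by
      intro n f
      refine (hφ n fun _ => lin f).trans ?_
      have : s (lin f) = f := LinearMap.congr_fun hs f
      simp [this]
    refine ⟨fun n => if d < n then 0 else φ' n ∘ₗ lin, fun n hn => if_pos hn, fun f => ?_⟩
    rw [hB f]
    refine Finset.sum_congr rfl fun n hn => ?_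
    have hn' : ¬ d < n := by simpa [Nat.lt_succ_iff] using hn
    simp only [if_neg hn', LinearMap.comp_apply, hφ']
  choose θ hθ0 hθ using hθ
  -- The n-th component at f is a combination of the values F(s f) with nodes and weights
  -- independent of V, W and f.
  have hext : ∀ n, ∃ (S : Finset k) (w : k → k), (∀ m ≤ d, ∑ s ∈ S, w s * s ^ m =
      if m = n then 1 else 0) ∧ ∀ (V W : FDRep k G) (f : V ⟶ W),
      θ V W n ((tensorPow k G n).map f) = ∑ s ∈ S, w s • PolyFunctor.lmap F (s • f) := by
    intro n
    obtain ⟨S, w, hS⟩ := exists_extraction k d n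
    refine ⟨S, w, hS, fun V W f => ?_⟩
    simp only [hθ, tensorPow_map_smul, map_smul, Finset.smul_sum, smul_smul]
    rw [Finset.sum_comm]
    simp only [← Finset.sum_smul]
    rw [Finset.sum_congr rfl fun m hm => by
      rw [hS m (by simpa [Nat.lt_succ_iff] using hm)]]
    by_cases hn : d < n
    · rw [hθ0 V W n hn]
      refine (Finset.sum_eq_zero fun m hm => ?_).symm
      rw [if_neg (by rintro rfl; simp at hm; omega), zero_smul]
    · simp [not_lt.1 hn]
  have hmul : ∀ (m n : ℕ) (U V W : FDRep k G) (f : U ⟶ V) (g : V ⟶ W),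
      θ V W n ((tensorPow k G n).map g) ∘ₗ θ U V m ((tensorPow k G m).map f) =
        if m = n then θ U W n ((tensorPow k G n).map (f ≫ g)) else 0 := by
    intro m n U V W f g
    obtain ⟨S, w, hS, hw⟩ := hext n
    obtain ⟨S', w', hS', hw'⟩ := hext m
    rw [hw]
    simp only [linearMap_sum_comp, LinearMap.smul_comp]
    -- As a function of `s` this is homogeneous of degree m, so extracting the n-th coefficient
    -- gives zero unless m = n.
    have : ∀ s : k, PolyFunctor.lmap F (s • g) ∘ₗ θ U V m ((tensorPow k G m).map f) =
        s ^ m • θ U W m ((tensorPow k G m).map (f ≫ g)) := by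
      intro s
      rw [← map_smul, ← tensorPow_map_smul, hw', hw']
      simp only [linearMap_comp_sum, LinearMap.comp_smul, ← PolyFunctor.lmap_comp,
        Linear.smul_comp, Linear.comp_smul]
      exact Finset.sum_congr rfl fun t _ => by rw [smul_comm]
    simp only [this, smul_smul, ← Finset.sum_smul]
    by_cases hm : d < m
    · split_ifs with h
      · subst h
        simp [hθ0 U W m hm]
      · simp [hθ0 U W m hm]
    · rw [hS m (not_lt.1 hm)]
      split_ifs with h
      · subst h
        simp
      · simp
  -- Both sides are bilinear, so it is enough to compare them on tensor powers of morphisms.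
  have hmul' : ∀ (m n : ℕ) (U V W : FDRep k G)
      (x : (tensorPow k G m).obj U ⟶ (tensorPow k G m).obj V)
      (y : (tensorPow k G n).obj V ⟶ (tensorPow k G n).obj W)
      (R : ((tensorPow k G m).obj U ⟶ (tensorPow k G m).obj V) →ₗ[k]
        ((tensorPow k G n).obj V ⟶ (tensorPow k G n).obj W) →ₗ[k]
          (F.obj.obj U →ₗ[k] F.obj.obj W)),
      (∀ f g, R ((tensorPow k G m).map f) ((tensorPow k G n).map g) =
        θ V W n ((tensorPow k G n).map g) ∘ₗ θ U V m ((tensorPow k G m).map f)) →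
      θ V W n y ∘ₗ θ U V m x = R x y := by
    intro m n U V W x y R hR
    have : R = LinearMap.compl₁₂ (LinearMap.llcomp k _ _ _).flip (θ U V m) (θ V W n) :=
      hom_ext_tensorPow fun f => hom_ext_tensorPow fun g => hR f g
    rw [this]
    rfl
  refine ⟨⟨d, fun n V W => θ V W n, fun f => hθ _ _ f, ?_, ?_, ?_⟩⟩
  · intro n U V W x y
    exact hmul' n n U V W x y ((Linear.comp _ _ _).compr₂ (θ U W n)) fun f g => by
      rw [hmul, if_pos rfl, Functor.map_comp]
      rfl
  · intro m n hmn U V W x y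
    exact hmul' m n U V W x y 0 fun f g => by
      rw [hmul, if_neg hmn]
      rfl
  · intro n hn V W x
    rw [hθ0 V W n hn, LinearMap.zero_apply]

end Theta

/-! ### The simple polynomial functors -/

section Isotypic

variable {k : Type u} [Field k] {C : Type v} [Category.{v'} C]
    [Preadditive C] [Linear k C] {I : Type w} {a : I → C}

namespace SumDecomposition

/-- A decomposition indexed by an arbitrary finite type. -/
def ofFintype {X : C} {T : Type*} [Fintype T] (s : T → I) (ι : ∀ t, a (s t) ⟶ X)
    (π : ∀ t, X ⟶ a (s t)) (h1 : ∀ t, ι t ≫ π t = 𝟙 _) (h2 : ∀ t t', t ≠ t' → ι t ≫ π t' = 0)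
    (h3 : ∑ t, π t ≫ ι t = 𝟙 X) : SumDecomposition a X where
  T := Fin (Fintype.card T)
  s t := s ((Fintype.equivFin T).symm t)
  ι _ := ι _
  π _ := π _
  ι_π _ := h1 _
  ι_π_ne _ _ h := h2 _ _ fun e => h ((Fintype.equivFin T).symm.injective e)
  total := (Equiv.sum_comp (Fintype.equivFin T).symm fun t => π t ≫ ι t).trans h3

variable {X : C} (D : SumDecomposition a X)

/-- The inclusions of the summands isomorphic to `a i`. -/
def incl (i : I) (t : {t // D.s t = i}) : a i ⟶ X := eqToHom (by rw [t.2]) ≫ D.ι t.1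

/-- The projections to the summands isomorphic to `a i`. -/
def proj (i : I) (t : {t // D.s t = i}) : X ⟶ a i := D.π t.1 ≫ eqToHom (by rw [t.2])

lemma proj_incl (i : I) (t : {t // D.s t = i}) : D.proj i t ≫ D.incl i t = D.π t.1 ≫ D.ι t.1 := by
  obtain ⟨t, rfl⟩ := t
  simp [proj, incl]

lemma proj_incl_total [DecidableEq I] [Fintype I] :
    ∑ i, ∑ t, D.proj i t ≫ D.incl i t = 𝟙 X := by
  simp only [proj_incl]
  rw [← D.total, ← Fintype.sum_sigma' (fun i (t : {t // D.s t = i}) => D.π t.1 ≫ D.ι t.1)]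
  exact Fintype.sum_equiv (Equiv.sigmaFiberEquiv D.s) _ _ fun _ => rfl

/-- By Schur's lemma a map from `a i` meets only the summands of type `i`. -/
lemma sum_comp_proj_incl [DecidableEq I] (h : IsSplitSemisimple k a) {i : I} (x : a i ⟶ X) :
    ∑ t, x ≫ D.proj i t ≫ D.incl i t = x := by
  simp only [proj_incl]
  rw [← Finset.sum_subtype (Finset.univ.filter fun t => D.s t = i) (by simp)
    (fun t => x ≫ D.π t ≫ D.ι t), Finset.sum_filter_of_ne, ← Preadditive.comp_sum, D.total,
    Category.comp_id]
  intro t _ ht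
  by_contra hi
  rw [← Category.assoc, h.hom_zero (Ne.symm hi) (x ≫ D.π t), Limits.zero_comp] at ht
  exact ht rfl

lemma sum_proj_incl_comp [DecidableEq I] (h : IsSplitSemisimple k a) {i : I} (p : X ⟶ a i) :
    ∑ t, D.proj i t ≫ D.incl i t ≫ p = p := by
  simp only [← Category.assoc, proj_incl]
  rw [← Finset.sum_subtype (Finset.univ.filter fun t => D.s t = i) (by simp)
    (fun t => (D.π t ≫ D.ι t) ≫ p), Finset.sum_filter_of_ne, ← Preadditive.sum_comp, D.total,
    Category.id_comp]
  intro t _ ht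
  by_contra hi
  rw [Category.assoc, h.hom_zero hi (D.ι t ≫ p), Limits.comp_zero] at ht
  exact ht rfl

end SumDecomposition

lemma IsSplitSemisimple.hom_ext_right (h : IsSplitSemisimple k a) {i : I} {X : C} {x y : a i ⟶ X}
    (hxy : ∀ p : X ⟶ a i, x ≫ p = y ≫ p) : x = y := by
  classical
  obtain ⟨D⟩ := h.dec X
  rw [← D.sum_comp_proj_incl h x, ← D.sum_comp_proj_incl h y]
  simp only [← Category.assoc, hxy]

end Isotypic

/-! ### Morphisms of polynomial functors through their components. -/

section Nat

variable {k : Type u} [Field k] {G : Type u} [Group G]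

namespace PolyFunctor

variable {F H : PolyFunctor k G}

/-- The components of a morphism of polynomial functors. -/
def app (V : FDRep k G) : (F ⟶ H) →ₗ[k] (F.obj.obj V →ₗ[k] H.obj.obj V) where
  toFun α := (α.hom.app V).hom.hom
  map_add' _ _ := rfl
  map_smul' _ _ := rfl

lemma app_naturality (α : F ⟶ H) {V W : FDRep k G} (f : V ⟶ W) (x : F.obj.obj V) :
    app W α (lmap F f x) = lmap H f (app V α x) :=
  LinearMap.congr_fun (congrArg (fun q => q.hom.hom) (α.hom.naturality f)) x

lemma hom_ext {α β : F ⟶ H} (h : ∀ V x, app V α x = app V β x) : α = β := by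
  ext V x
  exact h V x

/-- A morphism of polynomial functors from its components. -/
def mk (φ : ∀ V : FDRep k G, F.obj.obj V →ₗ[k] H.obj.obj V)
    (hφ : ∀ {V W : FDRep k G} (f : V ⟶ W) x, φ W (lmap F f x) = lmap H f (φ V x)) : F ⟶ H where
  hom :=
    { app := fun V => FGModuleCat.ofHom (φ V)
      naturality := fun V W f => by
        ext x
        exact hφ f x }

lemma app_comp {K : PolyFunctor k G} (α : F ⟶ H) (β : H ⟶ K) (V : FDRep k G) :
    app V (α ≫ β) = app V β ∘ₗ app V α := rfl

lemma app_id (F : PolyFunctor k G) (V : FDRep k G) : app V (𝟙 F) = LinearMap.id := rfl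

end PolyFunctor

/-- An equivariant map to the tensor power as an element of the functor `L_ρ`. -/
def toPoly {n : ℕ} (ρ : FDRep k (Wreath G n)) (V : FDRep k G) :
    (ρ ⟶ (tensorPow k G n).obj V) ≃ₗ[k] (polyOfRep ρ).obj.obj V := LinearEquiv.refl k _

lemma lmap_toPoly {n : ℕ} (ρ : FDRep k (Wreath G n)) {V W : FDRep k G} (f : V ⟶ W)
    (x : ρ ⟶ (tensorPow k G n).obj V) :
    PolyFunctor.lmap (polyOfRep ρ) f (toPoly ρ V x) =
      toPoly ρ W (x ≫ (tensorPow k G n).map f) := rfl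

end Nat

/-! ### Split semisimplicity of the category of polynomial functors. -/

section SimpleFunctors

variable {k : Type u} [Field k] [CharZero k] {G : Type u} [Group G] [Finite G]

-- Naturality at 2 · id compares the factors 2^m and 2^n, which differ in characteristic 0.
omit [Finite G] in
lemma app_eq_zero_of_ne {m n : ℕ} (hmn : m ≠ n) {ρ : FDRep k (Wreath G m)}
    {σ : FDRep k (Wreath G n)} (α : polyOfRep ρ ⟶ polyOfRep σ) : α = 0 := by
  refine PolyFunctor.hom_ext fun V x => ?_
  obtain ⟨x, rfl⟩ := (toPoly ρ V).surjective x
  have h := PolyFunctor.app_naturality α ((2 : k) • 𝟙 V) (toPoly ρ V x)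
  obtain ⟨y, hy⟩ := (toPoly σ V).surjective (PolyFunctor.app V α (toPoly ρ V x))
  rw [← hy, lmap_toPoly, lmap_toPoly, tensorPow_map_smul, tensorPow_map_smul,
    CategoryTheory.Functor.map_id, CategoryTheory.Functor.map_id, Linear.comp_smul,
    Linear.comp_smul, Category.comp_id, Category.comp_id, map_smul, map_smul, map_smul, ← hy,
    ← sub_eq_zero, ← sub_smul, smul_eq_zero] at h
  rw [← hy]
  refine h.resolve_left fun h0 => hmn ?_
  rw [sub_eq_zero] at h0
  exact Nat.pow_right_injective le_rfl (by exact_mod_cast h0)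

/-- A Yoneda argument: the inclusion j : ρ → X^{⊗n} generates L_ρ, since every `x` is j followed by
`r ≫ x` and this is a combination of maps f^{⊗n}. So α is determined by its value at j. -/
lemma exists_eq_comp {n : ℕ} {ρ σ : FDRep k (Wreath G n)} [Simple ρ]
    (α : polyOfRep ρ ⟶ polyOfRep σ) : ∃ φ : σ ⟶ ρ, ∀ V x,
      PolyFunctor.app V α (toPoly ρ V x) = toPoly σ V (φ ≫ x) := by
  obtain ⟨j, r, hjr⟩ := exists_retract_tensorPow_regPow ρ
  refine ⟨(toPoly σ _).symm (PolyFunctor.app _ α (toPoly ρ _ j)) ≫ r, fun V x => ?_⟩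
  have h : (PolyFunctor.app V α ∘ₗ (toPoly ρ V).toLinearMap) ∘ₗ Linear.leftComp k _ j =
      (toPoly σ V).toLinearMap ∘ₗ Linear.leftComp k _
        ((toPoly σ _).symm (PolyFunctor.app _ α (toPoly ρ _ j))) :=
    hom_ext_tensorPow fun f => by
      change PolyFunctor.app V α (toPoly ρ V (j ≫ (tensorPow k G n).map f)) = _
      rw [← lmap_toPoly, PolyFunctor.app_naturality]
      rfl
  have h' := LinearMap.congr_fun h (r ≫ x)
  change PolyFunctor.app V α (toPoly ρ V (j ≫ r ≫ x)) = toPoly σ V (_ ≫ r ≫ x) at h'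
  rw [reassoc_of% hjr] at h'
  rw [h', Category.assoc]

section Dec

variable {F : PolyFunctor k G} (A : PolyAction F)

-- Orthogonality of the components leaves only the degree n part of F(f).
omit [CharZero k] [Finite G] in
lemma PolyAction.lmap_comp_θ {n : ℕ} {U V W : FDRep k G}
    (x : (tensorPow k G n).obj U ⟶ (tensorPow k G n).obj V) (f : V ⟶ W) :
    PolyFunctor.lmap F f ∘ₗ A.θ n x = A.θ n (x ≫ (tensorPow k G n).map f) := by
  rw [A.map_eq, linearMap_sum_comp]
  by_cases hn : n ∈ Finset.range (A.d + 1)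
  · rw [Finset.sum_eq_single_of_mem n hn fun m _ hm => A.comp_ne hm.symm _ _, A.comp]
  · rw [Finset.sum_eq_zero fun m hm => A.comp_ne (by rintro rfl; exact hn hm) _ _, A.zero]
    simpa using hn

omit [CharZero k] [Finite G] in
lemma PolyAction.θ_comp_lmap {n : ℕ} {U V W : FDRep k G} (f : U ⟶ V)
    (x : (tensorPow k G n).obj V ⟶ (tensorPow k G n).obj W) :
    A.θ n x ∘ₗ PolyFunctor.lmap F f = A.θ n ((tensorPow k G n).map f ≫ x) := by
  rw [A.map_eq, linearMap_comp_sum]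
  by_cases hn : n ∈ Finset.range (A.d + 1)
  · rw [Finset.sum_eq_single_of_mem n hn fun m _ hm => A.comp_ne hm _ _, A.comp]
  · rw [Finset.sum_eq_zero fun m hm => A.comp_ne (by rintro rfl; exact hn hm) _ _, A.zero]
    simpa using hn

/-- The morphism `L_ρ ⟶ F` determined by an element of `F(regPow)`. -/
def PolyAction.fromPoly {n : ℕ} {ρ : FDRep k (Wreath G n)}
    (r : (tensorPow k G n).obj (regPow k G n) ⟶ ρ) (u : F.obj.obj (regPow k G n)) :
    polyOfRep ρ ⟶ F :=
  PolyFunctor.mk (fun V => (A.θ n ∘ₗ Linear.leftComp k _ r).flip u ∘ₗ (toPoly ρ V).symm.toLinearMap)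
    fun {V W} f x => by
      obtain ⟨x, rfl⟩ := (toPoly ρ V).surjective x
      refine Eq.trans ?_ (LinearMap.congr_fun (A.lmap_comp_θ (r ≫ x) f) u).symm
      rw [Category.assoc]
      rfl

omit [CharZero k] in
/-- A morphism `F ⟶ L_ρ` for irreducible `ρ` is determined by a functional on `F(regPow)`. -/
lemma PolyAction.exists_toPoly {n : ℕ}
    (hss : IsSplitSemisimple k (Irr.rep : Irr k (Wreath G n) → _)) (i : Irr k (Wreath G n))
    (j : i.rep ⟶ (tensorPow k G n).obj (regPow k G n)) (ξ : F.obj.obj (regPow k G n) →ₗ[k] k) :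
    ∃ β : F ⟶ polyOfRep i.rep, ∀ (V : FDRep k G) (y : F.obj.obj V)
      (p : (tensorPow k G n).obj V ⟶ i.rep),
      (toPoly i.rep V).symm (PolyFunctor.app V β y) ≫ p = ξ (A.θ n (p ≫ j) y) • 𝟙 _ := by
  classical
  choose D _ using fun V => exists_true_iff_nonempty.2 (hss.dec ((tensorPow k G n).obj V))
  let φ : ∀ V : FDRep k G, F.obj.obj V →ₗ[k] (i.rep ⟶ (tensorPow k G n).obj V) := fun V =>
    ∑ t, (ξ ∘ₗ A.θ n ((D V).proj i t ≫ j)).smulRight ((D V).incl i t)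
  -- The composites with all `p` determine a map from `i.rep`, and this formula for them no longer
  -- involves the chosen decompositions; naturality follows.
  have hφ : ∀ V y (p : (tensorPow k G n).obj V ⟶ i.rep),
      φ V y ≫ p = ξ (A.θ n (p ≫ j) y) • 𝟙 _ := by
    intro V y p
    choose c hc using fun t => hss.end_scalar ((D V).incl i t ≫ p)
    simp only [φ, LinearMap.sum_apply, LinearMap.smulRight_apply, LinearMap.comp_apply,
      Preadditive.sum_comp, Linear.smul_comp, hc, smul_smul, ← Finset.sum_smul]
    congr 1
    conv_rhs => rw [← (D V).sum_proj_incl_comp hss p]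
    simp [hc, Preadditive.sum_comp, mul_comm]
  refine ⟨PolyFunctor.mk (fun V => (toPoly i.rep V).toLinearMap ∘ₗ φ V) fun {V W} f y => ?_, ?_⟩
  · refine congrArg (toPoly i.rep W) (hss.hom_ext_right (x := φ W (PolyFunctor.lmap F f y)) (y := φ V y ≫ (tensorPow k G n).map f)
      fun p => ?_)
    rw [hφ, Category.assoc, hφ, Category.assoc, ← A.θ_comp_lmap]
    rfl
  · intro V y p
    exact hφ V y p

end Dec

/-- There are finitely many irreducible representations. -/
lemma finite_irr (hk : IsSplittingField k G) (n : ℕ) : Finite (Irr k (Wreath G n)) := by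
  have hss := isSplitSemisimple_of_splittingField (isSplittingField_wreath hk n)
  obtain ⟨D⟩ := hss.dec ((tensorPow k G n).obj (regPow k G n))
  -- Every irreducible representation occurs among the finitely many summands of X^{⊗n}.
  refine Finite.of_surjective D.s fun i => ?_
  obtain ⟨j, r, hjr⟩ := exists_retract_tensorPow_regPow i.rep
  by_contra hi
  push Not at hi
  refine id_nonzero i.rep ?_
  rw [← hjr, ← Category.id_comp r, ← D.total, Preadditive.sum_comp, Preadditive.comp_sum]
  refine Finset.sum_eq_zero fun t _ => ?_
  rw [Category.assoc, ← Category.assoc, hss.hom_zero (hi t).symm (j ≫ D.π t), Limits.zero_comp]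

variable (k G) in
/-- The index set of the simple polynomial functors. -/
abbrev SimpleIndex : Type (u + 1) := Σ n : ℕ, Irr k (Wreath G n)

/-- The simple polynomial functors. -/
def simplePoly (i : SimpleIndex k G) : PolyFunctor k G := polyOfRep i.2.rep

lemma simplePoly_hom_zero (hk : IsSplittingField k G) {i j : SimpleIndex k G} (hij : i ≠ j)
    (α : simplePoly i ⟶ simplePoly j) : α = 0 := by
  obtain ⟨m, i⟩ := i
  obtain ⟨n, j⟩ := j
  by_cases hmn : m = n
  · subst hmn
    obtain ⟨φ, hφ⟩ : ∃ φ : j.rep ⟶ i.rep, ∀ V x,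
      PolyFunctor.app V α (toPoly i.rep V x) = toPoly j.rep V (φ ≫ x) := exists_eq_comp α
    refine PolyFunctor.hom_ext fun V x => ?_
    have hss := isSplitSemisimple_of_splittingField (isSplittingField_wreath hk m)
    have : φ = 0 := hss.hom_zero (fun h => hij (by rw [h])) φ
    obtain ⟨x, rfl⟩ := (toPoly i.rep V).surjective x
    refine (hφ V x).trans ?_
    rw [this, Limits.zero_comp, map_zero]
    rfl
  · exact app_eq_zero_of_ne hmn α

/-- With j, r exhibiting ρ as a retract of X^{⊗n}, the operator P = θₙ(r ≫ j) on F(X) is idempotent.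
A basis of its image gives the maps L_ρ → F, and the dual coordinates the maps F → L_ρ. The sum of
the composites is θₙ of the ρ-isotypic projector. -/
lemma PolyAction.exists_isotypic {F : PolyFunctor k G} (A : PolyAction F) {n : ℕ}
    (hss : IsSplitSemisimple k (Irr.rep : Irr k (Wreath G n) → _)) (i : Irr k (Wreath G n)) :
    ∃ (m : ℕ) (α : Fin m → (polyOfRep i.rep ⟶ F)) (β : Fin m → (F ⟶ polyOfRep i.rep)),
      (∀ s, α s ≫ β s = 𝟙 _) ∧ (∀ s s', s ≠ s' → α s ≫ β s' = 0) ∧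
      ∀ (V : FDRep k G) (D : SumDecomposition Irr.rep ((tensorPow k G n).obj V)) (y : F.obj.obj V)
        [DecidableEq (Irr k (Wreath G n))],
        ∑ s, PolyFunctor.app V (α s) (PolyFunctor.app V (β s) y) =
          ∑ t, A.θ n (D.proj i t ≫ D.incl i t) y := by
  obtain ⟨j, r, hjr⟩ := exists_retract_tensorPow_regPow i.rep
  obtain ⟨P, hPdef⟩ : ∃ P : Module.End k (F.obj.obj (regPow k G n)), P = A.θ n (r ≫ j) := ⟨_, rfl⟩
  have hP : ∀ y, P (P y) = P y := fun y => by
    rw [hPdef, ← LinearMap.comp_apply, A.comp]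
    simp [reassoc_of% hjr]
  let b := Module.finBasis k (LinearMap.range P)
  let ξ := fun s => b.coord s ∘ₗ P.rangeRestrict
  have hbP : ∀ s, P (b s : F.obj.obj (regPow k G n)) = b s := by
    intro s
    obtain ⟨y, hy⟩ := (b s).2
    rw [← hy, hP]
  have hξ : ∀ s s', ξ s (b s') = if s' = s then 1 else 0 := by
    intro s s'
    have : P.rangeRestrict (b s') = b s' := Subtype.ext (hbP s')
    simp only [ξ, LinearMap.comp_apply, this, Module.Basis.coord_apply, Module.Basis.repr_self,
      Finsupp.single_apply]
  have hsum : ∀ y, ∑ s, ξ s y • (b s : F.obj.obj (regPow k G n)) = P y := by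
    intro y
    have := congrArg Subtype.val (b.sum_repr (P.rangeRestrict y))
    rw [Submodule.coe_sum] at this
    exact this
  choose β hβ using fun s => A.exists_toPoly hss i j (ξ s)
  let α := fun s => A.fromPoly r (b s : F.obj.obj (regPow k G n))
  have hα : ∀ s V x, PolyFunctor.app V (α s) (toPoly i.rep V x) = A.θ n (r ≫ x) (b s) :=
    fun _ _ _ => rfl
  have hαβ : ∀ s s', α s ≫ β s' = (if s = s' then 1 else 0 : k) • 𝟙 _ := by
    intro s s'
    refine PolyFunctor.hom_ext fun V x => ?_
    obtain ⟨x, rfl⟩ := (toPoly i.rep V).surjective x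
    refine (toPoly i.rep V).symm.injective (hss.hom_ext_right fun p => ?_)
    rw [PolyFunctor.app_comp, LinearMap.comp_apply, hβ, hα, ← LinearMap.comp_apply (A.θ n _),
      A.comp, map_smul, LinearMap.smul_apply, PolyFunctor.app_id, LinearMap.id_apply, map_smul,
      LinearEquiv.symm_apply_apply, Linear.smul_comp]
    obtain ⟨c, hc⟩ := hss.end_scalar (x ≫ p)
    have := hξ s' s
    rw [← hbP] at this
    rw [Category.assoc, ← Category.assoc x, hc, Linear.smul_comp, Linear.comp_smul, map_smul,
      LinearMap.smul_apply, map_smul, Category.id_comp, ← hPdef, this]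
    simp [smul_smul, mul_comm]
  refine ⟨_, α, β, fun s => by simp [hαβ], fun s s' h => by simp [hαβ, h], fun V D y _ => ?_⟩
  have h1 : ∀ s, PolyFunctor.app V (α s) (PolyFunctor.app V (β s) y) =
      ∑ t, A.θ n (r ≫ D.incl i t) (ξ s (A.θ n (D.proj i t ≫ j) y) •
        (b s : F.obj.obj (regPow k G n))) := by
    intro s
    obtain ⟨x, hx⟩ := (toPoly i.rep V).surjective (PolyFunctor.app V (β s) y)
    have hβ' := hβ s V y
    rw [← hx, LinearEquiv.symm_apply_apply] at hβ'
    rw [← hx, hα]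
    conv_lhs => rw [← D.sum_comp_proj_incl hss x]
    simp only [← Category.assoc x, hβ', Linear.smul_comp, Category.id_comp,
      Preadditive.comp_sum, Linear.comp_smul, map_sum, map_smul, LinearMap.sum_apply,
      LinearMap.smul_apply]
  simp only [h1]
  rw [Finset.sum_comm]
  refine Finset.sum_congr rfl fun t _ => ?_
  rw [← map_sum, hsum, hPdef, ← LinearMap.comp_apply (A.θ n (r ≫ j)), A.comp,
    ← LinearMap.comp_apply, A.comp]
  simp [reassoc_of% hjr]

/-- The identity of F(V) is the sum over n ≤ d of θₙ(id), and the identity of V^{⊗n} is the sum of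
its isotypic projectors. -/
lemma nonempty_sumDecomposition_poly (hk : IsSplittingField k G) (F : PolyFunctor k G) :
    Nonempty (SumDecomposition (simplePoly : SimpleIndex k G → _) F) := by
  classical
  obtain ⟨A⟩ := nonempty_polyAction F
  have hss := fun n => isSplitSemisimple_of_splittingField (isSplittingField_wreath hk n)
  have := fun n => finite_irr hk n
  have := fun n => Fintype.ofFinite (Irr k (Wreath G n))
  choose m α β h1 h2 h3 using fun (n : ℕ) (i : Irr k (Wreath G n)) => A.exists_isotypic (hss n) i
  refine ⟨SumDecomposition.ofFintype
    (T := Σ (n : Fin (A.d + 1)) (i : Irr k (Wreath G n)), Fin (m n i))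
    (fun t => ⟨t.1, t.2.1⟩) (fun t => α _ _ t.2.2) (fun t => β _ _ t.2.2) (fun t => h1 _ _ _)
    ?_ ?_⟩
  · rintro ⟨n, i, s⟩ ⟨n', i', s'⟩ h
    by_cases h' : (⟨n, i⟩ : SimpleIndex k G) = ⟨n', i'⟩
    · rw [Sigma.mk.injEq] at h'
      obtain ⟨hn, hi⟩ := h'
      obtain rfl : n = n' := Fin.ext hn
      obtain rfl := eq_of_heq hi
      exact h2 n i s s' fun e => h (by rw [e])
    · exact simplePoly_hom_zero hk h' _
  · refine PolyFunctor.hom_ext fun V y => ?_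
    have h4 := LinearMap.congr_fun (PolyFunctor.lmap_id F V) y
    rw [A.map_eq, Finset.sum_range] at h4
    rw [PolyFunctor.app_id, ← h4, map_sum, Fintype.sum_sigma, LinearMap.sum_apply,
      LinearMap.sum_apply]
    refine Finset.sum_congr rfl fun n _ => ?_
    obtain ⟨D⟩ := (hss n).dec ((tensorPow k G n).obj V)
    rw [Fintype.sum_sigma, LinearMap.sum_apply]
    simp only [LinearMap.sum_apply]
    refine (Finset.sum_congr rfl fun i _ => h3 n i V D y).trans ?_
    rw [CategoryTheory.Functor.map_id, ← D.proj_incl_total]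
    simp only [map_sum, LinearMap.sum_apply]

theorem isSplitSemisimple_poly (hk : IsSplittingField k G) :
    IsSplitSemisimple k (simplePoly : SimpleIndex k G → _) where
  dec := nonempty_sumDecomposition_poly hk
  hom_zero := simplePoly_hom_zero hk
  end_scalar := by
    rintro ⟨m, i⟩ α
    obtain ⟨φ, hφ⟩ := exists_eq_comp (ρ := i.rep) (σ := i.rep) α
    have hss := isSplitSemisimple_of_splittingField (isSplittingField_wreath hk m)
    obtain ⟨c, hc⟩ := hss.end_scalar φ
    refine ⟨c, PolyFunctor.hom_ext fun V x => ?_⟩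
    obtain ⟨x, rfl⟩ := (toPoly i.rep V).surjective x
    refine (hφ V x).trans ?_
    rw [hc, Linear.smul_comp, Category.id_comp, map_smul]
    rfl
  id_ne := by
    rintro ⟨m, i⟩ h
    obtain ⟨j, r, hjr⟩ := exists_retract_tensorPow_regPow i.rep
    have : j = 0 := LinearMap.congr_fun (congrArg (PolyFunctor.app _) h) (toPoly i.rep _ j)
    rw [this, Limits.zero_comp] at hjr
    exact id_nonzero i.rep hjr.symm

end SimpleFunctors

/-! ### Characters of polynomial functors -/

section Construct

variable {k : Type u} [Field k] {G : Type u} [Group G]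

namespace PolyFunctor

/-- A polynomial functor from its values on objects and morphisms. -/
def ofLinear (obj : FDRep k G → Type u) [∀ V, AddCommGroup (obj V)] [∀ V, Module k (obj V)]
    [∀ V, Module.Finite k (obj V)] (map : ∀ {V W : FDRep k G}, (V ⟶ W) → (obj V →ₗ[k] obj W))
    (map_id : ∀ V, map (𝟙 V) = LinearMap.id)
    (map_comp : ∀ {U V W : FDRep k G} (f : U ⟶ V) (g : V ⟶ W), map (f ≫ g) = map g ∘ₗ map f)
    (d : ℕ) (hd : ∀ V W : FDRep k G, IsPolynomialMap k d fun f : V ⟶ W => map f) :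
    PolyFunctor k G where
  obj :=
    { obj := fun V => FGModuleCat.of k (obj V)
      map := fun f => FGModuleCat.ofHom (map f)
      map_id := fun V => by
        ext x
        exact LinearMap.congr_fun (map_id V) x
      map_comp := fun f g => by
        ext x
        exact LinearMap.congr_fun (map_comp f g) x }
  property := ⟨d, fun V W => (hd V W).comp_linear
    ({ toFun := fun x => FGModuleCat.ofHom x
       map_add' := fun _ _ => rfl
       map_smul' := fun _ _ => rfl } :
      (obj V →ₗ[k] obj W) →ₗ[k] (FGModuleCat.of k (obj V) ⟶ FGModuleCat.of k (obj W)))⟩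

end PolyFunctor

lemma polyFunctions_mono {r d d' : ℕ} (h : d ≤ d') {N : Type v} [AddCommGroup N] [Module k N] :
    polyFunctions k r d N ≤ polyFunctions k r d' N :=
  Submodule.span_mono fun _ ⟨e, a, he, hp⟩ => ⟨e, a, he.trans h, hp⟩

lemma IsPolynomialMap.mono {d d' : ℕ} (h : d ≤ d') {M : Type w} {N : Type v} [AddCommGroup M]
    [Module k M] [AddCommGroup N] [Module k N] {f : M → N} (hf : IsPolynomialMap k d f) :
    IsPolynomialMap k d' f := fun r v => polyFunctions_mono h (hf r v)

lemma IsPolynomialMap.add {d : ℕ} {M : Type w} {N : Type v} [AddCommGroup M]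
    [Module k M] [AddCommGroup N] [Module k N] {f g : M → N} (hf : IsPolynomialMap k d f)
    (hg : IsPolynomialMap k d g) : IsPolynomialMap k d (fun x => f x + g x) :=
  fun r v => Submodule.add_mem _ (hf r v) (hg r v)

lemma isPolynomialMap_zero {d : ℕ} {M : Type w} {N : Type v} [AddCommGroup M]
    [Module k M] [AddCommGroup N] [Module k N] : IsPolynomialMap k d (fun _ : M => (0 : N)) :=
  fun _ _ => Submodule.zero_mem _

/-- Polynomial maps can be composed with affine maps. -/
lemma IsPolynomialMap.comp_affine {d : ℕ} {M M' : Type w} {N : Type v} [AddCommGroup M]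
    [Module k M] [AddCommGroup M'] [Module k M'] [AddCommGroup N] [Module k N] {f : M → N}
    (hf : IsPolynomialMap k d f) (x₀ : M) (l : M' →ₗ[k] M) :
    IsPolynomialMap k d (fun x => f (x₀ + l x)) := by
  intro r v
  -- The base point is treated as one more vector, whose scalar is then set to 1.
  have h := hf (r + 1) (Fin.cons x₀ fun i => l (v i))
  have hle : polyFunctions k (r + 1) d N ≤ (polyFunctions k r d N).comap
      (LinearMap.funLeft k N (fun c : Fin r → k => (Fin.cons 1 c : Fin (r + 1) → k))) := by
    refine Submodule.span_le.2 ?_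
    rintro _ ⟨e, a, he, rfl⟩
    refine Submodule.subset_span ⟨fun i => e i.succ, a, ?_, ?_⟩
    · rw [Fin.sum_univ_succ] at he
      exact (Nat.le_add_left _ _).trans he
    · funext c
      simp [LinearMap.funLeft_apply, Fin.prod_univ_succ]
  have h' := hle h
  rw [Submodule.mem_comap] at h'
  convert h' using 1
  funext c
  simp [LinearMap.funLeft_apply, Fin.sum_univ_succ]

namespace PolyFunctor

variable (F H : PolyFunctor k G)

/-- The direct sum of polynomial functors. -/
def prod : PolyFunctor k G :=
  ofLinear (fun V => F.obj.obj V × H.obj.obj V) (fun f => (lmap F f).prodMap (lmap H f))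
    (fun V => by rw [lmap_id, lmap_id]; rfl) (fun f g => by rw [lmap_comp, lmap_comp]; rfl)
    (max (exists_isPolynomialMap F).choose (exists_isPolynomialMap H).choose)
    fun V W => by
      have h1 := (((exists_isPolynomialMap F).choose_spec V W).mono
        (le_max_left _ (exists_isPolynomialMap H).choose)).comp_linear
        (LinearMap.prodMapLinear k (F.obj.obj V) (H.obj.obj V) (F.obj.obj W) (H.obj.obj W) k ∘ₗ
          LinearMap.inl k _ _)
      have h2 := (((exists_isPolynomialMap H).choose_spec V W).mono
        (le_max_right (exists_isPolynomialMap F).choose _)).comp_linear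
        (LinearMap.prodMapLinear k (F.obj.obj V) (H.obj.obj V) (F.obj.obj W) (H.obj.obj W) k ∘ₗ
          LinearMap.inr k _ _)
      convert h1.add h2 using 2 with f
      ext <;> simp

instance : Limits.HasBinaryBiproducts (PolyFunctor k G) where
  has_binary_biproduct F H := Limits.hasBinaryBiproduct_of_total
    { pt := prod F H
      fst := mk (fun V => LinearMap.fst k (F.obj.obj V) (H.obj.obj V)) fun _ _ => rfl
      snd := mk (fun V => LinearMap.snd k (F.obj.obj V) (H.obj.obj V)) fun _ _ => rfl
      inl := mk (fun V => LinearMap.inl k (F.obj.obj V) (H.obj.obj V)) fun f _ =>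
        Prod.ext rfl (map_zero (lmap H f)).symm
      inr := mk (fun V => LinearMap.inr k (F.obj.obj V) (H.obj.obj V)) fun f _ =>
        Prod.ext (map_zero (lmap F f)).symm rfl
      inl_fst := rfl
      inl_snd := rfl
      inr_fst := rfl
      inr_snd := rfl }
    (hom_ext fun _ x => Prod.ext (add_zero x.1) (zero_add x.2))

/-- The zero functor. -/
def zero : PolyFunctor k G :=
  ofLinear (fun _ => PUnit) (fun _ => 0) (fun _ => rfl) (fun _ _ => rfl) 0
    fun _ _ => isPolynomialMap_zero

instance : Limits.HasZeroObject (PolyFunctor k G) :=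
  ⟨zero, (Limits.IsZero.iff_id_eq_zero _).2 (hom_ext fun _ _ => rfl)⟩

/-- The character of a polynomial functor: the traces of its values on endomorphisms. -/
def char (F : PolyFunctor k G) (x : Σ V : FDRep k G, (V ⟶ V)) : k :=
  LinearMap.trace k _ (lmap F x.2)

variable {F H}

lemma char_eq_of_conj (F : PolyFunctor k G) {V W : FDRep k G} (e : V ≅ W) {f : V ⟶ V} {g : W ⟶ W}
    (h : f ≫ e.hom = e.hom ≫ g) : char F ⟨V, f⟩ = char F ⟨W, g⟩ := by
  have h1 : g = e.inv ≫ f ≫ e.hom := by rw [h, e.inv_hom_id_assoc]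
  have h2 : f = f ≫ e.hom ≫ e.inv := by simp
  rw [char, char, h1, lmap_comp, LinearMap.trace_comp_comm', ← lmap_comp, Category.assoc, ← h2]

lemma char_tensor (F H : PolyFunctor k G) : char (F ⊗ H) = char F * char H := by
  funext x
  exact LinearMap.trace_tensorProduct' (lmap F x.2) (lmap H x.2)

lemma char_unit : char (𝟙_ (PolyFunctor k G)) = 1 := by
  funext x
  refine (?_ : LinearMap.trace k k LinearMap.id = 1)
  simp

/-- The trace of an endomorphism of a retract. -/
lemma trace_comp_retract {K : PolyFunctor k G} (ι : K ⟶ F) (π : F ⟶ K) {V : FDRep k G}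
    (f : V ⟶ V) : LinearMap.trace k _ (app V (π ≫ ι) ∘ₗ lmap F f) =
      LinearMap.trace k _ (app V (ι ≫ π) ∘ₗ lmap K f) := by
  rw [app_comp, LinearMap.comp_assoc, LinearMap.trace_comp_comm', LinearMap.comp_assoc, app_comp,
    LinearMap.comp_assoc]
  congr 2
  exact LinearMap.ext fun x => (app_naturality ι f x).symm

/-- Insert the two complementary idempotents of the splitting and move each retraction around the
trace. -/
lemma splitAdditive_char : SplitAdditive (char : PolyFunctor k G → _) := by
  intro S hS
  funext x
  have h : lmap S.X₂ x.2 = app _ (hS.r ≫ S.f) ∘ₗ lmap S.X₂ x.2 +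
      app _ (S.g ≫ hS.s) ∘ₗ lmap S.X₂ x.2 := by
    rw [← LinearMap.add_comp, ← map_add, hS.id]
    rfl
  have h1 := trace_comp_retract S.f hS.r x.2
  have h2 := trace_comp_retract hS.s S.g x.2
  rw [hS.f_r] at h1
  rw [hS.s_g] at h2
  rw [char, h, map_add, h1, h2]
  rfl

end PolyFunctor

end Construct

/-! ### Traces on multiplicity spaces. -/

section IsotypicTrace

/-- Only the diagonal entries of β between summands of type `i` enter the trace on Hom(a i, X),
since End(a i) is one-dimensional. -/
lemma IsSplitSemisimple.trace_rightComp {k : Type u} [Field k] {C : Type v} [Category.{v'} C]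
    [Preadditive C] [Linear k C] {I : Type w} [DecidableEq I] {a : I → C}
    (h : IsSplitSemisimple k a) {X : C} (D : SumDecomposition a X) (β : X ⟶ X) (c : D.T → k)
    (hc : ∀ t, D.ι t ≫ β ≫ D.π t = c t • 𝟙 _) (i : I) :
    LinearMap.trace k (a i ⟶ X) (Linear.rightComp k (a i) β) =
      ∑ t with D.s t = i, c t := by
  have := h.finite_hom
  have h1 : Linear.rightComp k (a i) β = ∑ t, Linear.rightComp k (a i) (D.incl i t ≫ β) ∘ₗ
      Linear.rightComp k (a i) (D.proj i t) := by
    refine LinearMap.ext fun x => ?_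
    rw [Linear.rightComp_apply]
    conv_lhs => rw [← D.sum_comp_proj_incl h x]
    simp [Preadditive.sum_comp]
  rw [h1, map_sum, Finset.sum_subtype (p := fun t => D.s t = i)
    (Finset.univ.filter fun t => D.s t = i) (by simp)]
  refine Finset.sum_congr rfl ?_
  rintro ⟨t, rfl⟩ -
  rw [LinearMap.trace_comp_comm']
  have h2 : Linear.rightComp k (a (D.s t)) (D.proj _ ⟨t, rfl⟩) ∘ₗ
      Linear.rightComp k (a (D.s t)) (D.incl _ ⟨t, rfl⟩ ≫ β) = c t • LinearMap.id := by
    refine LinearMap.ext fun x => ?_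
    simp [SumDecomposition.incl, SumDecomposition.proj, hc]
  rw [h2, map_smul, LinearMap.trace_id, h.finrank_end]
  simp

/-- The trace of an endomorphism of a polynomial functor on a value of the functor, in terms of
the multiplicity spaces. -/
theorem exists_trace_isotypic {k : Type u} [Field k] {G : Type u} [Group G] {I : Type w}
    {a : I → PolyFunctor k G} (h : IsSplitSemisimple k a) (H : PolyFunctor k G) :
    ∃ S₀ : Finset I, ∀ S, S₀ ⊆ S → ∀ (β : H ⟶ H) {V : FDRep k G} (f : V ⟶ V),
      LinearMap.trace k _ (PolyFunctor.app V β ∘ₗ PolyFunctor.lmap H f) =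
        ∑ i ∈ S, LinearMap.trace k (a i ⟶ H) (Linear.rightComp k (a i) β) *
          PolyFunctor.char (a i) ⟨V, f⟩ := by
  classical
  obtain ⟨D⟩ := h.dec H
  -- The types occurring in `H`. The set depends on neither β nor f, and enlarging it only adds zero
  -- terms.
  refine ⟨Finset.univ.image D.s, fun S hS β V f => ?_⟩
  choose c hc using fun t => h.end_scalar (D.ι t ≫ β ≫ D.π t)
  simp only [h.trace_rightComp D β c hc, Finset.sum_mul]
  have h1 : PolyFunctor.app V β ∘ₗ PolyFunctor.lmap H f =
      ∑ t, PolyFunctor.app V (D.π t ≫ D.ι t ≫ β) ∘ₗ PolyFunctor.lmap H f := by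
    rw [← linearMap_sum_comp, ← map_sum]
    simp only [← Category.assoc, ← Preadditive.sum_comp, D.total, Category.id_comp]
  rw [h1, map_sum, ← Finset.sum_fiberwise_of_maps_to (t := S) (g := D.s)
    fun t _ => hS (Finset.mem_image_of_mem _ (Finset.mem_univ t))]
  refine Finset.sum_congr rfl fun i _ => Finset.sum_congr rfl fun t ht => ?_
  obtain rfl := (Finset.mem_filter.1 ht).2
  have h2 := PolyFunctor.trace_comp_retract (D.ι t ≫ β) (D.π t) f
  rw [h2, Category.assoc, hc, map_smul, LinearMap.smul_comp, map_smul]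
  rfl

end IsotypicTrace

/-! ### Linear independence of the characters of the simple functors. -/

section Independence

variable {k : Type u} [Field k] [CharZero k] {G : Type u} [Group G] [Finite G]

omit [CharZero k] [Finite G] in
lemma char_polyOfRep_smul {n : ℕ} (ρ : FDRep k (Wreath G n)) {V : FDRep k G} (c : k)
    (f : V ⟶ V) : PolyFunctor.char (polyOfRep ρ) ⟨V, c • f⟩ =
      c ^ n * PolyFunctor.char (polyOfRep ρ) ⟨V, f⟩ := by
  have h : PolyFunctor.lmap (polyOfRep ρ) (c • f) = c ^ n • PolyFunctor.lmap (polyOfRep ρ) f := by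
    refine LinearMap.ext fun x => ?_
    obtain ⟨x, rfl⟩ := (toPoly ρ V).surjective x
    rw [lmap_toPoly, tensorPow_map_smul, Linear.comp_smul, map_smul]
    rfl
  rw [PolyFunctor.char, h, map_smul, smul_eq_mul]
  rfl

/-- The character of `L_ρ` extends linearly to the endomorphisms of the tensor power. -/
def tensChar {n : ℕ} (ρ : FDRep k (Wreath G n)) (V : FDRep k G) :
    ((tensorPow k G n).obj V ⟶ (tensorPow k G n).obj V) →ₗ[k] k where
  toFun t := LinearMap.trace k (ρ ⟶ (tensorPow k G n).obj V) (Linear.rightComp k ρ t)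
  map_add' s t := by
    rw [← map_add]
    congr 1
  map_smul' c t := by
    rw [RingHom.id_apply, ← map_smul]
    congr 1

/-- Scaling f separates the degrees. Within degree n the characters extend linearly to all of
End(V^{⊗n}), because the f^{⊗n} span. For V = X, the projector onto a copy of ρ has value 1 for ρ
and 0 for the other irreducibles. -/
theorem linearIndependent_char (hk : IsSplittingField k G) :
    LinearIndependent k fun i : SimpleIndex k G => PolyFunctor.char (simplePoly i) := by
  classical
  rw [linearIndependent_iff']
  rintro s c hc ⟨n, i⟩ hi
  have hss := isSplitSemisimple_of_splittingField (isSplittingField_wreath hk n)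
  have hc' : ∀ (V : FDRep k G) (f : V ⟶ V),
      ∑ a ∈ s, c a * PolyFunctor.char (simplePoly a) ⟨V, f⟩ = 0 := fun V f => by
    simpa using congrFun hc ⟨V, f⟩
  obtain ⟨S, w, hw⟩ := exists_extraction k (s.sup Sigma.fst) n
  have h1 : ∀ (V : FDRep k G) (f : V ⟶ V), ∑ a ∈ s, (if a.1 = n then c a *
      PolyFunctor.char (simplePoly a) ⟨V, f⟩ else 0) = 0 := by
    intro V f
    have : ∑ t ∈ S, w t * ∑ a ∈ s, c a * PolyFunctor.char (simplePoly a) ⟨V, t • f⟩ = 0 :=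
      Finset.sum_eq_zero fun t _ => by rw [hc', mul_zero]
    refine Eq.trans ?_ this
    simp only [Finset.mul_sum]
    rw [Finset.sum_comm]
    refine Finset.sum_congr rfl fun a ha => ?_
    have h := hw a.1 (Finset.le_sup (f := Sigma.fst) ha)
    rw [← mul_boole, ← h, Finset.mul_sum]
    refine Finset.sum_congr rfl fun t _ => ?_
    rw [show PolyFunctor.char (simplePoly a) ⟨V, t • f⟩ = _ from char_polyOfRep_smul a.2.rep t f]
    simp only [simplePoly]
    ring
  have h2 : ∀ V : FDRep k G, ∑ b ∈ s.preimage (Sigma.mk n) sigma_mk_injective.injOn,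
      c ⟨n, b⟩ • tensChar b.rep V = 0 := by
    intro V
    refine hom_ext_tensorPow fun f => ?_
    rw [LinearMap.sum_apply, LinearMap.zero_apply, ← h1 V f, ← Finset.sum_preimage (Sigma.mk n)
      s sigma_mk_injective.injOn]
    · exact Finset.sum_congr rfl fun b _ => (if_pos rfl).symm
    · rintro ⟨m, a⟩ _ ha
      rw [if_neg]
      rintro rfl
      exact ha ⟨a, rfl⟩
  obtain ⟨j, r, hjr⟩ := exists_retract_tensorPow_regPow i.rep
  have h3 := LinearMap.congr_fun (h2 (regPow k G n)) (r ≫ j)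
  rw [LinearMap.sum_apply, Finset.sum_eq_single_of_mem i (by simpa using hi)] at h3
  · have : tensChar i.rep _ (r ≫ j) = 1 := by
      have h : Linear.rightComp k i.rep (r ≫ j) =
          Linear.rightComp k i.rep j ∘ₗ Linear.rightComp k i.rep r :=
        LinearMap.ext fun x => (Category.assoc x r j).symm
      have h' : Linear.rightComp k i.rep r ∘ₗ Linear.rightComp k i.rep j = LinearMap.id :=
        LinearMap.ext fun x => by simp [hjr]
      change LinearMap.trace k _ (Linear.rightComp k i.rep (r ≫ j)) = 1
      rw [h, LinearMap.trace_comp_comm', h', LinearMap.trace_id, hss.finrank_end, Nat.cast_one]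
    simpa [this] using h3
  · intro b _ hb
    have : tensChar b.rep _ (r ≫ j) = 0 := by
      have h : Linear.rightComp k b.rep (r ≫ j) = 0 := LinearMap.ext fun x => by
        rw [Linear.rightComp_apply, ← Category.assoc, hss.hom_zero hb (x ≫ r), Limits.zero_comp]
        rfl
      change LinearMap.trace k _ (Linear.rightComp k b.rep (r ≫ j)) = 0
      rw [h, map_zero]
    rw [LinearMap.smul_apply, this, smul_zero]

end Independence

/-! ### Polynomial functors on direct sums -/

section Shift

open Limits

variable {k : Type u} [Field k] {G : Type u} [Group G]

lemma biprod_map_id {C : Type*} [Category* C] [Preadditive C] [HasBinaryBiproducts C] (V W : C) :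
    biprod.map (𝟙 V) (𝟙 W) = 𝟙 (V ⊞ W) := by
  apply biprod.hom_ext <;> simp

lemma biprod_map_comp {C : Type*} [Category* C] [Preadditive C] [HasBinaryBiproducts C]
    {U U' V V' W W' : C} (f : U ⟶ V) (g : V ⟶ W) (f' : U' ⟶ V') (g' : V' ⟶ W') :
    biprod.map f f' ≫ biprod.map g g' = biprod.map (f ≫ g) (f' ≫ g') := by
  apply biprod.hom_ext <;> simp

namespace PolyFunctor

lemma lmap_lmap (F : PolyFunctor k G) {U V W : FDRep k G} (f : U ⟶ V) (g : V ⟶ W)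
    (x : F.obj.obj U) : lmap F g (lmap F f x) = lmap F (f ≫ g) x := by
  rw [lmap_comp, LinearMap.comp_apply]

/-- The functor `V ↦ F (V ⊕ W)`. -/
def shift (F : PolyFunctor k G) (W : FDRep k G) : PolyFunctor k G :=
  ofLinear (fun V => F.obj.obj (V ⊞ W)) (fun f => lmap F (biprod.map f (𝟙 W)))
    (fun V => by rw [biprod_map_id, lmap_id])
    (fun f g => by rw [← lmap_comp, biprod_map_comp, Category.comp_id])
    (exists_isPolynomialMap F).choose fun V V' => by
      have h := ((exists_isPolynomialMap F).choose_spec (V ⊞ W) (V' ⊞ W)).comp_affine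
        (biprod.snd ≫ biprod.inr)
        (Linear.leftComp k _ biprod.fst ∘ₗ Linear.rightComp k _ biprod.inl)
      convert h using 3 with f
      apply biprod.hom_ext <;> apply biprod.hom_ext' <;> simp

variable {F H K : PolyFunctor k G}

/-- The values of `shift`. -/
def toShift (F : PolyFunctor k G) (W V : FDRep k G) :
    F.obj.obj (V ⊞ W) ≃ₗ[k] (shift F W).obj.obj V := LinearEquiv.refl k _

lemma lmap_shift (F : PolyFunctor k G) (W : FDRep k G) {V V' : FDRep k G} (f : V ⟶ V')
    (x : F.obj.obj (V ⊞ W)) : lmap (shift F W) f (toShift F W V x) =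
      toShift F W V' (lmap F (biprod.map f (𝟙 W)) x) := rfl

/-- The functoriality of `shift` in the shift. -/
def shiftMap (F : PolyFunctor k G) {W W' : FDRep k G} (g : W ⟶ W') : shift F W ⟶ shift F W' :=
  mk (fun V => (toShift F W' V).toLinearMap ∘ₗ lmap F (biprod.map (𝟙 V) g) ∘ₗ
      (toShift F W V).symm.toLinearMap) fun {V V'} f x => by
    obtain ⟨x, rfl⟩ := (toShift F W V).surjective x
    simp only [lmap_shift, LinearMap.comp_apply, LinearEquiv.coe_coe,
      LinearEquiv.symm_apply_apply, lmap_lmap, biprod_map_comp, Category.comp_id, Category.id_comp]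

lemma app_shiftMap (F : PolyFunctor k G) {W W' : FDRep k G} (g : W ⟶ W') (V : FDRep k G)
    (x : F.obj.obj (V ⊞ W)) : app V (shiftMap F g) (toShift F W V x) =
      toShift F W' V (lmap F (biprod.map (𝟙 V) g) x) := rfl

/-- An element `x₀ ∈ A(W₀)` generates the functor `A`. -/
def IsGenerator (A : PolyFunctor k G) (W₀ : FDRep k G) (x₀ : A.obj.obj W₀) : Prop :=
  ∀ (H : PolyFunctor k G) (α : A ⟶ H), app W₀ α x₀ = 0 → α = 0

/-! ### Multiplicity functors and the adjunction with the tensor product. -/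

section Multiplicity

variable {A : PolyFunctor k G} {W₀ : FDRep k G} {x₀ : A.obj.obj W₀} (hA : IsGenerator A W₀ x₀)

variable (x₀) in
/-- The values at the generator of the morphisms `A ⟶ F(- ⊕ W)`. -/
def multSpace (F : PolyFunctor k G) (W : FDRep k G) : Submodule k (F.obj.obj (W₀ ⊞ W)) :=
  LinearMap.range ((toShift F W W₀).symm.toLinearMap ∘ₗ (app W₀).flip x₀)

/-- Morphisms from a functor with a generator are determined by the value at the generator. -/
def evEquiv (hA : IsGenerator A W₀ x₀) (F : PolyFunctor k G) (W : FDRep k G) :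
    (A ⟶ shift F W) ≃ₗ[k] multSpace x₀ F W :=
  LinearEquiv.ofInjective _ (LinearMap.ker_eq_bot.1 (LinearMap.ker_eq_bot'.2 fun α hα =>
    hA _ α ((toShift F W W₀).symm.map_eq_zero_iff.1 hα)))

lemma coe_evEquiv (F : PolyFunctor k G) (W : FDRep k G) (α : A ⟶ shift F W) :
    (evEquiv hA F W α : F.obj.obj (W₀ ⊞ W)) = (toShift F W W₀).symm (app W₀ α x₀) := rfl

/-- The action of a morphism on the multiplicity spaces. -/
def multMap (hA : IsGenerator A W₀ x₀) (F : PolyFunctor k G) {W W' : FDRep k G} (g : W ⟶ W') :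
    multSpace x₀ F W →ₗ[k] multSpace x₀ F W' :=
  (evEquiv hA F W').toLinearMap ∘ₗ
      Linear.rightComp k A (shiftMap F g) ∘ₗ (evEquiv hA F W).symm.toLinearMap

lemma multMap_evEquiv (F : PolyFunctor k G) {W W' : FDRep k G} (g : W ⟶ W') (α : A ⟶ shift F W) :
    multMap hA F g (evEquiv hA F W α) = evEquiv hA F W' (α ≫ shiftMap F g) := by
  simp [multMap]

/-- Evaluation at the generator realizes the multiplicity spaces inside the values F(W₀ ⊕ W),
compatibly with F(1 ⊕ g). This brings the Hom-spaces into the universe `u` and makes the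
multiplicity functor polynomial. -/
lemma coe_multMap (F : PolyFunctor k G) {W W' : FDRep k G} (g : W ⟶ W') (y : multSpace x₀ F W) :
    (multMap hA F g y : F.obj.obj (W₀ ⊞ W')) = lmap F (biprod.map (𝟙 W₀) g) y := by
  obtain ⟨α, rfl⟩ := (evEquiv hA F W).surjective y
  rw [multMap_evEquiv, coe_evEquiv, coe_evEquiv, app_comp, LinearMap.comp_apply]
  obtain ⟨x, hx⟩ := (toShift F W W₀).surjective (app W₀ α x₀)
  rw [← hx, app_shiftMap, LinearEquiv.symm_apply_apply, LinearEquiv.symm_apply_apply]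

lemma isPolynomialMap_multMap {d : ℕ} (hd : ∀ V W : FDRep k G,
    IsPolynomialMap k d fun f : V ⟶ W => lmap F f) (V V' : FDRep k G) :
    IsPolynomialMap k d fun g : V ⟶ V' => multMap hA F g := by
  obtain ⟨s, hs⟩ := LinearMap.exists_leftInverse_of_injective
    (multSpace x₀ F V').subtype (by simp)
  let l : (F.obj.obj (W₀ ⊞ V) →ₗ[k] F.obj.obj (W₀ ⊞ V')) →ₗ[k]
      (multSpace x₀ F V →ₗ[k] multSpace x₀ F V') :=
    { toFun := fun t => s ∘ₗ t ∘ₗ (multSpace x₀ F V).subtype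
      map_add' := fun t t' => by rw [LinearMap.add_comp, LinearMap.comp_add]
      map_smul' := fun c t => by rw [LinearMap.smul_comp, LinearMap.comp_smul, RingHom.id_apply] }
  have h := ((hd (W₀ ⊞ V) (W₀ ⊞ V')).comp_affine (biprod.fst ≫ biprod.inl)
    (Linear.leftComp k _ biprod.snd ∘ₗ Linear.rightComp k _ biprod.inr)).comp_linear l
  convert h using 2 with g
  have e1 : (biprod.fst ≫ biprod.inl : W₀ ⊞ V ⟶ W₀ ⊞ V') +
      (Linear.leftComp k _ biprod.snd ∘ₗ Linear.rightComp k _ biprod.inr) g =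
      biprod.map (𝟙 W₀) g := by
    apply biprod.hom_ext <;> apply biprod.hom_ext' <;> simp
  rw [e1]
  refine LinearMap.ext fun y => ?_
  change _ = s (lmap F (biprod.map (𝟙 W₀) g) y)
  rw [← coe_multMap hA]
  exact (LinearMap.congr_fun hs _).symm

/-- The functor `W ↦ Hom(A, F(- ⊕ W))`. -/
def multFunctor (hA : IsGenerator A W₀ x₀) (F : PolyFunctor k G) : PolyFunctor k G :=
  ofLinear (fun W => multSpace x₀ F W) (fun g => multMap hA F g)
    (fun V => LinearMap.ext fun x => Subtype.ext (by
      rw [coe_multMap, biprod_map_id, lmap_id]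
      rfl))
    (fun f g => LinearMap.ext fun x => Subtype.ext (by
      rw [coe_multMap, LinearMap.comp_apply, coe_multMap, coe_multMap, lmap_lmap,
        biprod_map_comp, Category.comp_id]))
    (exists_isPolynomialMap F).choose
    (isPolynomialMap_multMap hA (exists_isPolynomialMap F).choose_spec)

/-- The values of `multFunctor`. -/
def toMult (hA : IsGenerator A W₀ x₀) (F : PolyFunctor k G) (W : FDRep k G) :
    (A ⟶ shift F W) ≃ₗ[k] (multFunctor hA F).obj.obj W := evEquiv hA F W

lemma lmap_toMult (F : PolyFunctor k G) {W W' : FDRep k G} (g : W ⟶ W') (α : A ⟶ shift F W) :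
    lmap (multFunctor hA F) g (toMult hA F W α) = toMult hA F W' (α ≫ shiftMap F g) :=
  multMap_evEquiv hA F g α

lemma char_multFunctor (F : PolyFunctor k G) {W : FDRep k G} (g : W ⟶ W) :
    char (multFunctor hA F) ⟨W, g⟩ =
      LinearMap.trace k (A ⟶ shift F W) (Linear.rightComp k A (shiftMap F g)) := by
  rw [← LinearMap.trace_conj' _ (toMult hA F W), char]
  congr 1

variable {B : PolyFunctor k G}

/-- A pure tensor in a value of a tensor product of functors. -/
def tens (A B : PolyFunctor k G) (V : FDRep k G) :
    A.obj.obj V →ₗ[k] B.obj.obj V →ₗ[k] (A ⊗ B).obj.obj V :=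
  TensorProduct.mk k (A.obj.obj V) (B.obj.obj V)

/-- A linear map on a value of a tensor product of functors from a bilinear map. -/
def tensLift {A B : PolyFunctor k G} {V : FDRep k G} {N : Type u} [AddCommGroup N] [Module k N]
    (b : A.obj.obj V →ₗ[k] B.obj.obj V →ₗ[k] N) : (A ⊗ B).obj.obj V →ₗ[k] N :=
  (TensorProduct.lift b : A.obj.obj V ⊗[k] B.obj.obj V →ₗ[k] N)

lemma tensLift_tens {V : FDRep k G} {N : Type u} [AddCommGroup N] [Module k N]
    (b : A.obj.obj V →ₗ[k] B.obj.obj V →ₗ[k] N) (x : A.obj.obj V) (y : B.obj.obj V) :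
    tensLift b (tens A B V x y) = b x y := rfl

lemma tens_ext {V : FDRep k G} {N : Type u} [AddCommGroup N] [Module k N]
    {p q : (A ⊗ B).obj.obj V →ₗ[k] N} (h : ∀ x y, p (tens A B V x y) = q (tens A B V x y)) :
    p = q := TensorProduct.ext' h

lemma lmap_tens {V W : FDRep k G} (f : V ⟶ W) (x : A.obj.obj V) (y : B.obj.obj V) :
    lmap (A ⊗ B) f (tens A B V x y) = tens A B W (lmap A f x) (lmap B f y) := rfl

/-- The bilinear maps underlying `uncurry`. -/
def uncurryBilin (F : PolyFunctor k G) (γ : B ⟶ multFunctor hA F) (V : FDRep k G) :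
    A.obj.obj V →ₗ[k] B.obj.obj V →ₗ[k] F.obj.obj V :=
  LinearMap.mk₂ k (fun x y => lmap F (biprod.desc (𝟙 V) (𝟙 V))
      ((toShift F V V).symm (app V ((toMult hA F V).symm (app V γ y)) x)))
    (fun _ _ _ => by simp only [map_add]) (fun _ _ _ => by simp only [map_smul])
    (fun _ _ _ => by simp only [map_add, LinearMap.add_apply])
    (fun _ _ _ => by simp only [map_smul, LinearMap.smul_apply])

lemma uncurryBilin_naturality (F : PolyFunctor k G) (γ : B ⟶ multFunctor hA F) {V W : FDRep k G}
    (f : V ⟶ W) : tensLift (uncurryBilin hA F γ W) ∘ₗ lmap (A ⊗ B) f =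
      lmap F f ∘ₗ tensLift (uncurryBilin hA F γ V) := by
  refine tens_ext fun x y => ?_
  simp only [LinearMap.comp_apply, lmap_tens, tensLift_tens, LinearMap.mk₂_apply, uncurryBilin]
  obtain ⟨α, hα⟩ := (toMult hA F V).surjective (app V γ y)
  obtain ⟨z, hz⟩ := (toShift F V V).surjective (app V α x)
  rw [app_naturality γ, ← hα, lmap_toMult, LinearEquiv.symm_apply_apply,
    LinearEquiv.symm_apply_apply, app_comp, LinearMap.comp_apply, app_naturality, ← hz,
    lmap_shift, app_shiftMap, LinearEquiv.symm_apply_apply, LinearEquiv.symm_apply_apply,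
    lmap_lmap, lmap_lmap, lmap_lmap]
  congr 2
  apply biprod.hom_ext' <;> simp

/-- The morphism `A ⊗ B ⟶ F` corresponding to a morphism from `B` to the multiplicity functor. -/
def uncurry (F : PolyFunctor k G) (γ : B ⟶ multFunctor hA F) : A ⊗ B ⟶ F :=
  mk (fun V => tensLift (uncurryBilin hA F γ V))
    fun f => LinearMap.congr_fun (uncurryBilin_naturality hA F γ f)

lemma app_uncurry (F : PolyFunctor k G) (γ : B ⟶ multFunctor hA F) (V : FDRep k G)
    (x : A.obj.obj V) (y : B.obj.obj V) :
    app V (uncurry hA F γ) (tens A B V x y) = lmap F (biprod.desc (𝟙 V) (𝟙 V))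
      ((toShift F V V).symm (app V ((toMult hA F V).symm (app V γ y)) x)) := rfl

/-- The restriction of a morphism on a tensor product to an element of one factor. -/
def curryElem (F : PolyFunctor k G) (α : A ⊗ B ⟶ F) (W : FDRep k G) (y : B.obj.obj W) :
    A ⟶ shift F W :=
  mk (fun V => (toShift F W V).toLinearMap ∘ₗ app (V ⊞ W) α ∘ₗ
      (tens A B (V ⊞ W)).flip (lmap B biprod.inr y) ∘ₗ lmap A biprod.inl) fun {V V'} f x => by
    simp only [LinearMap.comp_apply, LinearEquiv.coe_coe, LinearMap.flip_apply, lmap_shift,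
      ← app_naturality, lmap_tens, lmap_lmap]
    simp

lemma app_curryElem (F : PolyFunctor k G) (α : A ⊗ B ⟶ F) (V W : FDRep k G) (x : A.obj.obj V)
    (y : B.obj.obj W) : app V (curryElem F α W y) x = toShift F W V (app (V ⊞ W) α
      (tens A B (V ⊞ W) (lmap A biprod.inl x) (lmap B biprod.inr y))) := rfl

/-- `curryElem` as a linear map. -/
def curryLinear (F : PolyFunctor k G) (α : A ⊗ B ⟶ F) (W : FDRep k G) :
    B.obj.obj W →ₗ[k] (A ⟶ shift F W) where
  toFun := curryElem F α W
  map_add' y y' := hom_ext fun V x => by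
    simp only [map_add, LinearMap.add_apply, app_curryElem]
  map_smul' c y := hom_ext fun V x => by
    simp only [map_smul, LinearMap.smul_apply, app_curryElem, RingHom.id_apply]

/-- The morphism to the multiplicity functor corresponding to a morphism `A ⊗ B ⟶ F`. -/
def curry (F : PolyFunctor k G) (α : A ⊗ B ⟶ F) : B ⟶ multFunctor hA F :=
  mk (fun W => (toMult hA F W).toLinearMap ∘ₗ curryLinear F α W) fun {W W'} g y => by
    rw [LinearMap.comp_apply, LinearMap.comp_apply, LinearEquiv.coe_coe, LinearEquiv.coe_coe,
      lmap_toMult]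
    refine congrArg (toMult hA F W') ?_
    change curryElem F α W' _ = curryElem F α W y ≫ _
    refine hom_ext fun V x => ?_
    rw [app_comp, LinearMap.comp_apply, app_curryElem, app_curryElem, app_shiftMap,
      ← app_naturality, lmap_tens, lmap_lmap, lmap_lmap, lmap_lmap]
    simp

lemma app_curry (F : PolyFunctor k G) (α : A ⊗ B ⟶ F) (W : FDRep k G) (y : B.obj.obj W) :
    app W (curry hA F α) y = toMult hA F W (curryElem F α W y) := rfl

/-- Morphisms `A ⊗ B ⟶ F` are morphisms from `B` to the multiplicity functor of `A`. -/
def curryEquiv (B F : PolyFunctor k G) : (B ⟶ multFunctor hA F) ≃ₗ[k] (A ⊗ B ⟶ F) where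
  toFun := uncurry hA F
  invFun := curry hA F
  map_add' γ γ' := hom_ext fun V => LinearMap.congr_fun (tens_ext fun x y => by
    simp only [app_uncurry, map_add, LinearMap.add_apply])
  map_smul' c γ := hom_ext fun V => LinearMap.congr_fun (tens_ext fun x y => by
    simp only [app_uncurry, map_smul, LinearMap.smul_apply, RingHom.id_apply])
  left_inv γ := hom_ext fun W y => by
    rw [app_curry]
    obtain ⟨α, hα⟩ := (toMult hA F W).surjective (app W γ y)
    rw [← hα]
    congr 1
    refine hom_ext fun V x => ?_
    obtain ⟨z, hz⟩ := (toShift F W V).surjective (app V α x)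
    rw [app_curryElem, app_uncurry, app_naturality γ, ← hα, lmap_toMult,
      LinearEquiv.symm_apply_apply, app_comp, LinearMap.comp_apply, app_naturality α, ← hz,
      lmap_shift, app_shiftMap, LinearEquiv.symm_apply_apply, lmap_lmap, lmap_lmap]
    congr 1
    -- A triangle identity: the two inclusions into V ⊕ W followed by the codiagonal give the
    -- identity of V ⊕ W.
    refine (LinearMap.congr_fun (?_ : lmap F _ = LinearMap.id) z)
    rw [← lmap_id]
    congr 1
    apply biprod.hom_ext' <;> simp
  right_inv α := hom_ext fun V => LinearMap.congr_fun (tens_ext fun x y => by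
    rw [app_uncurry, app_curry, LinearEquiv.symm_apply_apply, app_curryElem,
      LinearEquiv.symm_apply_apply, ← app_naturality, lmap_tens, lmap_lmap, lmap_lmap]
    simp [lmap_id])

end Multiplicity

end PolyFunctor

/-! ### Homogeneous functors of different degrees. -/

section Degree

lemma IsHomogeneous.lmap_smul {n : ℕ} {F : PolyFunctor k G} (hF : IsHomogeneous n F)
    {V W : FDRep k G} (c : k) (f : V ⟶ W) :
    PolyFunctor.lmap F (c • f) = c ^ n • PolyFunctor.lmap F f := by
  rw [PolyFunctor.lmap, hF]
  rfl

lemma isHomogeneous_of_lmap_smul {n : ℕ} {F : PolyFunctor k G}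
    (h : ∀ {V W : FDRep k G} (c : k) (f : V ⟶ W),
      PolyFunctor.lmap F (c • f) = c ^ n • PolyFunctor.lmap F f) : IsHomogeneous n F := by
  intro V W c f
  ext x
  exact LinearMap.congr_fun (h c f) x

lemma isHomogeneous_polyOfRep {n : ℕ} (ρ : FDRep k (Wreath G n)) :
    IsHomogeneous n (polyOfRep ρ) :=
  isHomogeneous_of_lmap_smul fun {V W} c f => LinearMap.ext fun x => by
    obtain ⟨x, rfl⟩ := (toPoly ρ V).surjective x
    rw [lmap_toPoly, tensorPow_map_smul, Linear.comp_smul, map_smul]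
    rfl

lemma isHomogeneous_simplePoly (i : SimpleIndex k G) : IsHomogeneous i.1 (simplePoly i) :=
  isHomogeneous_polyOfRep i.2.rep

lemma IsHomogeneous.tensor {m n : ℕ} {F H : PolyFunctor k G} (hF : IsHomogeneous m F)
    (hH : IsHomogeneous n H) : IsHomogeneous (m + n) (F ⊗ H) :=
  isHomogeneous_of_lmap_smul fun {V W} c f => PolyFunctor.tens_ext fun x y => by
    rw [LinearMap.smul_apply, PolyFunctor.lmap_tens, PolyFunctor.lmap_tens, hF.lmap_smul,
      hH.lmap_smul, LinearMap.smul_apply, LinearMap.smul_apply, map_smul, map_smul,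
      LinearMap.smul_apply, smul_smul, pow_add, mul_comm]

lemma IsHomogeneous.hom_eq_zero [CharZero k] {m n : ℕ} (hmn : m ≠ n) {F H : PolyFunctor k G}
    (hF : IsHomogeneous m F) (hH : IsHomogeneous n H) (α : F ⟶ H) : α = 0 := by
  refine PolyFunctor.hom_ext fun V x => ?_
  have h := PolyFunctor.app_naturality α ((2 : k) • 𝟙 V) x
  rw [hF.lmap_smul, hH.lmap_smul, PolyFunctor.lmap_id, PolyFunctor.lmap_id, LinearMap.smul_apply,
    LinearMap.smul_apply, map_smul, LinearMap.id_apply, LinearMap.id_apply,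
    ← sub_eq_zero, ← sub_smul, smul_eq_zero] at h
  refine h.resolve_left fun h0 => hmn ?_
  rw [sub_eq_zero] at h0
  exact Nat.pow_right_injective le_rfl (by exact_mod_cast h0)

end Degree

/-! ### Values of characters on direct sums. -/

section Comul

variable [CharZero k] [Finite G]

/-- The inclusion of the irreducible representation into X^{⊗n} generates: its images under the
f^{⊗n} span all maps from the retract to V^{⊗n}. -/
lemma exists_isGenerator (i : SimpleIndex k G) :
    ∃ x₀, PolyFunctor.IsGenerator (simplePoly i) (regPow k G i.1) x₀ := by
  obtain ⟨j, r, hjr⟩ := exists_retract_tensorPow_regPow i.2.rep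
  refine ⟨toPoly i.2.rep _ j, fun H α hα => PolyFunctor.hom_ext fun V x => ?_⟩
  obtain ⟨x, rfl⟩ := (toPoly i.2.rep V).surjective x
  have h : (PolyFunctor.app V α ∘ₗ (toPoly i.2.rep V).toLinearMap) ∘ₗ Linear.leftComp k _ j = 0 :=
    hom_ext_tensorPow fun f => by
      refine (PolyFunctor.app_naturality α f (toPoly i.2.rep _ j)).trans ?_
      rw [hα, map_zero]
      rfl
  have h' := LinearMap.congr_fun h (r ≫ x)
  change PolyFunctor.app V α (toPoly i.2.rep V (j ≫ r ≫ x)) = 0 at h'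
  rwa [reassoc_of% hjr] at h'

lemma finite_simpleIndex_le (hk : IsSplittingField k G) (N : ℕ) :
    {i : SimpleIndex k G | i.1 ≤ N}.Finite := by
  have := fun n => finite_irr hk n
  refine (Set.finite_range fun i : Σ n : Fin (N + 1), Irr k (Wreath G n) =>
    (⟨i.1, i.2⟩ : SimpleIndex k G)).subset ?_
  rintro ⟨n, i⟩ hn
  exact ⟨⟨⟨n, Nat.lt_succ_of_le hn⟩, i⟩, rfl⟩

omit [Finite G] in
lemma degree_eq_of_finrank_ne_zero {i j l : SimpleIndex k G}
    (h : Module.finrank k (simplePoly i ⊗ simplePoly j ⟶ simplePoly l) ≠ 0) :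
    i.1 + j.1 = l.1 := by
  by_contra hne
  have : Subsingleton (simplePoly i ⊗ simplePoly j ⟶ simplePoly l) :=
    subsingleton_of_forall_eq 0 (IsHomogeneous.hom_eq_zero hne
      ((isHomogeneous_simplePoly i).tensor (isHomogeneous_simplePoly j))
      (isHomogeneous_simplePoly l))
  exact h Module.finrank_zero_of_subsingleton

/-- The multiplicities of the simple bifunctors in `F(V ⊕ W)`. -/
def comulCoeff (hk : IsSplittingField k G) (F : PolyFunctor k G) :
    SimpleIndex k G × SimpleIndex k G →₀ ℕ :=
  Finsupp.ofSupportFinite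
    (fun p => Module.finrank k (simplePoly p.1 ⊗ simplePoly p.2 ⟶ F)) <| by
    obtain ⟨D⟩ := (isSplitSemisimple_poly hk).dec F
    have hfin := finite_simpleIndex_le hk (Finset.univ.sup fun t => (D.s t).1)
    refine (hfin.prod hfin).subset fun p hp => ?_
    -- A nonzero Hom-space forces the two degrees to add up to the degree of a summand of `F`, which
    -- bounds both of them.
    have h : ∃ t, p.1.1 + p.2.1 = (D.s t).1 := by
      by_contra hcon
      push Not at hcon
      have : Subsingleton (simplePoly p.1 ⊗ simplePoly p.2 ⟶ F) := by
        refine subsingleton_of_forall_eq 0 fun α => ?_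
        rw [← Category.comp_id α, ← D.total, Preadditive.comp_sum]
        refine Finset.sum_eq_zero fun t _ => ?_
        rw [← Category.assoc, IsHomogeneous.hom_eq_zero (hcon t)
          ((isHomogeneous_simplePoly p.1).tensor (isHomogeneous_simplePoly p.2))
          (isHomogeneous_simplePoly _) (α ≫ D.π t), zero_comp]
      exact hp Module.finrank_zero_of_subsingleton
    obtain ⟨t, ht⟩ := h
    have := Finset.le_sup (f := fun t => (D.s t).1) (Finset.mem_univ t)
    simp only [Set.mem_prod, Set.mem_ofPred_eq]
    omega

lemma comulCoeff_apply (hk : IsSplittingField k G) (F : PolyFunctor k G)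
    (p : SimpleIndex k G × SimpleIndex k G) :
    comulCoeff hk F p = Module.finrank k (simplePoly p.1 ⊗ simplePoly p.2 ⟶ F) := rfl

/-- The character of a polynomial functor on a direct sum. -/
theorem char_biprod (hk : IsSplittingField k G) (F : PolyFunctor k G) {V W : FDRep k G}
    (f : V ⟶ V) (g : W ⟶ W) :
    PolyFunctor.char F ⟨V ⊞ W, biprod.map f g⟩ = (comulCoeff hk F).sum fun p n =>
      (n : k) * (PolyFunctor.char (simplePoly p.1) ⟨V, f⟩ *
        PolyFunctor.char (simplePoly p.2) ⟨W, g⟩) := by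
  classical
  have hss := isSplitSemisimple_poly hk
  choose x₀ hx₀ using exists_isGenerator (k := k) (G := G)
  -- F(f ⊕ g) is the value of F(- ⊕ W) at f followed by the endomorphism F(1 ⊕ g) of that functor,
  -- so its trace can be computed on multiplicity spaces.
  obtain ⟨S₀, hS₀⟩ := exists_trace_isotypic hss (PolyFunctor.shift F W)
  let S := S₀ ∪ (comulCoeff hk F).support.image Prod.fst
  have h1 := hS₀ S Finset.subset_union_left (PolyFunctor.shiftMap F g) f
  have h2 : LinearMap.trace k _ (PolyFunctor.app V (PolyFunctor.shiftMap F g) ∘ₗ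
      PolyFunctor.lmap (PolyFunctor.shift F W) f) =
      PolyFunctor.char F ⟨V ⊞ W, biprod.map f g⟩ := by
    have e : biprod.map f g = biprod.map f (𝟙 W) ≫ biprod.map (𝟙 V) g := by
      rw [biprod_map_comp, Category.comp_id, Category.id_comp]
    rw [PolyFunctor.char, e, PolyFunctor.lmap_comp]
    rfl
  rw [h2] at h1
  -- The adjunction turns the multiplicity of L_j in W ↦ Hom(L_i, F(- ⊕ W)) into dim Hom(L_i ⊗ L_j,
  -- F).
  have h3 : ∀ i j, hss.mult (PolyFunctor.multFunctor (hx₀ i) F) j = comulCoeff hk F (i, j) := by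
    intro i j
    rw [hss.mult_apply, comulCoeff_apply, (PolyFunctor.curryEquiv (hx₀ i) _ F).finrank_eq]
  let S' := (S.biUnion fun i => (hss.mult (PolyFunctor.multFunctor (hx₀ i) F)).support) ∪
    (comulCoeff hk F).support.image Prod.snd
  have h4 : ∀ i ∈ S, LinearMap.trace k (simplePoly i ⟶ PolyFunctor.shift F W)
      (Linear.rightComp k (simplePoly i) (PolyFunctor.shiftMap F g)) =
      ∑ j ∈ S', (comulCoeff hk F (i, j) : k) * PolyFunctor.char (simplePoly j) ⟨W, g⟩ := by
    intro i hi
    rw [← PolyFunctor.char_multFunctor (hx₀ i), hss.splitAdditive_eq PolyFunctor.splitAdditive_char,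
      Finsupp.sum_of_support_subset (s := S') _ _ _ (by simp)]
    · rw [Finset.sum_apply]
      refine Finset.sum_congr rfl fun j _ => ?_
      rw [h3]
      simp
    · exact (Finset.subset_biUnion_of_mem (fun i => (hss.mult
        (PolyFunctor.multFunctor (hx₀ i) F)).support) hi).trans Finset.subset_union_left
  rw [h1, Finset.sum_congr rfl fun i hi => by rw [h4 i hi],
    Finsupp.sum_of_support_subset (s := S ×ˢ S') _ _ _ (by simp), Finset.sum_product]
  · refine Finset.sum_congr rfl fun i _ => ?_
    rw [Finset.sum_mul]
    exact Finset.sum_congr rfl fun j _ => by ring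
  · intro p hp
    exact Finset.mem_product.2 ⟨Finset.mem_union_right _ (Finset.mem_image_of_mem _ hp),
      Finset.mem_union_right _ (Finset.mem_image_of_mem _ hp)⟩

end Comul

end Shift

/-! ### PSH algebras of functions -/

section Independence

variable {k : Type u} [Field k]

/-- For fixed y, independence of `v` isolates one first index; then let y vary and use independence
of `v'`. -/
lemma linearIndependent_mul {I I' X Y : Type*} {v : I → X → k} {v' : I' → Y → k}
    (hv : LinearIndependent k v) (hv' : LinearIndependent k v') :
    LinearIndependent k fun (p : I × I') (q : X × Y) => v p.1 q.1 * v' p.2 q.2 := by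
  classical
  rw [linearIndependent_iff']
  intro s c hc p hp
  let c' : I × I' → k := fun p => if p ∈ s then c p else 0
  have h1 : ∀ x y, ∑ i ∈ s.image Prod.fst, (∑ j ∈ s.image Prod.snd, c' (i, j) * v' j y) * v i x
      = 0 := by
    intro x y
    have h := congrFun hc (x, y)
    rw [Finset.sum_apply, Pi.zero_apply] at h
    rw [← h]
    simp only [Finset.sum_mul]
    rw [← Finset.sum_product', ← Finset.sum_subset (s₁ := s)]
    · refine Finset.sum_congr rfl fun q hq => ?_
      simp [c', hq]
      ring
    · intro q hq
      exact Finset.mem_product.2 ⟨Finset.mem_image_of_mem _ hq, Finset.mem_image_of_mem _ hq⟩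
    · intro q _ hq
      simp [c', hq]
  have h2 : ∀ y, ∑ j ∈ s.image Prod.snd, c' (p.1, j) * v' j y = 0 := fun y =>
    linearIndependent_iff'.1 hv _ (fun i => ∑ j ∈ s.image Prod.snd, c' (i, j) * v' j y)
      (funext fun x => by simpa using h1 x y) p.1 (Finset.mem_image_of_mem _ hp)
  have h3 := linearIndependent_iff'.1 hv' _ (fun j => c' (p.1, j))
    (funext fun y => by simpa using h2 y) p.2 (Finset.mem_image_of_mem _ hp)
  simpa [c', hp] using h3

end Independence

/-! ### Coalgebra axioms checked on values. -/

section Evaluation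

variable {R : Type*} {k : Type u} [CommRing R] [Field k] [Algebra R k]

/-- The characters of a tensor product of algebras given by pairs of characters. -/
def evalTensor {A B X Y : Type*} [CommRing A] [Algebra R A] [CommRing B] [Algebra R B]
    (φ : X → A →ₐ[R] k) (ψ : Y → B →ₐ[R] k) (p : X × Y) : A ⊗[R] B →ₐ[R] k :=
  Algebra.TensorProduct.productMap (φ p.1) (ψ p.2)

lemma evalTensor_tmul {A B X Y : Type*} [CommRing A] [Algebra R A] [CommRing B] [Algebra R B]
    (φ : X → A →ₐ[R] k) (ψ : Y → B →ₐ[R] k) (p : X × Y) (a : A) (b : B) :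
    evalTensor φ ψ p (a ⊗ₜ b) = φ p.1 a * ψ p.2 b :=
  Algebra.TensorProduct.productMap_apply_tmul _ _ a b

/-- The principle behind all the Hopf identities: when the basis functions are independent over `k`,
values separate elements, and by `linearIndependent_evalTensor` the same holds in tensor powers of
`A`. -/
lemma eq_of_eval_eq {A I X : Type*} [CommRing A] [Algebra R A] {φ : X → A →ₐ[R] k}
    {b : Module.Basis I R A} (hR : Function.Injective (algebraMap R k))
    (hb : LinearIndependent k fun i x => φ x (b i)) {a a' : A} (h : ∀ x, φ x a = φ x a') :
    a = a' := by
  have hb' : LinearIndependent R fun i x => φ x (b i) := hb.restrict_scalars fun r s hrs =>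
    hR (by simpa [Algebra.smul_def] using hrs)
  have e : ∀ a : A, (fun x => φ x a) = Finsupp.linearCombination R (fun i x => φ x (b i))
      (b.repr a) := by
    intro a
    funext x
    conv_lhs => rw [← b.linearCombination_repr a]
    simp [Finsupp.linearCombination_apply, Finsupp.sum, map_sum, Finset.sum_apply]
  refine b.repr.injective (hb' ?_)
  rw [← e, ← e]
  exact funext h

lemma linearIndependent_evalTensor {I J A B X Y : Type*} [CommRing A] [Algebra R A] [CommRing B]
    [Algebra R B] {φ : X → A →ₐ[R] k} {ψ : Y → B →ₐ[R] k} {b : Module.Basis I R A}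
    {c : Module.Basis J R B} (hb : LinearIndependent k fun i x => φ x (b i))
    (hc : LinearIndependent k fun i y => ψ y (c i)) :
    LinearIndependent k (fun p q => evalTensor φ ψ q (b.tensorProduct c p)) := by
  convert linearIndependent_mul hb hc using 1
  funext p q
  rw [Module.Basis.tensorProduct_apply, evalTensor_tmul]

variable {A I X : Type*} [CommRing A] [Algebra R A] [CoalgebraStruct R A] {φ : X → A →ₐ[R] k}
  {plus : X → X → X} {zero : X}

/-- On values the comultiplication is pullback along `plus`, so coassociativity reduces to
associativity of `plus`. -/
lemma eval_lTensor_comul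
    (hc : ∀ a x y, evalTensor φ φ (x, y) (Coalgebra.comul (R := R) a) = φ (plus x y) a)
    (t : A ⊗[R] A) (x y z : X) :
    evalTensor φ (evalTensor φ φ) (x, y, z) ((Coalgebra.comul (R := R) (A := A)).lTensor A t) =
      evalTensor φ φ (x, plus y z) t := by
  induction t using TensorProduct.induction_on with
  | zero => simp only [map_zero]
  | tmul a b => rw [LinearMap.lTensor_tmul, evalTensor_tmul, hc, evalTensor_tmul]
  | add s t hs ht => rw [map_add, map_add, map_add, hs, ht]

omit [CoalgebraStruct R A] in
lemma eval_assoc (s : A ⊗[R] A) (b : A) (x y z : X) :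
    evalTensor φ (evalTensor φ φ) (x, y, z) (TensorProduct.assoc R A A A (s ⊗ₜ b)) =
      evalTensor φ φ (x, y) s * φ z b := by
  induction s using TensorProduct.induction_on with
  | zero => simp only [TensorProduct.zero_tmul, map_zero, zero_mul]
  | tmul p q =>
    rw [TensorProduct.assoc_tmul, evalTensor_tmul, evalTensor_tmul, evalTensor_tmul, mul_assoc]
  | add s t hs ht => rw [TensorProduct.add_tmul, map_add, map_add, map_add, hs, ht, add_mul]

lemma eval_rTensor_comul
    (hc : ∀ a x y, evalTensor φ φ (x, y) (Coalgebra.comul (R := R) a) = φ (plus x y) a)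
    (t : A ⊗[R] A) (x y z : X) :
    evalTensor φ (evalTensor φ φ) (x, y, z) (TensorProduct.assoc R A A A
      ((Coalgebra.comul (R := R) (A := A)).rTensor A t)) = evalTensor φ φ (plus x y, z) t := by
  induction t using TensorProduct.induction_on with
  | zero => simp only [map_zero]
  | tmul a b => rw [LinearMap.rTensor_tmul, eval_assoc, hc, evalTensor_tmul]
  | add s t hs ht => rw [map_add, map_add, map_add, map_add, hs, ht]

lemma eval_lid_rTensor_counit
    (h0 : ∀ a : A, algebraMap R k (Coalgebra.counit a) = φ zero a) (t : A ⊗[R] A) (x : X) :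
    φ x (TensorProduct.lid R A ((Coalgebra.counit (R := R) (A := A)).rTensor A t)) =
      evalTensor φ φ (zero, x) t := by
  induction t using TensorProduct.induction_on with
  | zero => simp only [map_zero]
  | tmul a b =>
    rw [LinearMap.rTensor_tmul, TensorProduct.lid_tmul, map_smul, Algebra.smul_def, h0,
      evalTensor_tmul]
  | add s t hs ht => rw [map_add, map_add, map_add, map_add, hs, ht]

lemma eval_rid_lTensor_counit
    (h0 : ∀ a : A, algebraMap R k (Coalgebra.counit a) = φ zero a) (t : A ⊗[R] A) (x : X) :
    φ x (TensorProduct.rid R A ((Coalgebra.counit (R := R) (A := A)).lTensor A t)) =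
      evalTensor φ φ (x, zero) t := by
  induction t using TensorProduct.induction_on with
  | zero => simp only [map_zero]
  | tmul a b =>
    rw [LinearMap.lTensor_tmul, TensorProduct.rid_tmul, map_smul, Algebra.smul_def, h0,
      evalTensor_tmul, mul_comm]
  | add s t hs ht => rw [map_add, map_add, map_add, map_add, hs, ht]

/-- A coalgebra structure on an algebra of functions on a monoid. -/
abbrev coalgebraOfEval {b : Module.Basis I R A} (hR : Function.Injective (algebraMap R k))
    (hb : LinearIndependent k fun i x => φ x (b i))
    (hc : ∀ a x y, evalTensor φ φ (x, y) (Coalgebra.comul (R := R) a) = φ (plus x y) a)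
    (h0 : ∀ a : A, algebraMap R k (Coalgebra.counit a) = φ zero a)
    (assoc : ∀ a x y z, φ (plus (plus x y) z) a = φ (plus x (plus y z)) a)
    (zero_plus : ∀ a x, φ (plus zero x) a = φ x a) (plus_zero : ∀ a x, φ (plus x zero) a = φ x a) :
    Coalgebra R A where
  coassoc := LinearMap.ext fun a => eq_of_eval_eq hR
    (linearIndependent_evalTensor hb (linearIndependent_evalTensor hb hb)) fun ⟨x, y, z⟩ => by
      refine (eval_rTensor_comul hc _ x y z).trans (Eq.trans ?_ (eval_lTensor_comul hc _ x y z).symm)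
      rw [hc, hc, assoc]
  rTensor_counit_comp_comul := LinearMap.ext fun a => (TensorProduct.lid R A).injective
    (eq_of_eval_eq hR hb fun x => by
      refine (eval_lid_rTensor_counit h0 _ x).trans ?_
      rw [hc, zero_plus, TensorProduct.mk_apply, TensorProduct.lid_tmul, one_smul])
  lTensor_counit_comp_comul := LinearMap.ext fun a => (TensorProduct.rid R A).injective
    (eq_of_eval_eq hR hb fun x => by
      refine (eval_rid_lTensor_counit h0 _ x).trans ?_
      rw [hc, plus_zero, LinearMap.flip_apply, TensorProduct.mk_apply, TensorProduct.rid_tmul,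
        one_smul])

lemma comul_mul_of_eval {b : Module.Basis I R A} (hR : Function.Injective (algebraMap R k))
    (hb : LinearIndependent k fun i x => φ x (b i))
    (hc : ∀ a x y, evalTensor φ φ (x, y) (Coalgebra.comul (R := R) a) = φ (plus x y) a) (a a' : A) :
    Coalgebra.comul (R := R) (a * a') = Coalgebra.comul (R := R) a * Coalgebra.comul (R := R) a' :=
  eq_of_eval_eq hR (linearIndependent_evalTensor hb hb) fun ⟨x, y⟩ => by
    rw [hc, map_mul (φ _), map_mul (evalTensor φ φ _), hc, hc]

lemma comul_one_of_eval {b : Module.Basis I R A} (hR : Function.Injective (algebraMap R k))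
    (hb : LinearIndependent k fun i x => φ x (b i))
    (hc : ∀ a x y, evalTensor φ φ (x, y) (Coalgebra.comul (R := R) a) = φ (plus x y) a) :
    Coalgebra.comul (R := R) (1 : A) = 1 :=
  eq_of_eval_eq hR (linearIndependent_evalTensor hb hb) fun ⟨x, y⟩ => by
    rw [hc, map_one, map_one]

end Evaluation


/-- Functions on a set `Ω` with a binary operation that are the basis of a PSH algebra: products
and values on sums are described by the same structure constants. -/
structure CharData (k : Type u) [Field k] (I : Type v) (Ω : Type w) where
  χ : I → Ω → k
  indep : LinearIndependent k χ
  deg : I → ℕ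
  finite_deg : ∀ n, {i | deg i = n}.Finite
  unit : I
  χ_unit : χ unit = 1
  deg_eq_zero : ∀ i, deg i = 0 ↔ i = unit
  /-- The structure constants of the comultiplication. -/
  N : I → I × I →₀ ℕ
  /-- The structure constants of the multiplication. -/
  M : I → I → I →₀ ℕ
  M_apply : ∀ i j l, M i j l = N l (i, j)
  mul : ∀ i j, χ i * χ j = (M i j).sum fun l n => n • χ l
  deg_N : ∀ l p, N l p ≠ 0 → deg p.1 + deg p.2 = deg l
  plus : Ω → Ω → Ω
  comul : ∀ l x y, χ l (plus x y) = (N l).sum fun p n => n • (χ p.1 x * χ p.2 y)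
  assoc : ∀ l x y z, χ l (plus (plus x y) z) = χ l (plus x (plus y z))
  zero : Ω
  χ_zero : ∀ i, i ≠ unit → χ i zero = 0
  zero_plus : ∀ i x, χ i (plus zero x) = χ i x
  plus_zero : ∀ i x, χ i (plus x zero) = χ i x

namespace CharData

variable {k : Type u} [Field k] {I : Type v} {Ω : Type w} (D : CharData k I Ω)

/-- The ring of functions spanned by the basis functions. -/
def subring : Subring (Ω → k) where
  __ := (Submodule.span ℤ (Set.range D.χ)).toAddSubgroup
  one_mem' := Submodule.subset_span ⟨D.unit, D.χ_unit⟩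
  mul_mem' {a b} ha hb := by
    change a * b ∈ Submodule.span ℤ (Set.range D.χ)
    refine Submodule.span_induction₂ (p := fun a b _ _ => a * b ∈ Submodule.span ℤ (Set.range D.χ))
      ?_ ?_ ?_ ?_ ?_ ?_ ?_ ha hb
    · rintro _ _ ⟨i, rfl⟩ ⟨j, rfl⟩
      rw [D.mul]
      exact Submodule.sum_mem _ fun l _ => Submodule.smul_of_tower_mem _ _
        (Submodule.subset_span ⟨l, rfl⟩)
    · intro y _
      rw [zero_mul]
      exact Submodule.zero_mem _
    · intro x _
      rw [mul_zero]
      exact Submodule.zero_mem _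
    · intro x y z _ _ _ h h'
      rw [add_mul]
      exact Submodule.add_mem _ h h'
    · intro x y z _ _ _ h h'
      rw [mul_add]
      exact Submodule.add_mem _ h h'
    · intro r x y _ _ h
      rw [smul_mul_assoc]
      exact Submodule.smul_mem _ r h
    · intro r x y _ _ h
      rw [mul_smul_comm]
      exact Submodule.smul_mem _ r h

/-- The ring of functions spanned by the basis functions, as a type. -/
def Alg : Type (max u w) := D.subring

instance : CommRing D.Alg := inferInstanceAs (CommRing D.subring)

/-- The values of the functions in the ring. -/
def ev (x : Ω) : D.Alg →ₐ[ℤ] k :=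
  ((Pi.evalRingHom (fun _ => k) x).comp D.subring.subtype).toIntAlgHom

lemma ev_injective {a b : D.Alg} (h : ∀ x, D.ev x a = D.ev x b) : a = b :=
  Subtype.ext (funext h)

/-- The basis functions as elements of the ring. -/
def elt (i : I) : D.Alg := ⟨D.χ i, Submodule.subset_span ⟨i, rfl⟩⟩

lemma ev_elt (i : I) (x : Ω) : D.ev x (D.elt i) = D.χ i x := rfl

variable [CharZero k]

/-- The distinguished basis of the ring. -/
def basis : Module.Basis I ℤ D.Alg :=
  have h : LinearIndependent ℤ D.χ := D.indep.restrict_scalars fun a b h => by simpa using h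
  let evL : D.Alg →ₗ[ℤ] (Ω → k) := D.subring.subtype.toAddMonoidHom.toIntLinearMap
  Module.Basis.mk (v := D.elt) (LinearIndependent.of_comp evL h) <| by
    rintro ⟨x, hx⟩ -
    have h : x ∈ Submodule.map evL (Submodule.span ℤ (Set.range D.elt)) := by
      rw [Submodule.map_span, ← Set.range_comp]
      exact hx
    obtain ⟨y, hy, hyx⟩ := h
    have : y = ⟨x, hx⟩ := Subtype.val_injective hyx
    rwa [← this]

lemma basis_apply (i : I) : D.basis i = D.elt i := by simp [basis]

lemma ev_basis (i : I) (x : Ω) : D.ev x (D.basis i) = D.χ i x := by rw [basis_apply, ev_elt]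

lemma basis_unit : D.basis D.unit = 1 :=
  D.ev_injective fun x => by rw [ev_basis, D.χ_unit, map_one, Pi.one_apply]

lemma basis_mul (i j : I) : D.basis i * D.basis j = (D.M i j).sum fun l n => n • D.basis l := by
  refine D.ev_injective fun x => ?_
  rw [map_mul, ev_basis, ev_basis, ← Pi.mul_apply, D.mul, Finsupp.sum, Finsupp.sum, map_sum,
    Finset.sum_apply]
  exact Finset.sum_congr rfl fun l _ => by rw [map_nsmul, ev_basis, Pi.smul_apply]

lemma repr_basis_mul (i j l : I) : D.basis.repr (D.basis i * D.basis j) l = D.M i j l := by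
  classical
  rw [basis_mul, Finsupp.sum, map_sum, Finsupp.finsetSum_apply]
  simp only [map_nsmul, Module.Basis.repr_self, Finsupp.smul_apply, Finsupp.single_apply]
  simp [eq_comm]

/-- Cocommutativity is commutativity of the product, read through the shared structure constants. -/
lemma N_swap (l i j : I) : D.N l (i, j) = D.N l (j, i) := by
  have h := D.repr_basis_mul i j l
  rw [mul_comm, repr_basis_mul, D.M_apply, D.M_apply] at h
  exact_mod_cast h.symm

open Classical in
lemma N_unit (l i : I) : D.N l (i, D.unit) = if i = l then 1 else 0 := by
  have h := D.repr_basis_mul i D.unit l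
  rw [basis_unit, mul_one, Module.Basis.repr_self, Finsupp.single_apply, D.M_apply] at h
  split_ifs at h ⊢ <;> exact_mod_cast h.symm

/-! #### The coalgebra structure -/

lemma addHom_ext {M : Type*} [AddCommGroup M] {f g : D.Alg →+ M}
    (h : ∀ i, f (D.basis i) = g (D.basis i)) (x : D.Alg) : f x = g x :=
  LinearMap.congr_fun (D.basis.ext (f₁ := f.toIntLinearMap) (f₂ := g.toIntLinearMap) h) x

open Classical in
instance : CoalgebraStruct ℤ D.Alg where
  comul := D.basis.constr ℤ fun l => (D.N l).sum fun p n => n • (D.basis p.1 ⊗ₜ[ℤ] D.basis p.2)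
  counit := D.basis.constr ℤ fun i => if i = D.unit then 1 else 0

lemma comul_basis (l : I) : Coalgebra.comul (R := ℤ) (D.basis l) =
    (D.N l).sum fun p n => n • (D.basis p.1 ⊗ₜ[ℤ] D.basis p.2) :=
  Module.Basis.constr_basis _ _ _ _

open Classical in
lemma counit_basis (i : I) :
    Coalgebra.counit (R := ℤ) (D.basis i) = if i = D.unit then 1 else 0 :=
  Module.Basis.constr_basis _ _ _ _

lemma algebraMap_counit (a : D.Alg) :
    algebraMap ℤ k (Coalgebra.counit (R := ℤ) a) = D.ev D.zero a := by
  classical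
  refine D.addHom_ext (f := (algebraMap ℤ k).toAddMonoidHom.comp
      (Coalgebra.counit (R := ℤ) (A := D.Alg)).toAddMonoidHom)
    (g := (D.ev D.zero).toRingHom.toAddMonoidHom) (fun i => ?_) a
  change algebraMap ℤ k (Coalgebra.counit (R := ℤ) (D.basis i) : ℤ) = D.ev D.zero (D.basis i)
  rw [counit_basis, ev_basis]
  split_ifs with h
  · simp [h, D.χ_unit]
  · simp [D.χ_zero i h]

lemma evalTensor_comul (a : D.Alg) (x y : Ω) :
    evalTensor D.ev D.ev (x, y) (Coalgebra.comul (R := ℤ) a) = D.ev (D.plus x y) a := by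
  refine D.addHom_ext (f := (evalTensor D.ev D.ev (x, y)).toRingHom.toAddMonoidHom.comp
      (Coalgebra.comul (R := ℤ) (A := D.Alg)).toAddMonoidHom)
    (g := (D.ev (D.plus x y)).toRingHom.toAddMonoidHom) (fun l => ?_) a
  change evalTensor D.ev D.ev (x, y) (Coalgebra.comul (R := ℤ) (D.basis l)) =
    D.ev (D.plus x y) (D.basis l)
  rw [comul_basis, ev_basis, D.comul, Finsupp.sum, Finsupp.sum, map_sum]
  refine Finset.sum_congr rfl fun p _ => ?_
  rw [map_nsmul, evalTensor_tmul, ev_basis, ev_basis]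

lemma linearIndependent_ev : LinearIndependent k fun i x => D.ev x (D.basis i) := by
  simpa only [ev_basis] using D.indep

lemma ev_congr {x y : Ω} (h : ∀ i, D.χ i x = D.χ i y) (a : D.Alg) : D.ev x a = D.ev y a :=
  D.addHom_ext (f := (D.ev x).toRingHom.toAddMonoidHom) (g := (D.ev y).toRingHom.toAddMonoidHom)
    (fun l => by
      change D.ev x (D.basis l) = D.ev y (D.basis l)
      rw [ev_basis, ev_basis, h]) a

omit D in
lemma injective_algebraMap_int : Function.Injective (algebraMap ℤ k) := fun a b h => by
  simpa using h

instance : Coalgebra ℤ D.Alg :=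
  coalgebraOfEval injective_algebraMap_int D.linearIndependent_ev D.evalTensor_comul
    D.algebraMap_counit (fun a x y z => D.ev_congr (fun i => D.assoc i x y z) a)
    (fun a x => D.ev_congr (fun i => D.zero_plus i x) a)
    (fun a x => D.ev_congr (fun i => D.plus_zero i x) a)

end CharData

namespace CharData

variable {k : Type u} [Field k] [CharZero k] {I : Type v} {Ω : Type w} (D : CharData k I Ω)

/-! #### The antipode -/

open Classical in
/-- The values of the antipode on the basis. -/
def antipodeAux (l : I) : D.Alg :=
  -- The recursion solves S * id = ηε for its top term. The value 0 where the degree does not drop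
  -- discards only the term (l, 1), which is the one solved for, and makes the recursion terminate.
  if l = D.unit then 1 else
    -∑ p ∈ (D.N l).support.attach, if _h : D.deg p.1.1 < D.deg l then
      D.N l p.1 • (antipodeAux p.1.1 * D.basis p.1.2) else 0
termination_by D.deg l
decreasing_by assumption

/-- The antipode. -/
def antipode : D.Alg →ₗ[ℤ] D.Alg := D.basis.constr ℤ D.antipodeAux

lemma antipode_basis (l : I) : D.antipode (D.basis l) = D.antipodeAux l :=
  Module.Basis.constr_basis _ _ _ _

omit [CharZero k] in
lemma deg_unit : D.deg D.unit = 0 := (D.deg_eq_zero _).2 rfl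

omit [CharZero k] in
lemma N_unit_unit (p : I × I) (hp : D.N D.unit p ≠ 0) : p = (D.unit, D.unit) := by
  have h := D.deg_N _ _ hp
  rw [deg_unit] at h
  exact Prod.ext ((D.deg_eq_zero _).1 (by omega)) ((D.deg_eq_zero _).1 (by omega))

lemma sum_antipode_mul (l : I) :
    (D.N l).sum (fun p n => n • (D.antipode (D.basis p.1) * D.basis p.2)) =
      algebraMap ℤ D.Alg (Coalgebra.counit (R := ℤ) (D.basis l)) := by
  classical
  rw [counit_basis]
  by_cases hl : l = D.unit
  · subst hl
    rw [Finsupp.sum_of_support_subset (s := {(D.unit, D.unit)}) _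
      (fun p hp => Finset.mem_singleton.2 (D.N_unit_unit p (Finsupp.mem_support_iff.1 hp)))
      (fun p n => n • (D.antipode (D.basis p.1) * D.basis p.2))
      (fun _ _ => zero_smul _ _), Finset.sum_singleton, antipode_basis, antipodeAux, if_pos rfl,
      N_unit, if_pos rfl, basis_unit, if_pos rfl]
    simp
  · rw [if_neg hl, map_zero]
    have hmem : (l, D.unit) ∈ (D.N l).support := by
      rw [Finsupp.mem_support_iff, N_unit, if_pos rfl]
      exact one_ne_zero
    rw [Finsupp.sum, ← Finset.add_sum_erase _ _ hmem, N_unit, if_pos rfl, one_smul, basis_unit,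
      mul_one, antipode_basis, antipodeAux, if_neg hl, neg_add_eq_zero]
    rw [Finset.sum_attach (D.N l).support (fun p => if h : D.deg p.1 < D.deg l then
      D.N l p • (D.antipodeAux p.1 * D.basis p.2) else 0), ← Finset.add_sum_erase _ _ hmem,
      dif_neg (lt_irrefl _), zero_add]
    refine Finset.sum_congr rfl fun p hp => ?_
    obtain ⟨hp1, hp2⟩ := Finset.mem_erase.1 hp
    have hN := Finsupp.mem_support_iff.1 hp2
    have hdeg := D.deg_N _ _ hN
    rw [dif_pos, antipode_basis]
    -- If the left degree does not drop, the right factor has degree 0 and is the unit; such a term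
    -- has nonzero coefficient only if it is (l, 1), which was removed.
    by_contra hlt
    have h2 : p.2 = D.unit := (D.deg_eq_zero _).1 (by omega)
    obtain ⟨i, j⟩ := p
    obtain rfl : j = D.unit := h2
    rw [N_unit] at hN
    refine hp1 (Prod.ext ?_ rfl)
    by_contra hne
    exact hN (if_neg hne)

lemma mul_antipode_left (x : D.Alg) :
    LinearMap.mul' ℤ D.Alg (D.antipode.rTensor D.Alg (Coalgebra.comul (R := ℤ) x)) =
      algebraMap ℤ D.Alg (Coalgebra.counit (R := ℤ) x) := by
  refine D.addHom_ext (f := ((LinearMap.mul' ℤ D.Alg).comp ((D.antipode.rTensor D.Alg).comp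
      (Coalgebra.comul (R := ℤ)))).toAddMonoidHom)
    (g := (algebraMap ℤ D.Alg).toAddMonoidHom.comp
      (Coalgebra.counit (R := ℤ) (A := D.Alg)).toAddMonoidHom) (fun l => ?_) x
  change LinearMap.mul' ℤ D.Alg (D.antipode.rTensor D.Alg (Coalgebra.comul (R := ℤ) (D.basis l))) =
    algebraMap ℤ D.Alg (Coalgebra.counit (R := ℤ) (D.basis l))
  rw [← sum_antipode_mul, comul_basis, Finsupp.sum, map_sum, map_sum, Finsupp.sum]
  refine Finset.sum_congr rfl fun p _ => ?_
  rw [map_nsmul, map_nsmul, LinearMap.rTensor_tmul, LinearMap.mul'_apply]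

/-- By commutativity and cocommutativity this is the left identity with the two factors exchanged.
-/
lemma mul_antipode_right (x : D.Alg) :
    LinearMap.mul' ℤ D.Alg (D.antipode.lTensor D.Alg (Coalgebra.comul (R := ℤ) x)) =
      algebraMap ℤ D.Alg (Coalgebra.counit (R := ℤ) x) := by
  refine D.addHom_ext (f := ((LinearMap.mul' ℤ D.Alg).comp ((D.antipode.lTensor D.Alg).comp
      (Coalgebra.comul (R := ℤ)))).toAddMonoidHom)
    (g := (algebraMap ℤ D.Alg).toAddMonoidHom.comp
      (Coalgebra.counit (R := ℤ) (A := D.Alg)).toAddMonoidHom) (fun l => ?_) x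
  change LinearMap.mul' ℤ D.Alg (D.antipode.lTensor D.Alg (Coalgebra.comul (R := ℤ) (D.basis l))) =
    algebraMap ℤ D.Alg (Coalgebra.counit (R := ℤ) (D.basis l))
  rw [← sum_antipode_mul, comul_basis, Finsupp.sum, map_sum, map_sum, Finsupp.sum]
  refine Finset.sum_equiv (Equiv.prodComm I I) (fun p => ?_) fun p _ => ?_
  · rw [Finsupp.mem_support_iff, Finsupp.mem_support_iff, Equiv.prodComm_apply, Prod.swap,
      D.N_swap l p.1 p.2]
  · rw [map_nsmul, map_nsmul, LinearMap.lTensor_tmul, LinearMap.mul'_apply, mul_comm,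
      Equiv.prodComm_apply, Prod.swap, ← D.N_swap l p.1 p.2]

/-! #### The grading -/

/-- The homogeneous components. -/
def grade (n : ℕ) : Submodule ℤ D.Alg := Submodule.span ℤ (D.basis '' {i | D.deg i = n})

lemma basis_mem_grade (i : I) : D.basis i ∈ D.grade (D.deg i) :=
  Submodule.subset_span ⟨i, rfl, rfl⟩

lemma basis_mem_grade_iff {i : I} {n : ℕ} : D.basis i ∈ D.grade n ↔ D.deg i = n := by
  refine ⟨fun h => ?_, fun h => h ▸ D.basis_mem_grade i⟩
  exact (D.basis.mem_span_image.1 h) (by rw [Module.Basis.repr_self]; simp)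

lemma isInternal_grade : DirectSum.IsInternal D.grade := by
  rw [DirectSum.isInternal_submodule_iff_iSupIndep_and_iSup_eq_top]
  constructor
  · intro n
    rw [show (⨆ (m : ℕ) (_ : m ≠ n), D.grade m) =
      Submodule.span ℤ (D.basis '' ⋃ (m : ℕ) (_ : m ≠ n), {i | D.deg i = m}) by
        simp only [grade, Set.image_iUnion, Submodule.span_iUnion]]
    refine D.basis.linearIndependent.disjoint_span_image ?_
    rw [Set.disjoint_left]
    intro i hi h
    simp only [Set.mem_iUnion] at h
    obtain ⟨m, hm, him⟩ := h
    exact hm (him.symm.trans hi)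
  · rw [eq_top_iff, ← D.basis.span_eq, Submodule.span_le]
    rintro _ ⟨i, rfl⟩
    exact Submodule.mem_iSup_of_mem (D.deg i) (D.basis_mem_grade i)

lemma mul_mem_grade {m n : ℕ} {x y : D.Alg} (hx : x ∈ D.grade m) (hy : y ∈ D.grade n) :
    x * y ∈ D.grade (m + n) := by
  induction hx, hy using Submodule.span_induction₂ with
  | mem_mem x y hx hy =>
    obtain ⟨i, rfl, rfl⟩ := hx
    obtain ⟨j, rfl, rfl⟩ := hy
    rw [basis_mul]
    refine Submodule.sum_mem _ fun l hl => nsmul_mem ?_ _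
    rw [Finsupp.mem_support_iff, D.M_apply] at hl
    rw [basis_mem_grade_iff, ← D.deg_N _ _ hl]
  | zero_left y hy => rw [zero_mul]; exact Submodule.zero_mem _
  | zero_right x hx => rw [mul_zero]; exact Submodule.zero_mem _
  | add_left x y z _ _ _ h h' => rw [add_mul]; exact Submodule.add_mem _ h h'
  | add_right x y z _ _ _ h h' => rw [mul_add]; exact Submodule.add_mem _ h h'
  | smul_left r x y _ _ h => rw [smul_mul_assoc]; exact Submodule.smul_mem _ _ h
  | smul_right r x y _ _ h => rw [mul_smul_comm]; exact Submodule.smul_mem _ _ h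

lemma comul_mem_grade {n : ℕ} {x : D.Alg} (hx : x ∈ D.grade n) :
    Coalgebra.comul (R := ℤ) x ∈ ⨆ (p : ℕ × ℕ) (_ : p.1 + p.2 = n),
      LinearMap.range (TensorProduct.map (D.grade p.1).subtype (D.grade p.2).subtype) := by
  induction hx using Submodule.span_induction with
  | mem x hx =>
    obtain ⟨l, rfl, rfl⟩ := hx
    rw [comul_basis]
    refine Submodule.sum_mem _ fun p hp => nsmul_mem ?_ _
    refine Submodule.mem_iSup_of_mem (D.deg p.1, D.deg p.2) (Submodule.mem_iSup_of_mem
      (D.deg_N _ _ (Finsupp.mem_support_iff.1 hp)) ⟨⟨_, D.basis_mem_grade p.1⟩ ⊗ₜ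
        ⟨_, D.basis_mem_grade p.2⟩, TensorProduct.map_tmul _ _ _ _⟩)
  | zero => rw [map_zero]; exact Submodule.zero_mem _
  | add x y _ _ h h' => rw [map_add]; exact Submodule.add_mem _ h h'
  | smul r x _ h => rw [map_smul]; exact Submodule.smul_mem _ _ h

lemma counit_grade {n : ℕ} {x : D.Alg} (hn : n ≠ 0) (hx : x ∈ D.grade n) :
    Coalgebra.counit (R := ℤ) x = 0 := by
  classical
  induction hx using Submodule.span_induction with
  | mem x hx =>
    obtain ⟨l, rfl, rfl⟩ := hx
    rw [counit_basis, if_neg]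
    rintro rfl
    exact hn D.deg_unit
  | zero => rw [map_zero]
  | add x y _ _ h h' => rw [map_add, h, h', add_zero]
  | smul r x _ h => rw [map_smul, h, smul_zero]

lemma algebraMap_counit_of_mem {x : D.Alg} (hx : x ∈ D.grade 0) :
    algebraMap ℤ D.Alg (Coalgebra.counit (R := ℤ) x) = x := by
  classical
  induction hx using Submodule.span_induction with
  | mem x hx =>
    obtain ⟨l, hl, rfl⟩ := hx
    obtain rfl := (D.deg_eq_zero l).1 hl
    rw [counit_basis, if_pos rfl, map_one, basis_unit]
  | zero => rw [map_zero, map_zero]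
  | add x y _ _ h h' => rw [map_add, map_add, h, h']
  | smul r x _ h => rw [map_smul, smul_eq_mul, map_mul, h, Algebra.smul_def]

/-! #### The inner product -/

/-- The inner product. -/
def inner : LinearMap.BilinForm ℤ D.Alg := D.basis.constr ℤ fun i => D.basis.coord i

lemma inner_basis_left (i : I) (x : D.Alg) : D.inner (D.basis i) x = D.basis.repr x i := by
  rw [inner, Module.Basis.constr_basis, Module.Basis.coord_apply]

open Classical in
lemma inner_basis (i j : I) : D.inner (D.basis i) (D.basis j) = if i = j then 1 else 0 := by
  rw [inner_basis_left, Module.Basis.repr_self, Finsupp.single_apply]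
  simp only [eq_comm]

lemma inner_basis_right (x : D.Alg) (i : I) : D.inner x (D.basis i) = D.basis.repr x i := by
  classical
  refine D.addHom_ext (f := (D.inner.flip (D.basis i)).toAddMonoidHom)
    (g := (D.basis.coord i).toAddMonoidHom) (fun j => ?_) x
  change D.inner (D.basis j) (D.basis i) = D.basis.repr (D.basis j) i
  rw [inner_basis, Module.Basis.repr_self, Finsupp.single_apply]

/-- Both sides are the common structure constant of the product and the coproduct. -/
lemma inner_mul_basis (i j l : I) : D.inner (D.basis i * D.basis j) (D.basis l) =
    (D.inner.tmul D.inner) (D.basis i ⊗ₜ[ℤ] D.basis j) (Coalgebra.comul (R := ℤ) (D.basis l)) := by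
  classical
  rw [inner_basis_right, repr_basis_mul, comul_basis, Finsupp.sum, map_sum]
  rw [Finset.sum_eq_single (i, j)]
  · rw [map_nsmul, LinearMap.BilinForm.tmul, LinearMap.BilinForm.tensorDistrib_tmul, inner_basis,
      inner_basis, if_pos rfl, if_pos rfl, D.M_apply]
    simp
  · intro p _ hp
    rw [map_nsmul, LinearMap.BilinForm.tmul, LinearMap.BilinForm.tensorDistrib_tmul, inner_basis,
      inner_basis]
    by_cases h : i = p.1
    · rw [if_neg (c := j = p.2) (fun h' => hp (Prod.ext h.symm h'.symm))]
      simp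
    · rw [if_neg h]
      simp
  · intro h
    rw [Finsupp.notMem_support_iff.1 h, zero_smul, map_zero]

lemma inner_mul (x y z : D.Alg) : D.inner (x * y) z =
    (D.inner.tmul D.inner) (x ⊗ₜ[ℤ] y) (Coalgebra.comul (R := ℤ) z) := by
  refine D.addHom_ext (f := (D.inner (x * y)).toAddMonoidHom)
    (g := ((D.inner.tmul D.inner (x ⊗ₜ[ℤ] y)).comp
      (Coalgebra.comul (R := ℤ))).toAddMonoidHom) (fun l => ?_) z
  refine D.addHom_ext (f := ((D.inner.flip (D.basis l)).comp
      ((LinearMap.mul ℤ D.Alg).flip y)).toAddMonoidHom)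
    (g := (((D.inner.tmul D.inner).flip (Coalgebra.comul (R := ℤ) (D.basis l))).comp
      ((TensorProduct.mk ℤ D.Alg D.Alg).flip y)).toAddMonoidHom) (fun i => ?_) x
  refine D.addHom_ext (f := ((D.inner.flip (D.basis l)).comp
      (LinearMap.mul ℤ D.Alg (D.basis i))).toAddMonoidHom)
    (g := (((D.inner.tmul D.inner).flip (Coalgebra.comul (R := ℤ) (D.basis l))).comp
      (TensorProduct.mk ℤ D.Alg D.Alg (D.basis i))).toAddMonoidHom) (fun j => ?_) y
  exact D.inner_mul_basis i j l

/-- The PSH algebra of functions. -/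
def pshAlgebra : PSHAlgebra.{max u w} where
  carrier := D.Alg
  counit_one := by
    -- Inside `k` the counit is evaluation at `zero`, which is multiplicative.
    refine injective_algebraMap_int (k := k) ?_
    rw [algebraMap_counit, map_one, map_one]
  counit_mul x y := by
    refine injective_algebraMap_int (k := k) ?_
    rw [algebraMap_counit, map_mul, map_mul, algebraMap_counit, algebraMap_counit]
  comul_one := comul_one_of_eval injective_algebraMap_int D.linearIndependent_ev D.evalTensor_comul
  comul_mul x y := comul_mul_of_eval injective_algebraMap_int D.linearIndependent_ev
    D.evalTensor_comul x y
  antipode := D.antipode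
  mul_antipode_left := D.mul_antipode_left
  mul_antipode_right := D.mul_antipode_right
  grade := D.grade
  isInternal := D.isInternal_grade
  one_mem := by
    rw [← basis_unit, basis_mem_grade_iff, deg_unit]
  mul_mem := D.mul_mem_grade
  comul_mem := D.comul_mem_grade
  counit_grade := D.counit_grade
  connected := D.algebraMap_counit_of_mem
  inner := D.inner
  basis := Set.range D.basis
  basis_homogeneous := by
    rintro _ ⟨i, rfl⟩
    exact ⟨_, D.basis_mem_grade i⟩
  basis_finite n := by
    refine ((D.finite_deg n).image D.basis).subset ?_
    rintro _ ⟨⟨i, rfl⟩, hi⟩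
    exact ⟨i, D.basis_mem_grade_iff.1 hi, rfl⟩
  basis_span n := by
    rw [grade]
    congr 1
    ext x
    constructor
    · rintro ⟨⟨i, rfl⟩, hi⟩
      exact ⟨i, D.basis_mem_grade_iff.1 hi, rfl⟩
    · rintro ⟨i, hi, rfl⟩
      exact ⟨⟨i, rfl⟩, D.basis_mem_grade_iff.2 hi⟩
  inner_self := by
    classical
    rintro _ ⟨i, rfl⟩
    rw [inner_basis, if_pos rfl]
  inner_ne := by
    classical
    rintro _ ⟨i, rfl⟩ _ ⟨j, rfl⟩ h
    rw [inner_basis, if_neg (fun hij : i = j => h (congrArg D.basis hij))]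
  selfAdjoint := D.inner_mul
  mul_pos := by
    rintro _ ⟨i, rfl⟩ _ ⟨j, rfl⟩
    rw [basis_mul]
    exact sum_mem fun l _ => nsmul_mem (AddSubmonoid.subset_closure (Set.mem_range_self l)) _
  comul_pos := by
    rintro _ ⟨l, rfl⟩
    rw [comul_basis]
    refine sum_mem fun p _ => nsmul_mem (AddSubmonoid.subset_closure ?_) _
    exact ⟨_, ⟨p.1, rfl⟩, _, ⟨p.2, rfl⟩, rfl⟩

end CharData

/-- The identity map of a PSH algebra. -/
def PSHHom.id (A : PSHAlgebra.{v}) : PSHHom A A where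
  toBialgHom := BialgHom.id ℤ A
  map_grade _ _ h := h
  map_inner _ _ := rfl
  map_positive _ h := h

lemma PSHHom.isIsomorphism_id (A : PSHAlgebra.{v}) : (PSHHom.id A).IsIsomorphism :=
  ⟨PSHHom.id A, fun _ => rfl, fun _ => rfl⟩

/-! ### Induction products -/

section Induction

/-- The linear map on an induced representation determined by an equivariant map. -/
def indLift {k G H A B : Type*} [CommRing k] [Group G] [Group H] [AddCommGroup A] [Module k A]
    [AddCommGroup B] [Module k B] (φ : G →* H) (ρ : Representation k G A)
    (τ : Representation k H B) (f : A →ₗ[k] B) (hf : ∀ g x, f (ρ g x) = τ (φ g) (f x)) :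
    Representation.IndV φ ρ →ₗ[k] B :=
  Representation.Coinvariants.lift _
    (TensorProduct.lift <| (Finsupp.lift _ _ _ fun h => τ h⁻¹ ∘ₗ f) ∘ₗ
      (MonoidAlgebra.coeffLinearEquiv k).toLinearMap) fun g ↦ by
        ext h x
        simp only [LinearMap.coe_comp, Function.comp_apply, MonoidAlgebra.lsingle_apply]
        simp [Representation.ofMulAction_single, mul_inv_rev, hf]

lemma indLift_mk {k G H A B : Type*} [CommRing k] [Group G] [Group H] [AddCommGroup A] [Module k A]
    [AddCommGroup B] [Module k B] (φ : G →* H) (ρ : Representation k G A)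
    (τ : Representation k H B) (f : A →ₗ[k] B) (hf : ∀ g x, f (ρ g x) = τ (φ g) (f x)) (h : H)
    (x : A) : indLift φ ρ τ f hf (Representation.IndV.mk φ ρ h x) = τ h⁻¹ (f x) := by
  simp [indLift]

variable {k : Type u} [Field k] {H₁ H₂ K : Type u} [Group H₁] [Group H₂] [Group K] [Finite K]
  (φ : H₁ × H₂ →* K)

/-- The representation induced from an external tensor product. -/
def indTensor (ρ : FDRep k H₁) (σ : FDRep k H₂) : FDRep k K :=
  FDRep.of (Representation.ind φ (extTensor ρ σ))

variable {φ} {ρ : FDRep k H₁} {σ : FDRep k H₂} {A : FDRep k H₁} {B : FDRep k H₂} {C : FDRep k K}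

/-- The restriction of a map from an induced representation. -/
def indRestrict : (indTensor φ ρ σ ⟶ C) →ₗ[k] (ρ ⊗[k] σ →ₗ[k] C) where
  toFun F := (lin F : Representation.IndV φ (extTensor ρ σ) →ₗ[k] C) ∘ₗ
    Representation.IndV.mk φ (extTensor ρ σ) 1
  map_add' _ _ := rfl
  map_smul' _ _ := rfl

/-- The translates of the classes at 1 exhaust the induced representation; with the coinvariants
convention the class at `h` is the translate by `h⁻¹`. -/
lemma lin_indTensor_mk (F : indTensor φ ρ σ ⟶ C) (h : K) (x : ρ ⊗[k] σ) :
    (lin F : Representation.IndV φ (extTensor ρ σ) →ₗ[k] C)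
      (Representation.IndV.mk φ (extTensor ρ σ) h x) = C.ρ h⁻¹ (indRestrict F x) := by
  have h1 := lin_equivariant F h⁻¹
    (Representation.IndV.mk φ (extTensor ρ σ) 1 x : Representation.IndV φ (extTensor ρ σ))
  refine Eq.trans ?_ h1
  congr 1
  refine Eq.trans ?_ (Representation.ind_mk φ (extTensor ρ σ) h⁻¹ 1 x).symm
  rw [inv_inv, one_mul]

lemma indRestrict_injective : Function.Injective (indRestrict (φ := φ) (ρ := ρ) (σ := σ) (C := C)) :=
  fun F F' h => lin_injective <| by
    refine Representation.IndV.hom_ext φ (extTensor ρ σ) fun g => LinearMap.ext fun x => ?_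
    refine (lin_indTensor_mk F g x).trans (Eq.trans ?_ (lin_indTensor_mk F' g x).symm)
    rw [h]

lemma indRestrict_equivariant (F : indTensor φ ρ σ ⟶ C) (g : H₁ × H₂) (x : ρ ⊗[k] σ) :
    indRestrict F (extTensor ρ σ g x) = C.ρ (φ g) (indRestrict F x) := by
  have h1 := lin_equivariant F (φ g)
    (Representation.IndV.mk φ (extTensor ρ σ) 1 x : Representation.IndV φ (extTensor ρ σ))
  refine Eq.trans ?_ h1
  refine congrArg (lin F : Representation.IndV φ (extTensor ρ σ) →ₗ[k] C) ?_
  refine Eq.trans ?_ (Representation.ind_mk φ (extTensor ρ σ) (φ g) 1 x).symm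
  have h2 := Representation.Coinvariants.mk_self_apply (Representation.tprod
    ((Representation.leftRegular k K).comp φ) (extTensor ρ σ)) g
    (MonoidAlgebra.single (φ g)⁻¹ 1 ⊗ₜ x)
  rw [one_mul]
  refine Eq.trans ?_ h2
  simp [Representation.ofMulAction_single]
  rfl

/-- The map from an induced representation determined by an equivariant map. -/
def indHom (f : ρ ⊗[k] σ →ₗ[k] C) (hf : ∀ g x, f (extTensor ρ σ g x) = C.ρ (φ g) (f x)) :
    indTensor φ ρ σ ⟶ C :=
  mkHom (indLift φ (extTensor ρ σ) C.ρ f hf) fun g x => by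
    refine LinearMap.congr_fun (f := (indLift φ (extTensor ρ σ) C.ρ f hf) ∘ₗ
      (Representation.ind φ (extTensor ρ σ) g)) (g := C.ρ g ∘ₗ indLift φ (extTensor ρ σ) C.ρ f hf)
      (Representation.IndV.hom_ext φ (extTensor ρ σ) fun h => LinearMap.ext fun x => ?_) x
    change indLift φ (extTensor ρ σ) C.ρ f hf (Representation.ind φ (extTensor ρ σ) g
      (Representation.IndV.mk φ (extTensor ρ σ) h x)) =
      C.ρ g (indLift φ (extTensor ρ σ) C.ρ f hf (Representation.IndV.mk φ (extTensor ρ σ) h x))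
    rw [Representation.ind_mk, indLift_mk, indLift_mk, ← Module.End.mul_apply, ← map_mul,
      mul_inv_rev, inv_inv]

lemma indRestrict_indHom (f : ρ ⊗[k] σ →ₗ[k] C)
    (hf : ∀ g x, f (extTensor ρ σ g x) = C.ρ (φ g) (f x)) : indRestrict (indHom f hf) = f := by
  refine LinearMap.ext fun x => (indLift_mk φ (extTensor ρ σ) C.ρ f hf 1 x).trans ?_
  simp

lemma map_lin_equivariant (a : ρ ⟶ A) (b : σ ⟶ B) (g : H₁ × H₂) (x : ρ ⊗[k] σ) :
    TensorProduct.map (lin a) (lin b) (extTensor ρ σ g x) =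
      extTensor A B g (TensorProduct.map (lin a) (lin b) x) := by
  induction x using TensorProduct.induction_on with
  | zero => simp only [map_zero]
  | tmul x y =>
    refine (TensorProduct.map_tmul _ _ _ _).trans ?_
    exact congrArg₂ _ (lin_equivariant a g.1 x) (lin_equivariant b g.2 y)
  | add x y hx hy => simp only [map_add, hx, hy]

/-- The map from an induced representation determined by a pair of maps. -/
def indMk (m : A ⊗[k] B ≃ₗ[k] C) (hm : ∀ g t, m (extTensor A B g t) = C.ρ (φ g) (m t))
    (a : ρ ⟶ A) (b : σ ⟶ B) : indTensor φ ρ σ ⟶ C :=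
  indHom (m.toLinearMap ∘ₗ TensorProduct.map (lin a) (lin b)) fun g x =>
    (congrArg m (map_lin_equivariant a b g x)).trans (hm g _)

lemma indRestrict_indMk (m : A ⊗[k] B ≃ₗ[k] C)
    (hm : ∀ g t, m (extTensor A B g t) = C.ρ (φ g) (m t)) (a : ρ ⟶ A) (b : σ ⟶ B) :
    indRestrict (indMk m hm a b) = m.toLinearMap ∘ₗ TensorProduct.map (lin a) (lin b) :=
  indRestrict_indHom _ _

/-- The map `Hom(ρ, A) ⊗ Hom(σ, B) → Hom(Ind(ρ ⊠ σ), C)`. -/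
def indPair (m : A ⊗[k] B ≃ₗ[k] C) (hm : ∀ g t, m (extTensor A B g t) = C.ρ (φ g) (m t)) :
    (ρ ⟶ A) ⊗[k] (σ ⟶ B) →ₗ[k] (indTensor φ ρ σ ⟶ C) :=
  TensorProduct.lift (LinearMap.mk₂ k (indMk m hm)
    (fun a a' b => indRestrict_injective (by
      rw [map_add, indRestrict_indMk, indRestrict_indMk, indRestrict_indMk, map_add,
        TensorProduct.map_add_left, LinearMap.comp_add]))
    (fun c a b => indRestrict_injective (by
      rw [map_smul, indRestrict_indMk, indRestrict_indMk, map_smul,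
        TensorProduct.map_smul_left, LinearMap.comp_smul]))
    (fun a b b' => indRestrict_injective (by
      rw [map_add, indRestrict_indMk, indRestrict_indMk, indRestrict_indMk, map_add,
        TensorProduct.map_add_right, LinearMap.comp_add]))
    (fun c a b => indRestrict_injective (by
      rw [map_smul, indRestrict_indMk, indRestrict_indMk, map_smul,
        TensorProduct.map_smul_right, LinearMap.comp_smul])))

lemma indRestrict_indPair_tmul (m : A ⊗[k] B ≃ₗ[k] C)
    (hm : ∀ g t, m (extTensor A B g t) = C.ρ (φ g) (m t)) (a : ρ ⟶ A) (b : σ ⟶ B) :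
    indRestrict (indPair m hm (a ⊗ₜ b)) = m.toLinearMap ∘ₗ TensorProduct.map (lin a) (lin b) :=
  indRestrict_indMk m hm a b

lemma indRestrict_indPair (m : A ⊗[k] B ≃ₗ[k] C)
    (hm : ∀ g t, m (extTensor A B g t) = C.ρ (φ g) (m t)) (t : (ρ ⟶ A) ⊗[k] (σ ⟶ B)) :
    indRestrict (indPair m hm t) = m.toLinearMap ∘ₗ homTensorHomEquiv k ρ σ A B
      (TensorProduct.map lin lin t) := by
  induction t using TensorProduct.induction_on with
  | zero => simp only [map_zero, LinearMap.comp_zero]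
  | tmul a b =>
    rw [indRestrict_indPair_tmul, TensorProduct.map_tmul, homTensorHomEquiv_apply]
    rfl
  | add s t hs ht => simp only [map_add, hs, ht, LinearMap.comp_add]

lemma indPair_injective (m : A ⊗[k] B ≃ₗ[k] C)
    (hm : ∀ g t, m (extTensor A B g t) = C.ρ (φ g) (m t)) :
    Function.Injective (indPair (ρ := ρ) (σ := σ) m hm) := by
  intro s t h
  have h' := congrArg indRestrict h
  rw [indRestrict_indPair, indRestrict_indPair] at h'
  refine TensorProduct.map_injective_of_flat_flat (lin : (ρ ⟶ A) →ₗ[k] _) (lin : (σ ⟶ B) →ₗ[k] _)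
    lin_injective lin_injective ((homTensorHomEquiv k ρ σ A B).injective (LinearMap.ext fun x => ?_))
  exact m.injective (LinearMap.congr_fun h' x)

/-- Summing over a product group factors into the two separate sums of conjugates. -/
lemma homTensorHomEquiv_sumConj [Fintype H₁] [Fintype H₂]
    (t : (ρ →ₗ[k] A) ⊗[k] (σ →ₗ[k] B)) :
    homTensorHomEquiv k ρ σ A B (TensorProduct.map (lin ∘ₗ sumConj ρ A) (lin ∘ₗ sumConj σ B) t) =
      ∑ g : H₁ × H₂, extTensor A B g ∘ₗ homTensorHomEquiv k ρ σ A B t ∘ₗ extTensor ρ σ g⁻¹ := by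
  induction t using TensorProduct.induction_on with
  | zero => simp only [map_zero, LinearMap.zero_comp, LinearMap.comp_zero, Finset.sum_const_zero]
  | tmul a b =>
    rw [TensorProduct.map_tmul, LinearMap.comp_apply, LinearMap.comp_apply, lin_sumConj,
      lin_sumConj, TensorProduct.sum_tmul, map_sum, Fintype.sum_prod_type]
    refine Finset.sum_congr rfl fun g _ => ?_
    rw [TensorProduct.tmul_sum, map_sum]
    refine Finset.sum_congr rfl fun h _ => ?_
    rw [homTensorHomEquiv_apply, homTensorHomEquiv_apply]
    exact TensorProduct.ext' fun x y => rfl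
  | add s t hs ht =>
    simp only [map_add, hs, ht, LinearMap.comp_add, LinearMap.add_comp, Finset.sum_add_distrib]

/-- The restriction of `F` is equivariant, so summing its conjugates multiplies it by the group
order. The same sum, computed factorwise, comes from Hom(ρ, A) ⊗ Hom(σ, B). -/
lemma indPair_surjective [CharZero k] [Finite H₁] [Finite H₂] (m : A ⊗[k] B ≃ₗ[k] C)
    (hm : ∀ g t, m (extTensor A B g t) = C.ρ (φ g) (m t)) :
    Function.Surjective (indPair (ρ := ρ) (σ := σ) m hm) := by
  have := Fintype.ofFinite H₁
  have := Fintype.ofFinite H₂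
  intro F
  let l : ρ ⊗[k] σ →ₗ[k] A ⊗[k] B := m.symm.toLinearMap ∘ₗ indRestrict F
  have hl : ∀ g, extTensor A B g ∘ₗ l ∘ₗ extTensor ρ σ g⁻¹ = l := by
    intro g
    refine LinearMap.ext fun x => m.injective ?_
    change m (extTensor A B g (m.symm (indRestrict F (extTensor ρ σ g⁻¹ x)))) =
      m (m.symm (indRestrict F x))
    rw [hm, LinearEquiv.apply_symm_apply, LinearEquiv.apply_symm_apply, ← indRestrict_equivariant,
      ← Module.End.mul_apply, ← map_mul, mul_inv_cancel, map_one, Module.End.one_apply]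
  let t := TensorProduct.map (sumConj ρ A) (sumConj σ B) ((homTensorHomEquiv k ρ σ A B).symm l)
  have ht : indRestrict (indPair m hm t) = (Fintype.card (H₁ × H₂) : k) • indRestrict F := by
    rw [indRestrict_indPair, ← LinearMap.comp_apply (TensorProduct.map lin lin),
      ← TensorProduct.map_comp, homTensorHomEquiv_sumConj, LinearEquiv.apply_symm_apply]
    simp only [hl, Finset.sum_const, Finset.card_univ]
    refine LinearMap.ext fun x => ?_
    simp only [l, LinearMap.comp_apply, LinearMap.smul_apply, Nat.cast_smul_eq_nsmul, map_nsmul,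
      LinearEquiv.coe_coe, LinearEquiv.apply_symm_apply]
  have hcard : (Fintype.card (H₁ × H₂) : k) ≠ 0 := Nat.cast_ne_zero.2 Fintype.card_ne_zero
  refine ⟨(Fintype.card (H₁ × H₂) : k)⁻¹ • t, indRestrict_injective ?_⟩
  rw [map_smul, map_smul, ht, smul_smul, inv_mul_cancel₀ hcard, one_smul]

end Induction

/-! ### Characters of induction products. -/

section CharInd

variable {k : Type u} [Field k] {G : Type u} [Group G]

lemma mulEquiv_tprod {m n : ℕ} (V : Type u) [AddCommGroup V] [Module k V] (v : Fin m → V)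
    (w : Fin n → V) : TensorPower.mulEquiv (R := k) (PiTensorProduct.tprod k v ⊗ₜ
      PiTensorProduct.tprod k w) = PiTensorProduct.tprod k (Fin.append v w) :=
  TensorPower.tprod_mul_tprod k v w

lemma mulEquiv_ext {m n : ℕ} {V W : Type u} [AddCommGroup V] [Module k V] [AddCommGroup W]
    [Module k W] {f g : (⨂[k] _ : Fin m, V) ⊗[k] (⨂[k] _ : Fin n, V) →ₗ[k] W}
    (h : ∀ v w, f (PiTensorProduct.tprod k v ⊗ₜ PiTensorProduct.tprod k w) =
      g (PiTensorProduct.tprod k v ⊗ₜ PiTensorProduct.tprod k w)) : f = g := by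
  refine TensorProduct.ext (PiTensorProduct.ext (MultilinearMap.ext fun v => ?_))
  refine PiTensorProduct.ext (MultilinearMap.ext fun w => ?_)
  exact h v w

/-- The identification `V^{⊗m} ⊗ V^{⊗n} ≃ V^{⊗(m+n)}`. -/
def tensorPowMul (m n : ℕ) (V : FDRep k G) :
    (tensorPow k G m).obj V ⊗[k] (tensorPow k G n).obj V ≃ₗ[k] (tensorPow k G (m + n)).obj V :=
  (TensorPower.mulEquiv : (⨂[k] _ : Fin m, V) ⊗[k] (⨂[k] _ : Fin n, V) ≃ₗ[k] ⨂[k] _ : Fin (m + n), V)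

lemma tensorPowMul_equivariant (m n : ℕ) (V : FDRep k G) (g : Wreath G m × Wreath G n)
    (t : (tensorPow k G m).obj V ⊗[k] (tensorPow k G n).obj V) :
    tensorPowMul m n V (extTensor ((tensorPow k G m).obj V) ((tensorPow k G n).obj V) g t) =
      ((tensorPow k G (m + n)).obj V).ρ (wreathIncl G m n g) (tensorPowMul m n V t) := by
  refine LinearMap.congr_fun (f := TensorPower.mulEquiv.toLinearMap ∘ₗ
      TensorProduct.map (tensorPowRep m V g.1) (tensorPowRep n V g.2))
    (g := tensorPowRep (m + n) V (wreathIncl G m n g) ∘ₗ TensorPower.mulEquiv.toLinearMap)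
    (mulEquiv_ext fun v w => ?_) t
  change TensorPower.mulEquiv (tensorPowRep m V g.1 (PiTensorProduct.tprod k v) ⊗ₜ
    tensorPowRep n V g.2 (PiTensorProduct.tprod k w)) =
      tensorPowRep (m + n) V (wreathIncl G m n g) (TensorPower.mulEquiv
        (PiTensorProduct.tprod k v ⊗ₜ PiTensorProduct.tprod k w))
  rw [tensorPowRep_tprod, tensorPowRep_tprod, mulEquiv_tprod, mulEquiv_tprod, tensorPowRep_tprod]
  congr 1
  funext i
  refine Fin.addCases (fun i => ?_) (fun i => ?_) i <;>
    simp [wreathIncl, Equiv.Perm.inv_def, Equiv.permCongr, Equiv.equivCongr]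

lemma tensorPowMul_natural (m n : ℕ) {V W : FDRep k G} (f : V ⟶ W) :
    (tensorPowMul m n W).toLinearMap ∘ₗ TensorProduct.map (lin ((tensorPow k G m).map f))
      (lin ((tensorPow k G n).map f)) =
      lin ((tensorPow k G (m + n)).map f) ∘ₗ (tensorPowMul m n V).toLinearMap := by
  refine mulEquiv_ext fun v w => ?_
  change TensorPower.mulEquiv (PiTensorProduct.map (fun _ => lin f) (PiTensorProduct.tprod k v) ⊗ₜ
    PiTensorProduct.map (fun _ => lin f) (PiTensorProduct.tprod k w)) =
      PiTensorProduct.map (fun _ => lin f) (TensorPower.mulEquiv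
        (PiTensorProduct.tprod k v ⊗ₜ PiTensorProduct.tprod k w))
  rw [PiTensorProduct.map_tprod, PiTensorProduct.map_tprod, mulEquiv_tprod, mulEquiv_tprod,
    PiTensorProduct.map_tprod]
  congr 1
  funext i
  refine Fin.addCases (fun i => ?_) (fun i => ?_) i <;> simp

/-- Induction products correspond to tensor products of polynomial functors. -/
theorem char_polyOfRep_indProd [CharZero k] [Finite G] {m n : ℕ} (ρ : FDRep k (Wreath G m)) (σ : FDRep k (Wreath G n)) :
    PolyFunctor.char (polyOfRep (indProd ρ σ)) =
      PolyFunctor.char (polyOfRep ρ) * PolyFunctor.char (polyOfRep σ) := by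
  funext ⟨V, f⟩
  -- Frobenius reciprocity gives Hom(ρ, V^{⊗m}) ⊗ Hom(σ, V^{⊗n}) ≅ Hom(Ind(ρ ⊠ σ), V^{⊗(m+n)}),
  -- naturally in V, and the trace of a tensor product of maps is the product of traces.
  let e := LinearEquiv.ofBijective (indPair (ρ := ρ) (σ := σ) (tensorPowMul m n V)
      (tensorPowMul_equivariant m n V))
    ⟨indPair_injective _ _, indPair_surjective _ _⟩
  have he : ∀ t, e (TensorProduct.map (Linear.rightComp k ρ ((tensorPow k G m).map f))
      (Linear.rightComp k σ ((tensorPow k G n).map f)) t) =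
      Linear.rightComp k _ ((tensorPow k G (m + n)).map f) (e t) := by
    intro t
    induction t using TensorProduct.induction_on with
    | zero => simp only [map_zero]
    | tmul a b =>
      refine indRestrict_injective ?_
      refine (indRestrict_indPair_tmul _ _ (a ≫ (tensorPow k G m).map f)
        (b ≫ (tensorPow k G n).map f)).trans ?_
      rw [lin_comp, lin_comp, TensorProduct.map_comp, ← LinearMap.comp_assoc, tensorPowMul_natural,
        LinearMap.comp_assoc, ← indRestrict_indPair_tmul _ (tensorPowMul_equivariant m n V)]
      rfl
    | add s t hs ht => simp only [map_add, hs, ht]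
  have h1 : Linear.rightComp k (indTensor (wreathIncl G m n) ρ σ) ((tensorPow k G (m + n)).map f) =
      e.conj (TensorProduct.map (Linear.rightComp k ρ ((tensorPow k G m).map f))
        (Linear.rightComp k σ ((tensorPow k G n).map f))) := by
    refine LinearMap.ext fun x => ?_
    obtain ⟨t, rfl⟩ := e.surjective x
    rw [LinearEquiv.conj_apply_apply, LinearEquiv.symm_apply_apply, he]
  refine (congrArg (LinearMap.trace k (indTensor (wreathIncl G m n) ρ σ ⟶
    (tensorPow k G (m + n)).obj V)) h1).trans ?_
  rw [LinearMap.trace_conj', LinearMap.trace_tensorProduct']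
  rfl

end CharInd

/-! ### The PSH algebra of characters -/

section SplitSemisimple

variable {k : Type u} [Field k] {C : Type v} [Category.{v'} C] [Preadditive C] [Linear k C]
  {I : Type w} {a : I → C}

/-- The multiplicities of the simple objects, as natural numbers. -/
def IsSplitSemisimple.natMult (h : IsSplitSemisimple k a) (X : C) : I →₀ ℕ :=
  (h.mult X).mapRange Int.toNat rfl

lemma IsSplitSemisimple.natMult_apply (h : IsSplitSemisimple k a) (X : C) (i : I) :
    h.natMult X i = Module.finrank k (a i ⟶ X) := by
  rw [natMult, Finsupp.mapRange_apply, h.mult_apply, Int.toNat_natCast]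

lemma SplitAdditive.comp_addHom {A B : Type*} [AddCommGroup A] [AddCommGroup B] {f : C → A}
    (hf : SplitAdditive f) (φ : A →+ B) : SplitAdditive fun X => φ (f X) := fun S hS => by
  simp only [hf S hS, map_add]

variable [Limits.HasBinaryBiproducts C] [Limits.HasZeroObject C]

lemma IsSplitSemisimple.splitAdditive_ext (h : IsSplitSemisimple k a) {A : Type*} [AddCommGroup A]
    {f g : C → A} (hf : SplitAdditive f) (hg : SplitAdditive g) (hfg : ∀ i, f (a i) = g (a i))
    (X : C) : f X = g X := by
  rw [h.splitAdditive_eq hf, h.splitAdditive_eq hg]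
  simp only [hfg]

/-- This reconciles products, which count maps from a simple object, with coproducts, which count
maps to it. -/
lemma IsSplitSemisimple.finrank_hom_simple (h : IsSplitSemisimple k a) (X : C) (i : I) :
    Module.finrank k (X ⟶ a i) = Module.finrank k (a i ⟶ X) := by
  classical
  have e := h.finrank_hom_eq X (a i)
  simp only [mult_simple, Finsupp.single_apply] at e
  rw [Finsupp.sum, Finset.sum_eq_single i] at e
  · rw [if_pos rfl, mul_one, h.mult_apply] at e
    exact_mod_cast e
  · intro j _ hj
    rw [if_neg hj.symm, mul_zero]
  · intro hi
    rw [Finsupp.notMem_support_iff.1 hi, zero_mul]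

lemma IsSplitSemisimple.splitAdditive_eq_natMult (h : IsSplitSemisimple k a) {A : Type*}
    [AddCommGroup A] {f : C → A} (hf : SplitAdditive f) (X : C) :
    f X = (h.natMult X).sum fun i n => n • f (a i) := by
  rw [h.splitAdditive_eq hf, natMult, Finsupp.sum_mapRange_index (h := fun i n => n • f (a i)) (fun _ => zero_smul _ _)]
  refine Finset.sum_congr rfl fun i _ => ?_
  simp only [h.mult_apply, Int.toNat_natCast]
  exact natCast_zsmul _ _

end SplitSemisimple

/-! ### The degree 0 part. -/

section Unit

variable {k : Type u} [Field k] {G : Type u} [Group G]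

variable (k G) in
/-- The trivial representation of `S₀[G]`. -/
abbrev trivialZero : FDRep k (Wreath G 0) :=
  FDRep.of (Representation.trivial k (Wreath G 0) k)

instance : Subsingleton (Wreath G 0) :=
  ⟨fun _ _ => SemidirectProduct.ext (Subsingleton.elim _ _) (Subsingleton.elim _ _)⟩

/-- The equivariant map from the trivial representation of `S₀[G]` given by a vector. -/
def trivialZeroHom (V : FDRep k (Wreath G 0)) (x : V) : trivialZero k G ⟶ V :=
  mkHom (LinearMap.toSpanSingleton k V x) fun g y => by
    rw [Subsingleton.elim g 1, map_one, map_one]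
    rfl

lemma eq_trivialZeroHom {V : FDRep k (Wreath G 0)} (f : trivialZero k G ⟶ V) :
    f = trivialZeroHom V (lin f (1 : k)) :=
  lin_injective (LinearMap.ext_ring (by
    change lin f (1 : k) = (1 : k) • lin f (1 : k)
    rw [one_smul]))

lemma trivialZeroHom_smul (V : FDRep k (Wreath G 0)) (c : k) (x : V) :
    trivialZeroHom V (c • x) = c • trivialZeroHom V x :=
  lin_injective (LinearMap.ext_ring (by
    change (1 : k) • (c • x) = c • ((1 : k) • x)
    rw [one_smul, one_smul]))

/-- The tensor power V^{⊗0} is a line on which f^{⊗0} is the identity. -/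
lemma char_polyOfRep_trivialZero : PolyFunctor.char (polyOfRep (trivialZero k G)) = 1 := by
  funext ⟨V, f⟩
  let t : ⨂[k] _ : Fin 0, V := PiTensorProduct.tprod k fun i => i.elim0
  have ht : ∀ x : ⨂[k] _ : Fin 0, V, ∃ c : k, c • t = x := fun x => by
    refine ⟨PiTensorProduct.isEmptyEquiv (R := k) (Fin 0) x,
      (PiTensorProduct.isEmptyEquiv (R := k) (s := fun _ => (V : Type u)) (Fin 0)).injective ?_⟩
    rw [map_smul, smul_eq_mul]
    simp [t]
  have ht0 : t ≠ 0 := fun h => by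
    have := congrArg (PiTensorProduct.isEmptyEquiv (R := k) (s := fun _ => (V : Type u)) (Fin 0)) h
    simp [t] at this
  have h1 : Module.finrank k (trivialZero k G ⟶ (tensorPow k G 0).obj V) = 1 := by
    refine finrank_eq_one (trivialZeroHom ((tensorPow k G 0).obj V) t) (fun h => ht0 ?_) fun w => ?_
    · have h2 := LinearMap.congr_fun (congrArg lin h) (1 : k)
      rw [← one_smul k t]
      exact h2
    · obtain ⟨c, hc⟩ := ht (lin w (1 : k))
      refine ⟨c, ?_⟩
      refine (trivialZeroHom_smul ((tensorPow k G 0).obj V) c t).symm.trans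
        (Eq.trans ?_ (eq_trivialZeroHom w).symm)
      exact congrArg _ hc
  have h2 : (tensorPow k G 0).map f = 𝟙 _ := by
    refine lin_injective (PiTensorProduct.ext (MultilinearMap.ext fun v => ?_))
    refine (PiTensorProduct.map_tprod (R := k) (fun _ : Fin 0 => lin f) v).trans ?_
    refine congrArg (PiTensorProduct.tprod k) (funext fun i => i.elim0)
  have h3 : Linear.rightComp k (trivialZero k G) ((tensorPow k G 0).map f) = LinearMap.id :=
    LinearMap.ext fun x => by
      rw [h2]
      exact Category.comp_id x
  have h4 : LinearMap.trace k (trivialZero k G ⟶ (tensorPow k G 0).obj V)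
      (Linear.rightComp k (trivialZero k G) ((tensorPow k G 0).map f)) = 1 := by
    rw [h3, LinearMap.trace_id, h1, Nat.cast_one]
  exact h4

variable [CharZero k] [Finite G]

/-- A summand of a one-dimensional representation has a nonzero scalar idempotent as projector,
which is therefore the identity. -/
lemma exists_unit (hk : IsSplittingField k G) :
    ∃ i : Irr k (Wreath G 0), Nonempty (i.rep ≅ trivialZero k G) := by
  have hss := isSplitSemisimple_of_splittingField (isSplittingField_wreath hk 0)
  obtain ⟨D⟩ := hss.dec (trivialZero k G)
  have hne : Nonempty D.T := by
    by_contra hT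
    rw [not_nonempty_iff] at hT
    have h := D.total
    rw [Finset.univ_eq_empty, Finset.sum_empty] at h
    exact one_ne_zero (α := k) (LinearMap.congr_fun (congrArg lin h) (1 : k)).symm
  obtain ⟨t⟩ := hne
  obtain ⟨c, hc⟩ : ∃ c : k, D.π t ≫ D.ι t = c • 𝟙 _ := by
    refine ⟨(lin (D.π t ≫ D.ι t) (1 : k) : k), lin_injective (LinearMap.ext_ring ?_)⟩
    exact (mul_one _).symm
  have h1 : (c - 1) • D.ι t = 0 := by
    have h2 : D.ι t ≫ D.π t ≫ D.ι t = c • D.ι t := by rw [hc, Linear.comp_smul, Category.comp_id]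
    rw [sub_smul, ← h2, ← Category.assoc, D.ι_π, Category.id_comp, one_smul, sub_self]
  have h3 : c = 1 := by
    rcases smul_eq_zero.1 h1 with h | h
    · exact sub_eq_zero.1 h
    · refine absurd (D.ι_π t) ?_
      rw [h, Limits.zero_comp]
      exact (hss.id_ne _).symm
  exact ⟨D.s t, ⟨⟨D.ι t, D.π t, D.ι_π t, by rw [hc, h3, one_smul]⟩⟩⟩

/-- The index of the unit. -/
def unitIrr (hk : IsSplittingField k G) : Irr k (Wreath G 0) := (exists_unit hk).choose

/-- The group S₀[G] is trivial, so every vector of a representation is the image of a map from the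
trivial one; this gives connectedness. -/
lemma eq_unitIrr (hk : IsSplittingField k G) (i : Irr k (Wreath G 0)) : i = unitIrr hk := by
  have hss := isSplitSemisimple_of_splittingField (isSplittingField_wreath hk 0)
  obtain ⟨e⟩ := (exists_unit hk).choose_spec
  by_contra hi
  refine hss.id_ne i (lin_injective (LinearMap.ext fun x => ?_))
  have h1 : e.hom ≫ trivialZeroHom i.rep x = 0 := hss.hom_zero (Ne.symm hi) _
  have h2 : trivialZeroHom i.rep x = 0 := by
    rw [← e.inv_hom_id_assoc (trivialZeroHom i.rep x), h1, Limits.comp_zero]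
  have h3 := LinearMap.congr_fun (congrArg lin h2) (1 : k)
  exact (one_smul k x).symm.trans h3

end Unit

/-! ### Additivity of the character of L_ρ in ρ. -/

section RepChar

variable {k : Type u} [Field k] {G : Type u} [Group G]

lemma splitAdditive_char_polyOfRep {n : ℕ} :
    SplitAdditive fun ρ : FDRep k (Wreath G n) => PolyFunctor.char (polyOfRep ρ) := by
  intro S hS
  funext ⟨V, f⟩
  let T := (tensorPow k G n).obj V
  let t : T ⟶ T := (tensorPow k G n).map f
  have key : ∀ {ρ σ : FDRep k (Wreath G n)} (a : ρ ⟶ σ) (b : σ ⟶ ρ), a ≫ b = 𝟙 ρ →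
      LinearMap.trace k (σ ⟶ T) (Linear.leftComp k T (b ≫ a) ∘ₗ Linear.rightComp k σ t) =
        LinearMap.trace k (ρ ⟶ T) (Linear.rightComp k ρ t) := by
    intro ρ σ a b hab
    have h1 : Linear.leftComp k T (b ≫ a) ∘ₗ Linear.rightComp k σ t =
        Linear.leftComp k T b ∘ₗ (Linear.leftComp k T a ∘ₗ Linear.rightComp k σ t) :=
      LinearMap.ext fun x => Category.assoc b a (x ≫ t)
    have h2 : (Linear.leftComp k T a ∘ₗ Linear.rightComp k σ t) ∘ₗ Linear.leftComp k T b =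
        Linear.rightComp k ρ t := LinearMap.ext fun x => by
      change a ≫ (b ≫ x) ≫ t = x ≫ t
      rw [Category.assoc, reassoc_of% hab]
    rw [h1, LinearMap.trace_comp_comm', h2]
  have h : Linear.rightComp k S.X₂ t = Linear.leftComp k T (hS.r ≫ S.f) ∘ₗ
      Linear.rightComp k S.X₂ t + Linear.leftComp k T (S.g ≫ hS.s) ∘ₗ Linear.rightComp k S.X₂ t :=
    LinearMap.ext fun x => by
      change x ≫ t = (hS.r ≫ S.f) ≫ x ≫ t + (S.g ≫ hS.s) ≫ x ≫ t
      rw [← Preadditive.add_comp, hS.id, Category.id_comp]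
  have h' := congrArg (LinearMap.trace k (S.X₂ ⟶ T)) h
  rw [map_add, key _ _ hS.f_r, key _ _ hS.s_g] at h'
  exact h'

end RepChar

/-! ### The common algebra of characters and the two identifications. -/

section CharAlgebra

open Limits ZeroObject

variable {k : Type u} [Field k] {G : Type u} [Group G]

lemma char_biprod_assoc (F : PolyFunctor k G) {U V W : FDRep k G} (f : U ⟶ U) (g : V ⟶ V)
    (h : W ⟶ W) : PolyFunctor.char F ⟨(U ⊞ V) ⊞ W, biprod.map (biprod.map f g) h⟩ =
      PolyFunctor.char F ⟨U ⊞ (V ⊞ W), biprod.map f (biprod.map g h)⟩ :=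
  PolyFunctor.char_eq_of_conj F (biprod.associator U V W) (biprod.associator_natural f g h)

lemma char_zero_biprod (F : PolyFunctor k G) {V : FDRep k G} (f : V ⟶ V) :
    PolyFunctor.char F ⟨(0 : FDRep k G) ⊞ V, biprod.map 0 f⟩ = PolyFunctor.char F ⟨V, f⟩ :=
  (PolyFunctor.char_eq_of_conj F (isoZeroBiprod (isZero_zero _)) (by simp)).symm

lemma char_biprod_zero (F : PolyFunctor k G) {V : FDRep k G} (f : V ⟶ V) :
    PolyFunctor.char F ⟨V ⊞ (0 : FDRep k G), biprod.map f 0⟩ = PolyFunctor.char F ⟨V, f⟩ :=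
  (PolyFunctor.char_eq_of_conj F (isoBiprodZero (isZero_zero _)) (by simp)).symm

variable [CharZero k] [Finite G]

/-- The characters of the simple polynomial functors. -/
def charData (hk : IsSplittingField k G) :
    CharData k (SimpleIndex k G) (Σ V : FDRep k G, (V ⟶ V)) where
  χ i := PolyFunctor.char (simplePoly i)
  indep := linearIndependent_char hk
  deg i := i.1
  finite_deg n := (finite_simpleIndex_le hk n).subset fun _ h => le_of_eq h
  unit := ⟨0, unitIrr hk⟩
  χ_unit := (splitAdditive_char_polyOfRep.of_iso (exists_unit hk).choose_spec.some).trans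
    char_polyOfRep_trivialZero
  deg_eq_zero := by
    rintro ⟨n, i⟩
    constructor
    · rintro rfl
      rw [eq_unitIrr hk i]
    · intro h
      exact congrArg Sigma.fst h
  N l := comulCoeff hk (simplePoly l)
  M i j := (isSplitSemisimple_poly hk).natMult (simplePoly i ⊗ simplePoly j)
  M_apply i j l := by
    rw [IsSplitSemisimple.natMult_apply, comulCoeff_apply,
      (isSplitSemisimple_poly hk).finrank_hom_simple]
  mul i j := by
    rw [← PolyFunctor.char_tensor]
    exact (isSplitSemisimple_poly hk).splitAdditive_eq_natMult PolyFunctor.splitAdditive_char _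
  deg_N l p h := degree_eq_of_finrank_ne_zero h
  plus x y := ⟨x.1 ⊞ y.1, biprod.map x.2 y.2⟩
  comul l x y := by
    rw [char_biprod hk]
    simp only [nsmul_eq_mul]
  assoc l x y z := char_biprod_assoc _ x.2 y.2 z.2
  zero := ⟨0, 0⟩
  χ_zero := by
    rintro ⟨n, i⟩ hi
    have hn : n ≠ 0 := by
      rintro rfl
      exact hi (by rw [eq_unitIrr hk i])
    -- Characters of positive degree vanish at zero, by scaling with the factor 0.
    have h := char_polyOfRep_smul i.rep (0 : k) (0 : (0 : FDRep k G) ⟶ 0)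
    rw [zero_pow hn, zero_mul, smul_zero] at h
    exact h
  zero_plus i x := char_zero_biprod _ x.2
  plus_zero i x := char_biprod_zero _ x.2

variable (hk : IsSplittingField k G)

/-- The identification of the Grothendieck group of polynomial functors. -/
def polyEquiv : K0 (PolyFunctor k G) ≃+ (charData hk).Alg :=
  (isSplitSemisimple_poly hk).k0Equiv.trans (charData hk).basis.repr.symm.toAddEquiv

lemma polyEquiv_cls (F : PolyFunctor k G) : polyEquiv hk (K0.cls F) =
    (charData hk).basis.repr.symm ((isSplitSemisimple_poly hk).mult F) :=
  congrArg (charData hk).basis.repr.symm ((isSplitSemisimple_poly hk).k0Equiv_cls F)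

lemma polyEquiv_simple (i : SimpleIndex k G) :
    polyEquiv hk (K0.cls (simplePoly i)) = (charData hk).basis i := by
  rw [polyEquiv_cls, IsSplitSemisimple.mult_simple, Module.Basis.repr_symm_single_one]

lemma splitAdditive_polyEquiv :
    SplitAdditive fun F : PolyFunctor k G => polyEquiv hk (K0.cls F) :=
  K0.splitAdditive_cls.comp_addHom (polyEquiv hk).toAddMonoidHom

lemma ev_polyEquiv (F : PolyFunctor k G) (x : Σ V : FDRep k G, (V ⟶ V)) :
    (charData hk).ev x (polyEquiv hk (K0.cls F)) = PolyFunctor.char F x := by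
  refine (isSplitSemisimple_poly hk).splitAdditive_ext
    ((splitAdditive_polyEquiv hk).comp_addHom ((charData hk).ev x).toRingHom.toAddMonoidHom)
    (PolyFunctor.splitAdditive_char.comp_addHom (Pi.evalAddMonoidHom (fun _ => k) x))
    (fun i => ?_) F
  change (charData hk).ev x (polyEquiv hk (K0.cls (simplePoly i))) =
    PolyFunctor.char (simplePoly i) x
  rw [polyEquiv_simple, CharData.ev_basis]
  rfl

include hk in
/-- The representations of the wreath products form split semisimple categories. -/
lemma isSplitSemisimple_wreath (n : ℕ) :
    IsSplitSemisimple k (Irr.rep : Irr k (Wreath G n) → FDRep k (Wreath G n)) :=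
  isSplitSemisimple_of_splittingField (isSplittingField_wreath hk n)

open Classical in
/-- The identification of the Grothendieck group of representations of wreath products. -/
def wreathEquiv : WreathK k G ≃+ (charData hk).Alg :=
  ((DFinsupp.mapRange.addEquiv fun n => (isSplitSemisimple_wreath hk n).k0Equiv).trans
    (sigmaFinsuppAddEquivDFinsupp (N := ℤ)).symm).trans (charData hk).basis.repr.symm.toAddEquiv

lemma wreathEquiv_simple {n : ℕ} (i : Irr k (Wreath G n)) :
    wreathEquiv hk (wreathCls i.rep) = (charData hk).basis ⟨n, i⟩ := by
  classical
  have h : sigmaFinsuppAddEquivDFinsupp.symm (DFinsupp.mapRange.addEquiv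
      (fun n => (isSplitSemisimple_wreath hk n).k0Equiv) (wreathCls i.rep)) =
      (Finsupp.single ⟨n, i⟩ 1 : SimpleIndex k G →₀ ℤ) := by
    rw [AddEquiv.symm_apply_eq]
    refine (DFinsupp.mapRange_single (f := fun n => (isSplitSemisimple_wreath hk n).k0Equiv)
      (hf := fun n => map_zero _)).trans ?_
    rw [IsSplitSemisimple.k0Equiv_cls, IsSplitSemisimple.mult_simple]
    exact (sigmaFinsuppEquivDFinsupp_single (⟨n, i⟩ : SimpleIndex k G) (1 : ℤ)).symm
  refine (congrArg (charData hk).basis.repr.symm h).trans ?_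
  rw [Module.Basis.repr_symm_single_one]

lemma splitAdditive_wreathEquiv (n : ℕ) :
    SplitAdditive fun ρ : FDRep k (Wreath G n) => wreathEquiv hk (wreathCls ρ) :=
  K0.splitAdditive_cls.comp_addHom ((wreathEquiv hk).toAddMonoidHom.comp
    (DirectSum.of (fun n : ℕ => K0 (FDRep k (Wreath G n))) n))

lemma ev_wreathEquiv {n : ℕ} (ρ : FDRep k (Wreath G n)) (x : Σ V : FDRep k G, (V ⟶ V)) :
    (charData hk).ev x (wreathEquiv hk (wreathCls ρ)) = PolyFunctor.char (polyOfRep ρ) x := by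
  refine (isSplitSemisimple_wreath hk n).splitAdditive_ext
    ((splitAdditive_wreathEquiv hk n).comp_addHom ((charData hk).ev x).toRingHom.toAddMonoidHom)
    (splitAdditive_char_polyOfRep.comp_addHom (Pi.evalAddMonoidHom (fun _ => k) x))
    (fun i => ?_) ρ
  change (charData hk).ev x (wreathEquiv hk (wreathCls i.rep)) = PolyFunctor.char (polyOfRep i.rep) x
  rw [wreathEquiv_simple, CharData.ev_basis]
  rfl

/-- Both classes are the same function, the character of L_ρ; this identity is the compatibility in
the theorem. -/
lemma wreathEquiv_eq_polyEquiv {n : ℕ} (ρ : FDRep k (Wreath G n)) :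
    wreathEquiv hk (wreathCls ρ) = polyEquiv hk (K0.cls (polyOfRep ρ)) :=
  (charData hk).ev_injective fun x => by rw [ev_wreathEquiv, ev_polyEquiv]

lemma inner_polyEquiv (F H : PolyFunctor k G) :
    (charData hk).inner (polyEquiv hk (K0.cls F)) (polyEquiv hk (K0.cls H)) =
      Module.finrank k (F ⟶ H) := by
  classical
  have hss := isSplitSemisimple_poly hk
  refine hss.splitAdditive_ext (f := fun F => (charData hk).inner (polyEquiv hk (K0.cls F))
    (polyEquiv hk (K0.cls H))) ((splitAdditive_polyEquiv hk).comp_addHom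
      ((charData hk).inner.flip (polyEquiv hk (K0.cls H))).toAddMonoidHom)
    (hss.splitAdditive_finrank_hom_left H) (fun i => ?_) F
  refine hss.splitAdditive_ext (f := fun H => (charData hk).inner
    (polyEquiv hk (K0.cls (simplePoly i))) (polyEquiv hk (K0.cls H)))
    ((splitAdditive_polyEquiv hk).comp_addHom
      ((charData hk).inner (polyEquiv hk (K0.cls (simplePoly i)))).toAddMonoidHom)
    (hss.splitAdditive_finrank_hom (simplePoly i)) (fun j => ?_) H
  simp only [polyEquiv_simple, CharData.inner_basis]
  split_ifs with hij
  · subst hij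
    rw [hss.finrank_end, Nat.cast_one]
  · rw [hss.finrank_ne hij, Nat.cast_zero]

lemma inner_wreathEquiv {n : ℕ} (ρ σ : FDRep k (Wreath G n)) :
    (charData hk).inner (wreathEquiv hk (wreathCls ρ)) (wreathEquiv hk (wreathCls σ)) =
      Module.finrank k (ρ ⟶ σ) := by
  classical
  have hss := isSplitSemisimple_wreath hk n
  refine hss.splitAdditive_ext (f := fun ρ => (charData hk).inner (wreathEquiv hk (wreathCls ρ))
    (wreathEquiv hk (wreathCls σ))) ((splitAdditive_wreathEquiv hk n).comp_addHom
      ((charData hk).inner.flip (wreathEquiv hk (wreathCls σ))).toAddMonoidHom)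
    (hss.splitAdditive_finrank_hom_left σ) (fun i => ?_) ρ
  refine hss.splitAdditive_ext (f := fun σ => (charData hk).inner
    (wreathEquiv hk (wreathCls i.rep)) (wreathEquiv hk (wreathCls σ)))
    ((splitAdditive_wreathEquiv hk n).comp_addHom
      ((charData hk).inner (wreathEquiv hk (wreathCls i.rep))).toAddMonoidHom)
    (hss.splitAdditive_finrank_hom i.rep) (fun j => ?_) σ
  simp only [wreathEquiv_simple, CharData.inner_basis]
  split_ifs with hij
  · obtain rfl : i = j := by simpa using hij
    rw [hss.finrank_end, Nat.cast_one]
  · rw [hss.finrank_ne (fun h => hij (by rw [h])), Nat.cast_zero]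

lemma inner_wreathEquiv_of_ne {m n : ℕ} (ρ : FDRep k (Wreath G m)) (σ : FDRep k (Wreath G n))
    (hmn : m ≠ n) :
    (charData hk).inner (wreathEquiv hk (wreathCls ρ)) (wreathEquiv hk (wreathCls σ)) = 0 := by
  rw [wreathEquiv_eq_polyEquiv, wreathEquiv_eq_polyEquiv, inner_polyEquiv, Nat.cast_eq_zero]
  have : Subsingleton (polyOfRep ρ ⟶ polyOfRep σ) := subsingleton_of_forall_eq 0
    (IsHomogeneous.hom_eq_zero hmn (isHomogeneous_polyOfRep ρ) (isHomogeneous_polyOfRep σ))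
  exact Module.finrank_zero_of_subsingleton

/-- There are no nonzero maps between homogeneous functors of different degrees, so only simple
functors of degree n occur in `F`. -/
lemma polyEquiv_mem_grade {n : ℕ} {F : PolyFunctor k G} (hF : IsHomogeneous n F) :
    polyEquiv hk (K0.cls F) ∈ (charData hk).grade n := by
  rw [(isSplitSemisimple_poly hk).splitAdditive_eq (splitAdditive_polyEquiv hk) F]
  refine Submodule.sum_mem _ fun i hi => Submodule.smul_mem _ _ ?_
  rw [polyEquiv_simple, CharData.basis_mem_grade_iff]
  by_contra hne
  refine Finsupp.mem_support_iff.1 hi ?_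
  have : Subsingleton (simplePoly i ⟶ F) := subsingleton_of_forall_eq 0
    (IsHomogeneous.hom_eq_zero hne (isHomogeneous_simplePoly i) hF)
  rw [IsSplitSemisimple.mult_apply, Module.finrank_zero_of_subsingleton, Nat.cast_zero]

lemma polyEquiv_unit : polyEquiv hk (K0.cls (𝟙_ (PolyFunctor k G))) = 1 :=
  (charData hk).ev_injective fun x => by
    rw [ev_polyEquiv, PolyFunctor.char_unit, map_one, Pi.one_apply]

lemma polyEquiv_mul (F H : PolyFunctor k G) :
    polyEquiv hk (K0.cls F) * polyEquiv hk (K0.cls H) = polyEquiv hk (K0.cls (F ⊗ H)) :=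
  (charData hk).ev_injective fun x => by
    rw [map_mul, ev_polyEquiv, ev_polyEquiv, ev_polyEquiv, PolyFunctor.char_tensor, Pi.mul_apply]

lemma grade_eq_span_polyEquiv (n : ℕ) : (charData hk).grade n = Submodule.span ℤ
    {x | ∃ F : PolyFunctor k G, IsHomogeneous n F ∧ x = polyEquiv hk (K0.cls F)} := by
  refine le_antisymm (Submodule.span_le.2 ?_) (Submodule.span_le.2 ?_)
  · rintro _ ⟨i, rfl, rfl⟩
    exact Submodule.subset_span ⟨simplePoly i, isHomogeneous_simplePoly i,
      (polyEquiv_simple hk i).symm⟩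
  · rintro _ ⟨F, hF, rfl⟩
    exact polyEquiv_mem_grade hk hF

lemma range_basis_eq_polyEquiv : Set.range (charData hk).basis =
    {x | ∃ F : PolyFunctor k G, Simple F ∧ x = polyEquiv hk (K0.cls F)} := by
  refine Set.Subset.antisymm ?_ ?_
  · rintro _ ⟨i, rfl⟩
    exact ⟨simplePoly i, (isSplitSemisimple_poly hk).simple i, (polyEquiv_simple hk i).symm⟩
  · rintro _ ⟨F, hF, rfl⟩
    obtain ⟨i, ⟨e⟩⟩ := (isSplitSemisimple_poly hk).exists_iso_of_simple F
    exact ⟨i, (polyEquiv_simple hk i).symm.trans ((splitAdditive_polyEquiv hk).of_iso e)⟩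

theorem isPolyPSH : IsPolyPSH (charData hk).pshAlgebra (polyEquiv hk) where
  one := polyEquiv_unit hk
  mul := polyEquiv_mul hk
  inner := inner_polyEquiv hk
  grade := grade_eq_span_polyEquiv hk
  basis := range_basis_eq_polyEquiv hk

lemma wreathEquiv_trivialZero : wreathEquiv hk (wreathCls (trivialZero k G)) = 1 :=
  (charData hk).ev_injective fun x => by
    rw [ev_wreathEquiv, char_polyOfRep_trivialZero, map_one, Pi.one_apply]

lemma wreathEquiv_mul {m n : ℕ} (ρ : FDRep k (Wreath G m)) (σ : FDRep k (Wreath G n)) :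
    wreathEquiv hk (wreathCls ρ) * wreathEquiv hk (wreathCls σ) =
      wreathEquiv hk (wreathCls (indProd ρ σ)) :=
  (charData hk).ev_injective fun x => by
    rw [map_mul, ev_wreathEquiv, ev_wreathEquiv, ev_wreathEquiv, char_polyOfRep_indProd,
      Pi.mul_apply]

lemma grade_eq_span_wreathEquiv (n : ℕ) : (charData hk).grade n = Submodule.span ℤ
    {x | ∃ ρ : FDRep k (Wreath G n), x = wreathEquiv hk (wreathCls ρ)} := by
  refine le_antisymm (Submodule.span_le.2 ?_) (Submodule.span_le.2 ?_)
  · rintro _ ⟨i, rfl, rfl⟩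
    exact Submodule.subset_span ⟨i.2.rep, (wreathEquiv_simple hk i.2).symm⟩
  · rintro _ ⟨ρ, rfl⟩
    rw [wreathEquiv_eq_polyEquiv]
    exact polyEquiv_mem_grade hk (isHomogeneous_polyOfRep ρ)

lemma range_basis_eq_wreathEquiv : Set.range (charData hk).basis =
    {x | ∃ (n : ℕ) (ρ : FDRep k (Wreath G n)), Simple ρ ∧ x = wreathEquiv hk (wreathCls ρ)} := by
  refine Set.Subset.antisymm ?_ ?_
  · rintro _ ⟨i, rfl⟩
    exact ⟨i.1, i.2.rep, inferInstance, (wreathEquiv_simple hk i.2).symm⟩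
  · rintro _ ⟨n, ρ, hρ, rfl⟩
    obtain ⟨i, ⟨e⟩⟩ := (isSplitSemisimple_wreath hk n).exists_iso_of_simple ρ
    exact ⟨⟨n, i⟩, (wreathEquiv_simple hk i).symm.trans
      ((splitAdditive_wreathEquiv hk n).of_iso e)⟩

theorem isWreathPSH : IsWreathPSH (charData hk).pshAlgebra (wreathEquiv hk) where
  one := wreathEquiv_trivialZero hk
  mul := wreathEquiv_mul hk
  inner := inner_wreathEquiv hk
  inner_of_ne := inner_wreathEquiv_of_ne hk
  grade := grade_eq_span_wreathEquiv hk
  basis := range_basis_eq_wreathEquiv hk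

end CharAlgebra

end PSH

end

theorem mainTheorem7 (k : Type u) [Field k] [CharZero k] (G : Type u) [Group G] [Finite G]
    (hk : PSH.IsSplittingField k G) :
    ∃ (R P : PSH.PSHAlgebra.{u + 1}) (clR : PSH.WreathK k G ≃+ R)
      (clP : PSH.K0 (PSH.PolyFunctor k G) ≃+ P),
      PSH.IsWreathPSH R clR ∧ PSH.IsPolyPSH P clP ∧
      ∃ Φ : PSH.PSHHom R P,
        (∀ (n : ℕ) (ρ : FDRep k (PSH.Wreath G n)),
          Φ (clR (PSH.wreathCls ρ)) = clP (PSH.K0.cls (PSH.polyOfRep ρ))) ∧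
        Φ.IsIsomorphism :=
  -- One algebra serves for both sides, with the content in the two identifications.
  ⟨(PSH.charData hk).pshAlgebra, (PSH.charData hk).pshAlgebra, PSH.wreathEquiv hk,
    PSH.polyEquiv hk, PSH.isWreathPSH hk, PSH.isPolyPSH hk, PSH.PSHHom.id _,
    fun _ ρ => PSH.wreathEquiv_eq_polyEquiv hk ρ, PSH.PSHHom.isIsomorphism_id _⟩
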